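/- **Conventions.** A pointed monoid is a commutative monoid $B$ with $1$ and an absorbing element $0$; its ambient semiring $B^+$ is the free semiring $\mathbb N[B]$ modulo the identification of $0\in B$ with the empty sum. A band is a pointed monoid $B$ with an ideal $N_B\subset B^+$ (the null set) such that for each $a\in B$ there is a unique $b=:-a\in B$ with $a+b\in N_B$. A band morphism is a morphism of pointed monoids $f:B\to C$ such that the induced map $f^+:B^+\to C^+$ satisfies $f^+(N_B)\subset N_C$. A prime $m$-ideal of $B$ is a subset $\mathfrak p\subset B$ with $0\in\mathfrak p$ and $B\cdot\mathfrak p\subset\mathfrak p$ whose complement is a multiplicative set (contains $1$ and is closed under products). $\operatorname{Spec}B$ is the space of prime $m$-ideals, with the topology generated by $U_h=\{\mathfrak p\mid h\notin\mathfrak p\}$ ($h\in B$) and the structure sheaf with $\mathcal O(U_h)=B[h^{-1}]$. A band space is a topological space with a sheaf of bands; a morphism of band spaces is a continuous map together with a morphism of sheaves whose stalk maps send non-units to non-units. A band scheme is a band space that is locally isomorphic to spectra of bands; $\mathrm{BSch}$ is the resulting full subcategory and $\underline{(-)}:\mathrm{BSch}\to\mathrm{Top}$ sends a band scheme to its underlying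 space. An open immersion is a morphism that restricts to an isomorphism onto an open subscheme. A closed immersion is a morphism $\iota:Y\to X$ such that for every affine open $U\subset X$ the open $\iota^{-1}(U)$ is affine and $\mathcal O_X(U)\to\mathcal O_Y(\iota^{-1}(U))$ is surjective. An affine presentation of $X$ is a small diagram $\mathcal U$ of affine band schemes and open immersions with an isomorphism $\operatorname{colim}\mathcal U\simeq X$ (colimit in $\mathrm{BSch}$) such that all canonical maps $U\to X$, $U\in\mathcal U$, are open immersions. A null ideal of $B$ is an ideal $I$ of $B^+$ that contains $N_B$ and satisfies: if $a-c\in I$ and $c+\sum b_j\in I$, then $a+\sum b_j\in I$ (for $a,c,b_j\in B$). It is prime if $B^+\setminus I$ is a multiplicative set. Let $\mathrm{Null}(B)$ be the set of prime null ideals of $B$ with the topology generated by the sets $\{\mathfrak p\mid h\notin\mathfrak p\}$, $h\in B^+$. Sending $f:B\to C$ to $\mathfrak p\mapsto(f^+)^{-1}(\mathfrak p)$ makes $\mathrm{Null}$ a contravariant functor from bands to topological spaces, and $\mathfrak p\mapsto\mathfrak p\cap B$ defines a natural transformation $\bar\pi:\mathrm{Null}\to\underline{(-)}\circ\operatorname{Spec}$.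 **Theorem.** There is a functor $(-)^{\mathrm{null}}:\mathrm{BSch}\to\mathrm{Top}$, together with a natural transformation $\pi:(-)^{\mathrm{null}}\to\underline{(-)}$ and a natural isomorphism $\eta:\mathrm{Null}\to(-)^{\mathrm{null}}\circ\operatorname{Spec}$, with the following properties: 1. $\bar\pi=\pi\circ\eta$, i.e. $\bar\pi_B=\pi_{\operatorname{Spec}B}\circ\eta_B$ for every band $B$. 2. Every affine presentation $\operatorname{colim}\mathcal U\simeq X$ induces a homeomorphism $\operatorname{colim}\mathcal U^{\mathrm{null}}\to X^{\mathrm{null}}$. 3. Every open (resp. closed) immersion $\iota:Y\to X$ induces an open (resp. closed) topological embedding $Y^{\mathrm{null}}\to X^{\mathrm{null}}$. The triple $((-)^{\mathrm{null}},\pi,\eta)$ is unique up to unique isomorphism: for any other triple $(N',\pi',\eta')$ with properties 1--3 there is exactly one natural isomorphism $\alpha:(-)^{\mathrm{null}}\to N'$ with $\pi'\circ\alpha=\pi$ and $\alpha_{\operatorname{Spec}}\circ\eta=\eta'$. -/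

import Mathlib

open CategoryTheory TopologicalSpace Opposite Topology

universe u

namespace BandTheory

noncomputable section

/-! ### The ambient semiring of a pointed monoid -/

section Ambient

/-- The relation on `ℕ[B]` that identifies the zero of `B` with the empty sum. -/
inductive ZeroRel (B : Type u) [CommMonoidWithZero B] :
    MonoidAlgebra ℕ B → MonoidAlgebra ℕ B → Prop
  | zero : ZeroRel B (MonoidAlgebra.of ℕ B 0) 0

/-- The ambient semiring `B⁺` of a pointed monoid `B`: the free semiring `ℕ[B]` modulo the
identification of `0 ∈ B` with the empty sum. -/
def Ambient (B : Type u) [CommMonoidWithZero B] : Type u := RingQuot (ZeroRel B)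

instance (B : Type u) [CommMonoidWithZero B] : CommSemiring (Ambient B) :=
  inferInstanceAs (CommSemiring (RingQuot (ZeroRel B)))

variable {B C D : Type u} [CommMonoidWithZero B] [CommMonoidWithZero C] [CommMonoidWithZero D]

/-- The canonical map `B → B⁺`. -/
def Ambient.of (B : Type u) [CommMonoidWithZero B] : B →*₀ Ambient B where
  toFun b := RingQuot.mkRingHom (ZeroRel B) (MonoidAlgebra.of ℕ B b)
  map_zero' := (RingQuot.mkRingHom_rel ZeroRel.zero).trans (map_zero _)
  map_one' := by rw [map_one, map_one]; rfl
  map_mul' a b := by rw [map_mul, map_mul]; rfl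

/-- The universal property of `B⁺`. -/
def Ambient.lift {S : Type*} [CommSemiring S] (f : B →*₀ S) : Ambient B →+* S :=
  RingQuot.lift ⟨(MonoidAlgebra.lift ℕ S B f.toMonoidHom).toRingHom, by
    rintro _ _ ⟨⟩
    simp⟩

@[simp]
theorem Ambient.lift_of {S : Type*} [CommSemiring S] (f : B →*₀ S) (b : B) :
    Ambient.lift f (Ambient.of B b) = f b := by
  refine (RingQuot.lift_mkRingHom_apply _ _ _).trans ?_
  simp

theorem Ambient.hom_ext {S : Type*} [CommSemiring S] {f g : Ambient B →+* S}
    (h : ∀ b, f (Ambient.of B b) = g (Ambient.of B b)) : f = g := by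
  refine RingQuot.ringQuot_ext f g ?_
  refine MonoidAlgebra.ringHom_ext (fun r => ?_) (fun a => h a)
  have : (MonoidAlgebra.single 1 r : MonoidAlgebra ℕ B) = (r : MonoidAlgebra ℕ B) := rfl
  rw [this, map_natCast, map_natCast]

/-- Every element of `B⁺` is a finite sum of elements of `B`. -/
theorem Ambient.induction {P : Ambient B → Prop} (h0 : P 0)
    (hadd : ∀ b x, P x → P (Ambient.of B b + x)) (x : Ambient B) : P x := by
  let m : MonoidAlgebra ℕ B →+* Ambient B := RingQuot.mkRingHom (ZeroRel B)
  obtain ⟨x, rfl⟩ : ∃ y, m y = x := RingQuot.mkRingHom_surjective (ZeroRel B) x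
  suffices h : ∀ y, P y → P (m x + y) by simpa using h 0 h0
  induction x using MonoidAlgebra.induction_linear with
  | zero => intro y hy; rwa [map_zero, zero_add]
  | add f g hf hg => intro y hy; rw [map_add, add_assoc]; exact hf _ (hg _ hy)
  | single b n =>
    intro y hy
    induction n with
    | zero => rwa [MonoidAlgebra.single_zero, map_zero, zero_add]
    | succ n ih =>
      rw [add_comm n 1, MonoidAlgebra.single_add, map_add, add_assoc]
      exact hadd b _ ih

/-- The semiring homomorphism `f⁺ : B⁺ → C⁺`. -/
def Ambient.map (f : B →*₀ C) : Ambient B →+* Ambient C :=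
  Ambient.lift ((Ambient.of C).comp f)

@[simp]
theorem Ambient.map_of (f : B →*₀ C) (b : B) :
    Ambient.map f (Ambient.of B b) = Ambient.of C (f b) :=
  Ambient.lift_of _ _

theorem Ambient.map_id : Ambient.map (MonoidWithZeroHom.id B) = RingHom.id (Ambient B) :=
  Ambient.hom_ext fun b => by simp

theorem Ambient.map_comp (g : C →*₀ D) (f : B →*₀ C) :
    Ambient.map (g.comp f) = (Ambient.map g).comp (Ambient.map f) :=
  Ambient.hom_ext fun b => by simp

end Ambient

/-! ### Bands -/

/-- A band: a pointed monoid `B` with an ideal (the null set) of `B⁺` such that every element of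
`B` has a unique additive inverse in `B`. -/
class Band (B : Type u) extends CommMonoidWithZero B where
  nullSet : Ideal (Ambient B)
  existsUnique_add_mem : ∀ a : B, ∃! b : B, Ambient.of B a + Ambient.of B b ∈ nullSet

/-- The null set `N_B` of a band. -/
abbrev nullSet (B : Type u) [Band B] : Ideal (Ambient B) := Band.nullSet

/-- The additive inverse of an element of a band. -/
def negB {B : Type u} [Band B] (a : B) : B := (Band.existsUnique_add_mem a).choose

section Band

variable {B C D : Type u} [Band B] [Band C] [Band D]

theorem add_neg_mem (a : B) : Ambient.of B a + Ambient.of B (negB a) ∈ nullSet B :=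
  (Band.existsUnique_add_mem a).choose_spec.1

theorem eq_neg {a b : B} (h : Ambient.of B a + Ambient.of B b ∈ nullSet B) : b = negB a :=
  (Band.existsUnique_add_mem a).choose_spec.2 b h

theorem mul_neg_eq (a b : B) : a * negB b = negB (a * b) := by
  apply eq_neg
  rw [map_mul, map_mul, ← mul_add]
  exact Ideal.mul_mem_left _ _ (add_neg_mem b)

/-- A band morphism: a morphism of pointed monoids `f` with `f⁺(N_B) ⊆ N_C`. -/
structure BandHom (B C : Type u) [Band B] [Band C] extends B →*₀ C where
  map_nullSet : ∀ x ∈ nullSet B, Ambient.map toMonoidWithZeroHom x ∈ nullSet C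

namespace BandHom

@[ext]
theorem ext {f g : BandHom B C} (h : ∀ b, f.toMonoidWithZeroHom b = g.toMonoidWithZeroHom b) :
    f = g := by
  cases f; cases g; congr; exact MonoidWithZeroHom.ext h

instance : FunLike (BandHom B C) B C where
  coe f := f.toMonoidWithZeroHom
  coe_injective _ _ h := ext fun b => congrFun h b

instance : MonoidWithZeroHomClass (BandHom B C) B C where
  map_mul f := f.map_mul'
  map_one f := f.map_one'
  map_zero f := f.map_zero'

/-- The identity morphism. -/
def id (B : Type u) [Band B] : BandHom B B where
  toMonoidWithZeroHom := MonoidWithZeroHom.id B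
  map_nullSet x hx := by rw [Ambient.map_id]; exact hx

/-- Composition of band morphisms. -/
def comp (g : BandHom C D) (f : BandHom B C) : BandHom B D where
  toMonoidWithZeroHom := g.toMonoidWithZeroHom.comp f.toMonoidWithZeroHom
  map_nullSet x hx := by
    rw [Ambient.map_comp]; exact g.map_nullSet _ (f.map_nullSet _ hx)

/-- The induced semiring homomorphism `f⁺ : B⁺ → C⁺`. -/
def plus (f : BandHom B C) : Ambient B →+* Ambient C := Ambient.map f.toMonoidWithZeroHom

theorem map_neg (f : BandHom B C) (a : B) : f (negB a) = negB (f a) := by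
  apply eq_neg
  have := f.map_nullSet _ (add_neg_mem a)
  rwa [map_add, Ambient.map_of, Ambient.map_of] at this

end BandHom

end Band

/-- The category of bands. -/
structure BandCat : Type (u + 1) where
  carrier : Type u
  [band : Band carrier]

attribute [instance] BandCat.band

namespace BandCat

instance : CoeSort BandCat.{u} (Type u) := ⟨BandCat.carrier⟩

instance : Category BandCat.{u} where
  Hom B C := BandHom B C
  id B := BandHom.id B
  comp f g := BandHom.comp g f

instance : ConcreteCategory BandCat.{u} (fun B C => BandHom B C) where
  hom f := f
  ofHom f := f

/-- The multiplicative monoid of a band. -/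
def toMon : BandCat.{u} ⥤ MonCat.{u} where
  obj B := MonCat.of B
  map f := MonCat.ofHom (BandHom.toMonoidWithZeroHom f).toMonoidHom

end BandCat

/-! ### Localizations -/

section Localization

variable {B : Type u} [Band B] (S : Submonoid B)

/-- The localization map `B → S⁻¹B` of pointed monoids. -/
def locMap : B →*₀ Localization S where
  toFun a := Localization.mk a 1
  map_zero' := Localization.mk_zero 1
  map_one' := Localization.mk_one
  map_mul' a b := by rw [Localization.mk_mul, one_mul]

theorem mk_eq_mul (a : B) (s : S) :
    Localization.mk a s = Localization.mk 1 s * locMap S a := by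
  change _ = _ * Localization.mk a 1
  rw [Localization.mk_mul, one_mul, mul_one]

theorem locMap_mul_mk (a : B) (s : S) : locMap S s * Localization.mk a s = locMap S a := by
  change Localization.mk _ _ * _ = Localization.mk _ _
  rw [Localization.mk_mul, Localization.mk_eq_mk_iff, Localization.r_iff_exists]
  exact ⟨1, by simp [mul_comm]⟩

theorem exists_mul_eq_of_map_eq {x y : Ambient B}
    (h : Ambient.map (locMap S) x = Ambient.map (locMap S) y) :
    ∃ s : S, Ambient.of B s * x = Ambient.of B s * y := by
  let T : Submonoid (Ambient B) := S.map (Ambient.of B).toMonoidHom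
  let g : B →*₀ Localization T := (algebraMap (Ambient B) (Localization T)).toMonoidWithZeroHom.comp
    (Ambient.of B)
  have hg : ∀ s : S, IsUnit (g s) := fun s =>
    IsLocalization.map_units (Localization T) (⟨Ambient.of B s, s, s.2, rfl⟩ : T)
  let ψ : Ambient (Localization S) →+* Localization T :=
    Ambient.lift ((Localization.monoidOf S).lift₀ g hg)
  have hψ : ψ.comp (Ambient.map (locMap S)) = algebraMap (Ambient B) (Localization T) := by
    apply Ambient.hom_ext
    intro b
    simp only [RingHom.comp_apply, Ambient.map_of, ψ, Ambient.lift_of]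
    exact (Localization.monoidOf S).lift_eq hg b
  have h' := congrArg ψ h
  rw [← RingHom.comp_apply, ← RingHom.comp_apply, hψ] at h'
  obtain ⟨⟨_, s, hs, rfl⟩, hc⟩ := (IsLocalization.eq_iff_exists T (Localization T)).1 h'
  exact ⟨⟨s, hs⟩, hc⟩

theorem exists_mul_eq_map (r : Ambient (Localization S)) :
    ∃ (s : S) (x : Ambient B), Ambient.of _ (locMap S s) * r = Ambient.map (locMap S) x := by
  induction r using Ambient.induction with
  | h0 => exact ⟨1, 0, by simp⟩
  | hadd b x ih =>
    obtain ⟨s, x', hx'⟩ := ih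
    induction b using Localization.induction_on with
    | H p =>
      obtain ⟨a, t⟩ := p
      refine ⟨t * s, Ambient.of B (s * a) + Ambient.of B t * x', ?_⟩
      simp only [Submonoid.coe_mul, map_mul, map_add, Ambient.map_of, mul_add, ← hx',
        ← locMap_mul_mk S a t]
      ring

theorem exists_mul_eq_of_mem {z : Ambient (Localization S)}
    (hz : z ∈ (nullSet B).map (Ambient.map (locMap S))) :
    ∃ (s : S) (y : Ambient B), y ∈ nullSet B ∧
      Ambient.of _ (locMap S s) * z = Ambient.map (locMap S) y := by
  refine Submodule.span_induction ?_ ?_ ?_ ?_ hz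
  · rintro _ ⟨y, hy, rfl⟩
    exact ⟨1, y, hy, by simp⟩
  · exact ⟨1, 0, zero_mem _, by simp⟩
  · rintro x y - - ⟨s, a, ha, hs⟩ ⟨t, b, hb, ht⟩
    refine ⟨s * t, Ambient.of B t * a + Ambient.of B s * b,
      add_mem (Ideal.mul_mem_left _ _ ha) (Ideal.mul_mem_left _ _ hb), ?_⟩
    simp only [Submonoid.coe_mul, map_mul, map_add, Ambient.map_of, ← hs, ← ht]
    ring
  · rintro r x - ⟨s, a, ha, hs⟩
    obtain ⟨t, r', hr⟩ := exists_mul_eq_map S r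
    refine ⟨t * s, r' * a, Ideal.mul_mem_left _ _ ha, ?_⟩
    simp only [Submonoid.coe_mul, map_mul, ← hs, ← hr, smul_eq_mul]
    ring

/-- The localization `S⁻¹B`; its null set is the ideal of `(S⁻¹B)⁺` generated by the image of
`N_B`. -/
instance : Band (Localization S) where
  nullSet := (nullSet B).map (Ambient.map (locMap S))
  existsUnique_add_mem z := by
    induction z using Localization.induction_on with
    | H p =>
      obtain ⟨a, s⟩ := p
      refine ⟨Localization.mk (negB a) s, ?_, ?_⟩
      · beta_reduce
        rw [mk_eq_mul, mk_eq_mul S (negB a), map_mul, map_mul, ← mul_add, ← Ambient.map_of,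
          ← Ambient.map_of, ← map_add]
        exact Ideal.mul_mem_left _ _ (Ideal.mem_map_of_mem _ (add_neg_mem a))
      · intro w hw
        induction w using Localization.induction_on with
        | H q =>
          obtain ⟨b, t⟩ := q
          obtain ⟨v, y, hy, hv⟩ := exists_mul_eq_of_mem S hw
          have key : Ambient.map (locMap S)
              (Ambient.of B (v * t * a) + Ambient.of B (v * s * b)) =
              Ambient.map (locMap S) (Ambient.of B (s * t) * y) := by
            simp only [map_mul, map_add, Ambient.map_of, ← hv, ← locMap_mul_mk S a s,
              ← locMap_mul_mk S b t]
            ring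
          obtain ⟨w, hw⟩ := exists_mul_eq_of_map_eq S key
          have hmem : Ambient.of B (w * (v * t * a)) + Ambient.of B (w * (v * s * b)) ∈
              nullSet B := by
            rw [map_mul _ (w : B), map_mul _ (w : B), ← mul_add, hw]
            exact Ideal.mul_mem_left _ _ (Ideal.mul_mem_left _ _ hy)
          have h := eq_neg hmem
          rw [← mul_neg_eq, ← mul_neg_eq] at h
          rw [Localization.mk_eq_mk_iff, Localization.r_iff_exists]
          refine ⟨w * v, ?_⟩
          simp only [Submonoid.coe_mul]
          calc (w * v : B) * (s * b) = w * (v * s * b) := by ac_rfl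
            _ = _ := h
            _ = _ := by ac_rfl

end Localization

/-! ### The prime spectrum -/

/-- A prime `m`-ideal of `B`: a subset that contains `0`, is stable under multiplication by `B`,
and whose complement is a multiplicative subset. -/
@[ext]
structure PrimeMIdeal (B : Type u) [Band B] : Type u where
  carrier : Set B
  zero_mem : 0 ∈ carrier
  mul_mem : ∀ (a : B) {b : B}, b ∈ carrier → a * b ∈ carrier
  one_notMem : 1 ∉ carrier
  mul_notMem : ∀ {a b : B}, a ∉ carrier → b ∉ carrier → a * b ∉ carrier

namespace PrimeMIdeal

variable {B C : Type u} [Band B] [Band C]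

/-- The complement of a prime `m`-ideal. -/
def compl (p : PrimeMIdeal B) : Submonoid B where
  carrier := p.carrierᶜ
  one_mem' := p.one_notMem
  mul_mem' := p.mul_notMem

/-- The principal open subset `U_h`. -/
def basicOpen (h : B) : Set (PrimeMIdeal B) := {p | h ∉ p.carrier}

instance : TopologicalSpace (PrimeMIdeal B) :=
  TopologicalSpace.generateFrom (Set.range basicOpen)

theorem isOpen_basicOpen (h : B) : IsOpen (basicOpen h) :=
  TopologicalSpace.isOpen_generateFrom_of_mem ⟨h, rfl⟩

/-- The inverse image of a prime `m`-ideal under a band morphism. -/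
def comap (f : BandHom B C) (q : PrimeMIdeal C) : PrimeMIdeal B where
  carrier := f ⁻¹' q.carrier
  zero_mem := by rw [Set.mem_preimage, map_zero]; exact q.zero_mem
  mul_mem a b hb := by rw [Set.mem_preimage, map_mul]; exact q.mul_mem _ hb
  one_notMem := by rw [Set.mem_preimage, map_one]; exact q.one_notMem
  mul_notMem {a b} ha hb := by rw [Set.mem_preimage, map_mul]; exact q.mul_notMem ha hb

theorem continuous_comap (f : BandHom B C) : Continuous (comap f) := by
  refine continuous_generateFrom_iff.2 ?_
  rintro _ ⟨h, rfl⟩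
  exact isOpen_basicOpen (f h)

/-- The localization `B_p`. -/
abbrev LocAt (p : PrimeMIdeal B) : Type u := Localization p.compl

/-- The morphism `B_{f⁻¹(q)} → C_q` of pointed monoids induced by `f : B → C`. -/
def locMonoidHom (f : BandHom B C) (q : PrimeMIdeal C) : LocAt (comap f q) →*₀ LocAt q :=
  (Localization.monoidOf (comap f q).compl).lift₀ ((locMap q.compl).comp f.toMonoidWithZeroHom)
    (fun s => by
      have hs : f s ∈ q.compl := s.2
      exact IsUnit.of_mul_eq_one (Localization.mk 1 ⟨f s, hs⟩)
        ((locMap_mul_mk q.compl 1 ⟨f s, hs⟩).trans (map_one _)))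

theorem locMonoidHom_locMap (f : BandHom B C) (q : PrimeMIdeal C) (a : B) :
    locMonoidHom f q (locMap (comap f q).compl a) = locMap q.compl (f a) :=
  (Localization.monoidOf (comap f q).compl).lift_eq _ a

/-- The band morphism `B_{f⁻¹(q)} → C_q` induced by `f : B → C`. -/
def locHom (f : BandHom B C) (q : PrimeMIdeal C) : BandHom (LocAt (comap f q)) (LocAt q) where
  toMonoidWithZeroHom := locMonoidHom f q
  map_nullSet := by
    have : nullSet (LocAt (comap f q)) ≤
        (nullSet (LocAt q)).comap (Ambient.map (locMonoidHom f q)) := by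
      refine Ideal.map_le_iff_le_comap.2 fun y hy => ?_
      rw [Ideal.mem_comap, Ideal.mem_comap]
      have h2 := Ideal.mem_map_of_mem (Ambient.map (locMap q.compl)) (f.map_nullSet y hy)
      have e : (locMonoidHom f q).comp (locMap (comap f q).compl) =
          (locMap q.compl).comp f.toMonoidWithZeroHom :=
        MonoidWithZeroHom.ext (locMonoidHom_locMap f q)
      rw [← RingHom.comp_apply, ← Ambient.map_comp, e, Ambient.map_comp]
      exact h2
    exact fun x hx => this hx

theorem locHom_mk (f : BandHom B C) (q : PrimeMIdeal C) (a : B) (s : (comap f q).compl) :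
    locHom f q (Localization.mk a s) = Localization.mk (f a) ⟨f s, s.2⟩ := by
  change (Localization.monoidOf (comap f q).compl).lift _ _ = _
  rw [Localization.mk_eq_monoidOf_mk', Submonoid.LocalizationMap.lift_mk'_spec]
  exact (locMap_mul_mk q.compl (f a) ⟨f s, s.2⟩).symm

end PrimeMIdeal

/-- The underlying space of `Spec B`. -/
abbrev specTop (B : Type u) [Band B] : TopCat.{u} := TopCat.of (PrimeMIdeal B)

section StructureSheaf

open PrimeMIdeal

variable {B : Type u} [Band B]

/-- A family of elements of the localizations `B_p` that is locally given by fractions. -/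
def IsLocallyFraction (U : Opens (specTop B)) (s : ∀ p : U, LocAt p.1) : Prop :=
  ∀ p : U, ∃ V : Opens (specTop B), p.1 ∈ V ∧ ∃ (a h : B), ∀ q : U, q.1 ∈ V →
    ∃ hq : h ∈ q.1.compl, s q = Localization.mk a ⟨h, hq⟩

/-- The sections of the structure sheaf of `Spec B` over `U`. -/
structure Sections (U : Opens (specTop B)) : Type u where
  val : ∀ p : U, LocAt p.1
  isLocallyFraction : IsLocallyFraction U val

namespace Sections

variable {U V : Opens (specTop B)}

@[ext]
theorem ext {s t : Sections U} (h : ∀ p, s.1 p = t.1 p) : s = t := by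
  cases s; cases t; congr; exact funext h

instance : Mul (Sections U) where
  mul s t := ⟨fun p => s.1 p * t.1 p, fun p => by
    obtain ⟨V, hV, a, h, H⟩ := s.2 p
    obtain ⟨W, hW, b, k, K⟩ := t.2 p
    refine ⟨V ⊓ W, ⟨hV, hW⟩, a * b, h * k, fun q hq => ?_⟩
    obtain ⟨h1, e1⟩ := H q hq.1
    obtain ⟨h2, e2⟩ := K q hq.2
    exact ⟨mul_mem h1 h2, by beta_reduce; rw [e1, e2, Localization.mk_mul]; rfl⟩⟩

instance : One (Sections U) where
  one := ⟨fun _ => 1, fun _ => ⟨⊤, trivial, 1, 1, fun _ _ =>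
    ⟨one_mem _, Localization.mk_one.symm⟩⟩⟩

instance : Zero (Sections U) where
  zero := ⟨fun _ => 0, fun _ => ⟨⊤, trivial, 0, 1, fun _ _ =>
    ⟨one_mem _, (Localization.mk_zero _).symm⟩⟩⟩

instance : CommMonoidWithZero (Sections U) where
  mul_assoc _ _ _ := ext fun _ => mul_assoc _ _ _
  one_mul _ := ext fun _ => one_mul _
  mul_one _ := ext fun _ => mul_one _
  mul_comm _ _ := ext fun _ => mul_comm _ _
  zero_mul _ := ext fun _ => zero_mul _
  mul_zero _ := ext fun _ => mul_zero _

/-- The value of a section at a point. -/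
def eval (p : U) : Sections U →*₀ LocAt p.1 where
  toFun s := s.1 p
  map_zero' := rfl
  map_one' := rfl
  map_mul' _ _ := rfl

theorem negB_mk (p : PrimeMIdeal B) (a : B) (s : p.compl) :
    negB (Localization.mk a s) = Localization.mk (negB a) s := by
  symm
  apply eq_neg
  rw [mk_eq_mul, mk_eq_mul p.compl (negB a), map_mul, map_mul, ← mul_add, ← Ambient.map_of,
    ← Ambient.map_of, ← map_add]
  exact Ideal.mul_mem_left _ _ (Ideal.mem_map_of_mem _ (add_neg_mem a))

/-- A formal sum of sections over `U` is null if its value at every point `p` of `U` lies in the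
null set of `B_p`. -/
instance : Band (Sections U) where
  nullSet := ⨅ p : U, (nullSet (LocAt p.1)).comap (Ambient.map (eval p))
  existsUnique_add_mem s := by
    refine ⟨⟨fun p => negB (s.1 p), fun p => ?_⟩, ?_, ?_⟩
    · obtain ⟨V, hV, a, h, H⟩ := s.2 p
      refine ⟨V, hV, negB a, h, fun q hq => ?_⟩
      obtain ⟨h1, e1⟩ := H q hq
      exact ⟨h1, by beta_reduce; rw [e1, negB_mk]⟩
    · simp only [Ideal.mem_iInf, Ideal.mem_comap, map_add, Ambient.map_of]
      exact fun p => add_neg_mem (s.1 p)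
    · intro t ht
      simp only [Ideal.mem_iInf, Ideal.mem_comap, map_add, Ambient.map_of] at ht
      exact ext fun p => eq_neg (ht p)

theorem mem_nullSet {x : Ambient (Sections U)} :
    x ∈ nullSet (Sections U) ↔ ∀ p : U, Ambient.map (eval p) x ∈ nullSet (LocAt p.1) := by
  change x ∈ (⨅ p : U, (nullSet (LocAt p.1)).comap (Ambient.map (eval p))) ↔ _
  simp only [Ideal.mem_iInf, Ideal.mem_comap]

/-- Restriction of sections. -/
def res (h : V ≤ U) : BandHom (Sections U) (Sections V) where
  toFun s := ⟨fun p => s.1 ⟨p.1, h p.2⟩, fun p => by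
    obtain ⟨W, hW, a, k, H⟩ := s.2 ⟨p.1, h p.2⟩
    exact ⟨W, hW, a, k, fun q hq => H ⟨q.1, h q.2⟩ hq⟩⟩
  map_zero' := rfl
  map_one' := rfl
  map_mul' _ _ := rfl
  map_nullSet x hx := by
    rw [mem_nullSet] at hx ⊢
    intro p
    rw [← RingHom.comp_apply, ← Ambient.map_comp]
    exact hx ⟨p.1, h p.2⟩

end Sections

/-- The structure presheaf of `Spec B`. -/
def structurePresheaf (B : Type u) [Band B] : TopCat.Presheaf BandCat.{u} (specTop B) where
  obj U := ⟨Sections U.unop⟩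
  map i := Sections.res i.unop.le
  map_id _ := rfl
  map_comp _ _ := rfl

theorem structurePresheaf_isSheaf (B : Type u) [Band B] :
    TopCat.Presheaf.IsSheaf (structurePresheaf B) := by
  intro E
  refine (isSheaf_iff_isSheaf_of_type _ _).1
    ((TopCat.Presheaf.isSheaf_iff_isSheafUniqueGluing_types
      (F := structurePresheaf B ⋙ coyoneda.obj (op E))).2 ?_)
  intro ι U sf hsf
  let F : ∀ i, BandHom E (Sections (U i)) := sf
  have hsf' : ∀ (i j : ι) (e : E) (p : specTop B) (hi : p ∈ U i) (hj : p ∈ U j),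
      (F i e).1 ⟨p, hi⟩ =
        (F j e).1 ⟨p, hj⟩ := by
    intro i j e p hi hj
    have h1 := congrArg (fun g : BandHom E (Sections (U i ⊓ U j)) => (g e).1 ⟨p, hi, hj⟩)
      (hsf i j)
    exact h1
  have hmem : ∀ p : (iSup U : Opens (specTop B)), ∃ i, p.1 ∈ U i := fun p =>
    Opens.mem_iSup.1 p.2
  choose idx hidx using hmem
  let gl : BandHom E (Sections (iSup U)) :=
    { toFun := fun e => ⟨fun p => (F (idx p) e).1
          ⟨p.1, hidx p⟩, fun p => by
        obtain ⟨W, hW, a, k, H⟩ := (F (idx p) e).2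
          ⟨p.1, hidx p⟩
        refine ⟨W ⊓ U (idx p), ⟨hW, hidx p⟩, a, k, fun q hq => ?_⟩
        obtain ⟨h1, h2⟩ := H ⟨q.1, hq.2⟩ hq.1
        exact ⟨h1, (hsf' _ _ e q.1 (hidx q) hq.2).trans h2⟩⟩
      map_zero' := by
        ext p
        exact congrArg (fun s : Sections (U (idx p)) => s.1 ⟨p.1, hidx p⟩)
          (map_zero (F (idx p)).toMonoidWithZeroHom)
      map_one' := by
        ext p
        exact congrArg (fun s : Sections (U (idx p)) => s.1 ⟨p.1, hidx p⟩)
          (map_one (F (idx p)).toMonoidWithZeroHom)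
      map_mul' := fun a b => by
        ext p
        exact congrArg (fun s : Sections (U (idx p)) => s.1 ⟨p.1, hidx p⟩)
          (map_mul (F (idx p)).toMonoidWithZeroHom a b)
      map_nullSet := fun x hx => by
        rw [Sections.mem_nullSet]
        intro p
        have h := Sections.mem_nullSet.1
          ((F (idx p)).map_nullSet x hx) ⟨p.1, hidx p⟩
        rw [← RingHom.comp_apply, ← Ambient.map_comp] at h ⊢
        exact h }
  refine ⟨gl, ?_, ?_⟩
  · intro i
    refine BandHom.ext (B := E) (C := Sections (U i)) fun e => ?_
    refine Sections.ext fun p => ?_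
    exact hsf' _ _ e p.1 (hidx ⟨p.1, _⟩) p.2
  · intro g hg
    refine BandHom.ext (B := E) (C := Sections (iSup U)) fun e => ?_
    refine Sections.ext fun p => ?_
    exact congrArg (fun k : BandHom E (Sections (U (idx p))) => (k e).1 ⟨p.1, hidx p⟩) (hg (idx p))

end StructureSheaf

/-! ### Band spaces -/

open AlgebraicGeometry

theorem isUnit_germ_iff {X : TopCat.{u}} (F : TopCat.Presheaf BandCat.{u} X) {U : Opens X} (x : X)
    (hx : x ∈ U) (s : (F.obj (op U)).carrier) :
    IsUnit (TopCat.Presheaf.germ (F ⋙ BandCat.toMon) U x hx s) ↔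
      ∃ (V : Opens X) (_ : x ∈ V) (i : V ⟶ U),
        IsUnit (M := (F.obj (op V)).carrier) (BandHom.toMonoidWithZeroHom (F.map i.op) s) := by
  constructor
  · intro h
    obtain ⟨t', ht⟩ := h.exists_right_inv
    obtain ⟨V, hV, t, rfl⟩ := TopCat.Presheaf.exists_germ_eq (F ⋙ BandCat.toMon) t'
    have hxUV : x ∈ U ⊓ V := ⟨hx, hV⟩
    have e : TopCat.Presheaf.germ (F ⋙ BandCat.toMon) (U ⊓ V) x hxUV
          ((F ⋙ BandCat.toMon).map (Opens.infLELeft U V).op s *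
            (F ⋙ BandCat.toMon).map (Opens.infLERight U V).op t) =
        TopCat.Presheaf.germ (F ⋙ BandCat.toMon) (U ⊓ V) x hxUV 1 := by
      rw [map_mul, map_one, ← ht]
      congr 1
      · exact TopCat.Presheaf.germ_res_apply (F ⋙ BandCat.toMon) (Opens.infLELeft U V) x hxUV s
      · exact TopCat.Presheaf.germ_res_apply (F ⋙ BandCat.toMon) (Opens.infLERight U V) x hxUV t
    obtain ⟨W, hW, i, j, hij⟩ := TopCat.Presheaf.germ_eq (F ⋙ BandCat.toMon) x _ _ _ _ e
    refine ⟨W, hW, i ≫ Opens.infLELeft U V, ?_⟩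
    rw [map_mul, map_one] at hij
    refine IsUnit.of_mul_eq_one (M := (F.obj (op W)).carrier)
      ((F ⋙ BandCat.toMon).map i.op ((F ⋙ BandCat.toMon).map (Opens.infLERight U V).op t)) ?_
    rw [op_comp, Functor.map_comp]
    exact hij
  · rintro ⟨V, hV, i, h⟩
    have h2 := IsUnit.map (TopCat.Presheaf.germ (F ⋙ BandCat.toMon) V x hV).hom h
    have h3 := TopCat.Presheaf.germ_res_apply (F ⋙ BandCat.toMon) i x hV s
    rw [← h3]
    exact h2

/-- A band space: a topological space together with a sheaf in bands. -/
structure BandSpace : Type (u + 1) extends SheafedSpace.{_, _, u} BandCat.{u}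

namespace BandSpace

/-- A morphism of band spaces: a continuous map together with a morphism of sheaves whose stalk
maps send non-units to non-units. The forgetful functor from bands to monoids commutes with
filtered colimits, so that the multiplicative monoid of a stalk is the stalk in monoids. -/
structure Hom (X Y : BandSpace.{u}) : Type u where
  hom : X.toPresheafedSpace ⟶ Y.toPresheafedSpace
  isLocal : ∀ x : X.carrier, IsLocalHom
    (PresheafedSpace.Hom.stalkMap (BandCat.toMon.mapPresheaf.map hom) x).hom

@[ext]
theorem Hom.ext {X Y : BandSpace.{u}} {f g : Hom X Y} (h : f.hom = g.hom) : f = g := by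
  cases f; cases g; congr

theorem isLocal_id (X : BandSpace.{u}) (x : X.carrier) : IsLocalHom
    (PresheafedSpace.Hom.stalkMap
      (BandCat.toMon.mapPresheaf.map (𝟙 X.toPresheafedSpace)) x).hom := by
  have aux : ∀ φ : BandCat.toMon.mapPresheaf.obj X.toPresheafedSpace ⟶
      BandCat.toMon.mapPresheaf.obj X.toPresheafedSpace, φ = 𝟙 _ →
      IsLocalHom (PresheafedSpace.Hom.stalkMap φ x).hom := by
    rintro _ rfl
    exact ⟨fun a ha => (congrArg IsUnit
      (ConcreteCategory.congr_hom (PresheafedSpace.stalkMap.id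
        (BandCat.toMon.mapPresheaf.obj X.toPresheafedSpace) x) a)).mp ha⟩
  exact aux _ (BandCat.toMon.mapPresheaf.map_id _)

theorem isLocal_comp {X Y Z : BandSpace.{u}} (f : Hom X Y) (g : Hom Y Z) (x : X.carrier) :
    IsLocalHom (PresheafedSpace.Hom.stalkMap
      (BandCat.toMon.mapPresheaf.map (f.hom ≫ g.hom)) x).hom := by
  have aux : ∀ φ, φ = BandCat.toMon.mapPresheaf.map f.hom ≫ BandCat.toMon.mapPresheaf.map g.hom →
      IsLocalHom (PresheafedSpace.Hom.stalkMap φ x).hom := by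
    rintro _ rfl
    refine ⟨fun a ha => (g.isLocal (f.hom.base x)).map_nonunit a
      ((f.isLocal x).map_nonunit _ ?_)⟩
    exact (congrArg IsUnit
      (ConcreteCategory.congr_hom (PresheafedSpace.stalkMap.comp
        (BandCat.toMon.mapPresheaf.map f.hom) (BandCat.toMon.mapPresheaf.map g.hom) x) a)).mp ha
  exact aux _ (BandCat.toMon.mapPresheaf.map_comp _ _)

instance : Category BandSpace.{u} where
  Hom := Hom
  id X := ⟨𝟙 X.toPresheafedSpace, isLocal_id X⟩
  comp f g := ⟨f.hom ≫ g.hom, isLocal_comp f g⟩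
  id_comp f := Hom.ext (Category.id_comp f.hom)
  comp_id f := Hom.ext (Category.comp_id f.hom)
  assoc f g h := Hom.ext (Category.assoc f.hom g.hom h.hom)

/-- The open subspace `U` of a band space `X` with the restricted structure sheaf. -/
def restrict (X : BandSpace.{u}) (U : Opens X.carrier) : BandSpace.{u} where
  toSheafedSpace := X.toSheafedSpace.restrict U.isOpenEmbedding

end BandSpace

/-! ### The spectrum as a band space -/

section Spec

open PrimeMIdeal

variable {B C : Type u} [Band B] [Band C]

/-- The spectrum of a band. -/
def specObj (B : BandCat.{u}) : BandSpace.{u} where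
  carrier := specTop B
  presheaf := structurePresheaf B
  IsSheaf := structurePresheaf_isSheaf B

/-- The continuous map `f^* : Spec C → Spec B`. -/
def specBase (f : BandHom B C) : specTop C ⟶ specTop B :=
  TopCat.ofHom ⟨comap f, continuous_comap f⟩

/-- Pull back of sections along `f^*`. -/
def pullSections (f : BandHom B C) (U : Opens (specTop B)) :
    BandHom (Sections U) (Sections ((Opens.map (specBase f)).obj U)) where
  toFun s := ⟨fun q => locHom f q.1 (s.1 ⟨comap f q.1, q.2⟩), fun q => by
    obtain ⟨V, hV, a, h, H⟩ := s.2 ⟨comap f q.1, q.2⟩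
    refine ⟨(Opens.map (specBase f)).obj V, hV, f a, f h, fun q' hq' => ?_⟩
    obtain ⟨h1, e1⟩ := H ⟨comap f q'.1, q'.2⟩ hq'
    exact ⟨h1, by beta_reduce; rw [e1, locHom_mk]⟩⟩
  map_zero' := Sections.ext fun q => map_zero (locHom f q.1)
  map_one' := Sections.ext fun q => map_one (locHom f q.1)
  map_mul' _ _ := Sections.ext fun q => map_mul (locHom f q.1) _ _
  map_nullSet x hx := by
    rw [Sections.mem_nullSet] at hx ⊢
    intro q
    have h := (locHom f q.1).map_nullSet _ (hx ⟨comap f q.1, q.2⟩)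
    rw [← RingHom.comp_apply, ← Ambient.map_comp] at h ⊢
    exact h

theorem notMem_of_isUnit_mk {p : PrimeMIdeal B} {a : B} {s : p.compl}
    (h : IsUnit (Localization.mk a s : LocAt p)) : a ∉ p.carrier := by
  intro ha
  obtain ⟨z, hz⟩ := h.exists_right_inv
  induction z using Localization.induction_on with
  | H w =>
    obtain ⟨b, k⟩ := w
    rw [Localization.mk_mul, ← Localization.mk_one, Localization.mk_eq_mk_iff,
      Localization.r_iff_exists] at hz
    obtain ⟨c, hc⟩ := hz
    have h1 : (c : B) * (((1 : p.compl) : B) * (a * b)) ∈ p.carrier := by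
      refine p.mul_mem _ (p.mul_mem _ ?_)
      rw [mul_comm]
      exact p.mul_mem _ ha
    rw [hc] at h1
    exact (c * ((s * k) * 1)).2 (by simpa using h1)

theorem exists_isUnit_res (f : BandHom B C) (q : PrimeMIdeal C) (U : Opens (specTop B))
    (hU : comap f q ∈ U) (s : Sections U) (hs : IsUnit (locHom f q (s.1 ⟨comap f q, hU⟩))) :
    ∃ (V : Opens (specTop B)) (h : V ≤ U), comap f q ∈ V ∧ IsUnit (Sections.res h s) := by
  obtain ⟨W, hW, a, h, H⟩ := s.2 ⟨comap f q, hU⟩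
  obtain ⟨h1, e1⟩ := H ⟨comap f q, hU⟩ hW
  rw [e1, locHom_mk] at hs
  have ha : f a ∉ q.carrier := notMem_of_isUnit_mk hs
  let V : Opens (specTop B) := U ⊓ W ⊓ ⟨basicOpen a, isOpen_basicOpen a⟩
  have hVa : ∀ p : V, a ∈ p.1.compl := fun p => p.2.2
  have hVh : ∀ p : V, h ∈ p.1.compl := fun p => (H ⟨p.1, p.2.1.1⟩ p.2.1.2).1
  refine ⟨V, inf_le_left.trans inf_le_left, ⟨⟨hU, hW⟩, ha⟩, ?_⟩
  refine IsUnit.of_mul_eq_one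
    ⟨fun p => Localization.mk h ⟨a, hVa p⟩, fun p => ⟨V, p.2, h, a, fun r _ => ⟨hVa r, rfl⟩⟩⟩ ?_
  refine Sections.ext fun p => ?_
  obtain ⟨h2, e2⟩ := H ⟨p.1, p.2.1.1⟩ p.2.1.2
  change s.1 ⟨p.1, p.2.1.1⟩ * Localization.mk h ⟨a, hVa p⟩ = 1
  rw [e2, Localization.mk_mul, ← Localization.mk_one, Localization.mk_eq_mk_iff,
    Localization.r_iff_exists]
  exact ⟨1, by simp [mul_comm]⟩

theorem locHom_id (q : PrimeMIdeal B) (x : LocAt q) : locHom (BandHom.id B) q x = x := by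
  induction x using Localization.induction_on with
  | H w => exact locHom_mk (BandHom.id B) q w.1 w.2

theorem locHom_comp {D : Type u} [Band D] (g : BandHom C D) (f : BandHom B C) (q : PrimeMIdeal D)
    (x : LocAt (comap f (comap g q))) :
    locHom (BandHom.comp g f) q x = locHom g q (locHom f (comap g q) x) := by
  induction x using Localization.induction_on with
  | H w =>
    rw [locHom_mk, locHom_mk]
    exact locHom_mk (BandHom.comp g f) q w.1 w.2

/-- The morphism `Spec C → Spec B` of presheafed spaces induced by `f : B → C`. -/
def specPshMap {B C : BandCat.{u}} (f : BandHom B C) :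
    (specObj C).toPresheafedSpace ⟶ (specObj B).toPresheafedSpace where
  base := specBase f
  c := { app := fun U => pullSections f U.unop, naturality := fun _ _ _ => rfl }

theorem isLocal_specPshMap {B C : BandCat.{u}} (f : BandHom B C) (q : (specObj C).carrier) :
    IsLocalHom (PresheafedSpace.Hom.stalkMap
      (BandCat.toMon.mapPresheaf.map (specPshMap f)) q).hom := by
  refine ⟨fun t ht => ?_⟩
  obtain ⟨U, hU, s, rfl⟩ := TopCat.Presheaf.exists_germ_eq
    (structurePresheaf B ⋙ BandCat.toMon) t
  have hcomp := ConcreteCategory.congr_hom (PresheafedSpace.stalkMap_germ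
    (BandCat.toMon.mapPresheaf.map (specPshMap f)) U q hU) s
  have hu : IsUnit (TopCat.Presheaf.germ (structurePresheaf C ⋙ BandCat.toMon)
      ((Opens.map (specBase f)).obj U) q hU (pullSections f U s)) := by
    refine Eq.mp (congrArg IsUnit ?_) ht
    exact hcomp
  obtain ⟨V, hV, i, hi⟩ := (isUnit_germ_iff (structurePresheaf C) q hU (pullSections f U s)).1 hu
  have hq : IsUnit (locHom f q (Sections.val s ⟨comap f q, hU⟩)) :=
    hi.map (Sections.eval (⟨q, hV⟩ : V))
  obtain ⟨W, hWU, hW, hu'⟩ := exists_isUnit_res f q U hU s hq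
  exact (isUnit_germ_iff (structurePresheaf B) _ hU s).2 ⟨W, hW, homOfLE hWU, hu'⟩

/-- The contravariant functor `Spec` from bands to band spaces. -/
def specFunctor : BandCat.{u}ᵒᵖ ⥤ BandSpace.{u} where
  obj B := specObj B.unop
  map f := ⟨specPshMap f.unop, isLocal_specPshMap f.unop⟩
  map_id B := by
    refine BandSpace.Hom.ext (PresheafedSpace.hext _ _ rfl (heq_of_eq ?_))
    refine NatTrans.ext (funext fun (U : (Opens (specTop B.unop))ᵒᵖ) => ?_)
    refine BandHom.ext (B := Sections U.unop) (C := Sections U.unop) fun s => ?_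
    exact Sections.ext fun q => locHom_id q.1 _
  map_comp {X Y Z} f g := by
    refine BandSpace.Hom.ext (PresheafedSpace.hext _ _ rfl (heq_of_eq ?_))
    refine NatTrans.ext (funext fun (U : (Opens (specTop Z.unop))ᵒᵖ) => ?_)
    refine BandHom.ext (B := Sections U.unop)
      (C := Sections ((Opens.map (specBase (BandHom.comp f.unop g.unop))).obj U.unop)) fun s => ?_
    exact Sections.ext fun q => locHom_comp f.unop g.unop q.1 _

end Spec

/-! ### Band schemes -/

/-- An affine band scheme: a band space isomorphic to the spectrum of a band. -/
def IsAffine (X : BandSpace.{u}) : Prop :=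
  ∃ B : BandCat.{u}, Nonempty (X ≅ specFunctor.obj (op B))

/-- A band scheme: a band space in which every point has an affine open neighbourhood. -/
def IsBandScheme (X : BandSpace.{u}) : Prop :=
  ∀ x : X.carrier, ∃ U : Opens X.carrier, x ∈ U ∧ IsAffine (X.restrict U)

/-- The category of band schemes, a full subcategory of the category of band spaces. -/
abbrev BandScheme : Type (u + 1) := ObjectProperty.FullSubcategory IsBandScheme.{u}

/-- The underlying topological space functor `BSch ⥤ Top`. -/
def toTop : BandScheme.{u} ⥤ TopCat.{u} where
  obj X := X.obj.carrier
  map f := f.hom.hom.base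

theorem isLocal_of_iso {X Y : BandSpace.{u}} (e : X.toPresheafedSpace ≅ Y.toPresheafedSpace)
    (x : X.carrier) : IsLocalHom
      (PresheafedSpace.Hom.stalkMap (BandCat.toMon.mapPresheaf.map e.hom) x).hom := by
  have h : IsIso (PresheafedSpace.Hom.stalkMap (BandCat.toMon.mapPresheaf.map e.hom) x) :=
    PresheafedSpace.stalkMap.isIso (BandCat.toMon.mapPresheaf.mapIso e).hom x
  refine ⟨fun a ha => ?_⟩
  have h2 := ha.map (inv (PresheafedSpace.Hom.stalkMap
    (BandCat.toMon.mapPresheaf.map e.hom) x)).hom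
  exact (congrArg IsUnit (ConcreteCategory.congr_hom (IsIso.hom_inv_id
    (PresheafedSpace.Hom.stalkMap (BandCat.toMon.mapPresheaf.map e.hom) x)) a)).mp h2

/-- An isomorphism of presheafed spaces between band spaces is an isomorphism of band spaces. -/
def BandSpace.isoMk {X Y : BandSpace.{u}} (e : X.toPresheafedSpace ≅ Y.toPresheafedSpace) :
    X ≅ Y where
  hom := ⟨e.hom, isLocal_of_iso e⟩
  inv := ⟨e.inv, isLocal_of_iso e.symm⟩
  hom_inv_id := BandSpace.Hom.ext e.hom_inv_id
  inv_hom_id := BandSpace.Hom.ext e.inv_hom_id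

theorem isBandScheme_spec (B : BandCat.{u}ᵒᵖ) : IsBandScheme (specFunctor.obj B) := fun _ =>
  ⟨⊤, trivial, B.unop, ⟨BandSpace.isoMk (PresheafedSpace.restrictTopIso _)⟩⟩

/-- The functor `Spec` from bands to band schemes. -/
def Spec : BandCat.{u}ᵒᵖ ⥤ BandScheme.{u} :=
  ObjectProperty.lift _ specFunctor isBandScheme_spec

/-- An open immersion: a morphism that restricts to an isomorphism onto an open subscheme. -/
def IsOpenImmersion {Y X : BandScheme.{u}} (f : Y ⟶ X) : Prop :=
  PresheafedSpace.IsOpenImmersion f.hom.hom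

/-- An affine open of a band scheme. -/
def IsAffineOpen (X : BandScheme.{u}) (U : Opens X.obj.carrier) : Prop :=
  IsAffine (X.obj.restrict U)

/-- A closed immersion: an affine morphism `f : Y ⟶ X` such that `𝒪_X(U) → 𝒪_Y(f⁻¹(U))` is
surjective for all affine opens `U` of `X`. -/
def IsClosedImmersion {Y X : BandScheme.{u}} (f : Y ⟶ X) : Prop :=
  ∀ U : Opens X.obj.carrier, IsAffineOpen X U →
    IsAffineOpen Y ((Opens.map f.hom.hom.base).obj U) ∧
      Function.Surjective (BandHom.toMonoidWithZeroHom (f.hom.hom.c.app (op U)))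

/-- An affine presentation of a band scheme: a diagram of affine band schemes and open immersions
together with a colimit cocone in the category of band schemes all of whose legs are open
immersions. -/
structure IsAffinePresentation {J : Type u} [Category.{u} J] (D : J ⥤ BandScheme.{u})
    (c : Limits.Cocone D) : Prop where
  affine : ∀ j, IsAffine (D.obj j).obj
  map_open : ∀ {i j} (a : i ⟶ j), IsOpenImmersion (D.map a)
  isColimit : Nonempty (Limits.IsColimit c)
  ι_open : ∀ j, IsOpenImmersion (c.ι.app j)

/-! ### The null space of a band -/

/-- A null ideal: an ideal of `B⁺` that contains `N_B` and satisfies the substitution rule. -/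
structure IsNullIdeal {B : Type u} [Band B] (I : Ideal (Ambient B)) : Prop where
  nullSet_le : nullSet B ≤ I
  subst : ∀ (a c : B) (x : Ambient B), Ambient.of B a + Ambient.of B (negB c) ∈ I →
    Ambient.of B c + x ∈ I → Ambient.of B a + x ∈ I

/-- A prime null ideal: a null ideal whose complement in `B⁺` is a multiplicative set. -/
@[ext]
structure PrimeNullIdeal (B : Type u) [Band B] : Type u where
  ideal : Ideal (Ambient B)
  isNullIdeal : IsNullIdeal ideal
  one_notMem : 1 ∉ ideal
  mul_notMem : ∀ {x y : Ambient B}, x ∉ ideal → y ∉ ideal → x * y ∉ ideal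

namespace PrimeNullIdeal

variable {B C : Type u} [Band B] [Band C]

/-- The basic open `U_h` for `h ∈ B⁺`. -/
def basicOpen (h : Ambient B) : Set (PrimeNullIdeal B) := {p | h ∉ p.ideal}

instance : TopologicalSpace (PrimeNullIdeal B) :=
  TopologicalSpace.generateFrom (Set.range basicOpen)

theorem isOpen_basicOpen (h : Ambient B) : IsOpen (basicOpen h) :=
  TopologicalSpace.isOpen_generateFrom_of_mem ⟨h, rfl⟩

/-- The inverse image `(f⁺)⁻¹(p)` of a prime null ideal. -/
def comap (f : BandHom B C) (p : PrimeNullIdeal C) : PrimeNullIdeal B where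
  ideal := p.ideal.comap f.plus
  isNullIdeal :=
    { nullSet_le := fun x hx => p.isNullIdeal.nullSet_le (f.map_nullSet x hx)
      subst := fun a c x h1 h2 => by
        rw [Ideal.mem_comap, map_add] at h1 h2 ⊢
        simp only [BandHom.plus, Ambient.map_of] at h1 h2 ⊢
        refine p.isNullIdeal.subst _ (f c) _ ?_ h2
        rw [← BandHom.map_neg]
        exact h1 }
  one_notMem := by rw [Ideal.mem_comap, map_one]; exact p.one_notMem
  mul_notMem hx hy := by
    rw [Ideal.mem_comap] at hx hy ⊢
    rw [map_mul]; exact p.mul_notMem hx hy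

theorem continuous_comap (f : BandHom B C) : Continuous (comap f) := by
  refine continuous_generateFrom_iff.2 ?_
  rintro _ ⟨h, rfl⟩
  exact isOpen_basicOpen (f.plus h)

/-- The prime `m`-ideal `p ∩ B`. -/
def inter (p : PrimeNullIdeal B) : PrimeMIdeal B where
  carrier := {b | Ambient.of B b ∈ p.ideal}
  zero_mem := by rw [Set.mem_ofPred_eq, map_zero]; exact zero_mem _
  mul_mem a b hb := by rw [Set.mem_ofPred_eq, map_mul]; exact Ideal.mul_mem_left _ _ hb
  one_notMem := by rw [Set.mem_ofPred_eq, map_one]; exact p.one_notMem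
  mul_notMem ha hb := by rw [Set.mem_ofPred_eq, map_mul]; exact p.mul_notMem ha hb

theorem continuous_inter : Continuous (inter : PrimeNullIdeal B → PrimeMIdeal B) := by
  refine continuous_generateFrom_iff.2 ?_
  rintro _ ⟨h, rfl⟩
  exact isOpen_basicOpen (Ambient.of B h)

theorem comap_id (p : PrimeNullIdeal B) : comap (BandHom.id B) p = p := by
  refine PrimeNullIdeal.ext ?_
  change p.ideal.comap (Ambient.map (MonoidWithZeroHom.id B)) = _
  rw [Ambient.map_id, Ideal.comap_id]

theorem comap_comp {D : Type u} [Band D] (g : BandHom C D) (f : BandHom B C)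
    (p : PrimeNullIdeal D) : comap (BandHom.comp g f) p = comap f (comap g p) := by
  refine PrimeNullIdeal.ext ?_
  change p.ideal.comap (Ambient.map (g.toMonoidWithZeroHom.comp f.toMonoidWithZeroHom)) = _
  rw [Ambient.map_comp, ← Ideal.comap_comap]
  rfl

end PrimeNullIdeal

/-- The functor `Null` from bands to topological spaces. -/
def Null : BandCat.{u}ᵒᵖ ⥤ TopCat.{u} where
  obj B := TopCat.of (PrimeNullIdeal B.unop)
  map f := TopCat.ofHom ⟨PrimeNullIdeal.comap f.unop, PrimeNullIdeal.continuous_comap f.unop⟩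
  map_id _ := TopCat.hom_ext (ContinuousMap.ext fun p => PrimeNullIdeal.comap_id p)
  map_comp f g := TopCat.hom_ext (ContinuousMap.ext fun p =>
    PrimeNullIdeal.comap_comp f.unop g.unop p)

/-- The natural transformation `Null(B) → Spec B`, `p ↦ p ∩ B`. -/
def piBar : Null.{u} ⟶ Spec ⋙ toTop where
  app B := TopCat.ofHom ⟨PrimeNullIdeal.inter (B := B.unop), PrimeNullIdeal.continuous_inter⟩
  naturality B C f := by
    refine TopCat.hom_ext (ContinuousMap.ext fun p => PrimeMIdeal.ext (Set.ext fun b => ?_))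
    change Ambient.map _ (Ambient.of _ b) ∈ p.ideal ↔ Ambient.of _ _ ∈ p.ideal
    rw [Ambient.map_of]
    rfl

/-- The properties that characterize the null space functor `N` together with `π` and `η`. -/
structure IsNullSpaceFunctor (N : BandScheme.{u} ⥤ TopCat.{u}) (π : N ⟶ toTop)
    (η : Null ≅ Spec ⋙ N) : Prop where
  piBar_eq : piBar = η.hom ≫ Functor.whiskerLeft Spec π
  isColimit : ∀ {J : Type u} [Category.{u} J] (D : J ⥤ BandScheme.{u}) (c : Limits.Cocone D),
    IsAffinePresentation D c → Nonempty (Limits.IsColimit (N.mapCocone c))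
  isOpenEmbedding : ∀ {Y X : BandScheme.{u}} (i : Y ⟶ X), IsOpenImmersion i →
    IsOpenEmbedding (N.map i)
  isClosedEmbedding : ∀ {Y X : BandScheme.{u}} (i : Y ⟶ X), IsClosedImmersion i →
    IsClosedEmbedding (N.map i)

end

end BandTheory

/-! A point of the null space of a band scheme `X` is taken to be a point `x` of `X` together with a
prime null ideal of the stalk at `x` that meets the stalk exactly in its non-units. The stalk need
not be formed: such an ideal amounts to a compatible family of prime null ideals of the bands
`𝒪(U)`, `x ∈ U`. The topology is generated by the loci where an element of some `𝒪(U)⁺` does not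
vanish. Morphisms of band spaces are local, so these data push forward, and `π` forgets the ideal.
No affine covering is chosen, so functoriality is immediate; the work lies in the comparison with
`Null` and in the colimit property.

On a spectrum, a prime null ideal `p` of `B` corresponds to the point `p ∩ B` with the extension of
`p` to the localization there (`specNullHomeo`). The reason is that an element of `𝒪(U)⁺` is, near a
given point and up to an invertible factor, the image of an element of `B⁺` (`exists_mul_res_eq`).
An open immersion identifies sections with sections over the image, so it identifies the null space
of `Y` with the part of the null space of `X` over the image (`NullPoint.range_map`). For a closed
immersion the claim is local on the target. Over an affine open it says that for a surjective `f : B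
→ C` the prime null ideals of `C` are those of `B` that contain the preimage of `N_C` under `f⁺`.

An affine presentation is only a colimit in band schemes, which a priori says nothing about points.
The test object is the non-separated scheme of two copies of `X` glued along the complement of the
closure of a point `x`. The two inclusions of `X` agree on every open subset that misses `x` but
differ at `x`. Mapping the presentation into this double shows that some piece contains `x` and that
any two pieces containing `x` are joined by a zigzag of arrows between pieces containing `x`. Since
the legs induce open embeddings of null spaces, this makes the null space of `X` the colimit.

For uniqueness, `Spec` is full because the global sections of `Spec B` are `B`, and every band
scheme is the colimit of its affine opens. An isomorphism over spectra thus extends to affine band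
schemes, and then to all band schemes by property 2. Naturality is checked at points, on small
affine opens. -/

namespace BandTheory

/-! ### Sections, germs of units and the null space functor. -/

noncomputable section

open AlgebraicGeometry

/-! ### Sections of presheaves of bands -/

/-- The sections of a presheaf of bands over an open subset. -/
abbrev Γ (X : PresheafedSpace BandCat.{u}) (U : Opens X.carrier) : Type u :=
  (X.presheaf.obj (op U)).carrier

section Sections

variable {X Y Z : PresheafedSpace BandCat.{u}}

/-- Restriction of sections. -/
def resHom (X : PresheafedSpace BandCat.{u}) {U V : Opens X.carrier} (h : V ≤ U) :
    BandHom (Γ X U) (Γ X V) :=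
  X.presheaf.map (homOfLE h).op

theorem resHom_refl (U : Opens X.carrier) (h : U ≤ U) : resHom X h = BandHom.id (Γ X U) :=
  X.presheaf.map_id (op U)

theorem resHom_comp {U V W : Opens X.carrier} (h : V ≤ U) (h' : W ≤ V) :
    BandHom.comp (resHom X h') (resHom X h) = resHom X (h'.trans h) :=
  (X.presheaf.map_comp (homOfLE h).op (homOfLE h').op).symm

theorem resHom_resHom {U V W : Opens X.carrier} (h : V ≤ U) (h' : W ≤ V) (a : Γ X U) :
    resHom X h' (resHom X h a) = resHom X (h'.trans h) a :=
  DFunLike.congr_fun (resHom_comp h h') a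

/-- Pull back of sections over `O` along `f` to an open subset of `f⁻¹(O)`. -/
def pull (f : X ⟶ Y) {O : Opens Y.carrier} {W : Opens X.carrier}
    (h : W ≤ (Opens.map f.base).obj O) : BandHom (Γ Y O) (Γ X W) :=
  BandHom.comp (resHom X h) (f.c.app (op O))

theorem pull_id {O W : Opens X.carrier} (h : W ≤ O) : pull (𝟙 X) h = resHom X h := by
  change BandHom.comp (resHom X h) (BandHom.id _) = _
  rfl

theorem app_comp_resHom (f : X ⟶ Y) {O O' : Opens Y.carrier} (h : O' ≤ O) :
    BandHom.comp (f.c.app (op O')) (resHom Y h) =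
      BandHom.comp (resHom X ((Opens.map f.base).map (homOfLE h)).le) (f.c.app (op O)) :=
  f.c.naturality (homOfLE h).op

theorem resHom_comp_pull (f : X ⟶ Y) {O : Opens Y.carrier} {W W' : Opens X.carrier}
    (h : W ≤ (Opens.map f.base).obj O) (h' : W' ≤ W) :
    BandHom.comp (resHom X h') (pull f h) = pull f (h'.trans h) := by
  unfold pull
  rw [← resHom_comp h h']
  rfl

theorem pull_comp_resHom (f : X ⟶ Y) {O O' : Opens Y.carrier} {W : Opens X.carrier}
    (h' : O' ≤ O) (h : W ≤ (Opens.map f.base).obj O') :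
    BandHom.comp (pull f h) (resHom Y h') = pull f (h.trans fun _ hx => h' hx) := by
  have e := app_comp_resHom f h'
  unfold pull
  rw [← resHom_comp ((Opens.map f.base).map (homOfLE h')).le h]
  exact congrArg (fun g => BandHom.comp (resHom X h) g) e

theorem pull_comp (f : X ⟶ Y) (g : Y ⟶ Z) {O : Opens Z.carrier} {V : Opens Y.carrier}
    {W : Opens X.carrier} (h : W ≤ (Opens.map f.base).obj V) (h' : V ≤ (Opens.map g.base).obj O) :
    BandHom.comp (pull f h) (pull g h') =
      pull (f ≫ g) (O := O) (W := W) (fun _ hx => h' (h hx)) := by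
  change BandHom.comp (BandHom.comp (pull f h) (resHom Y h')) (g.c.app (op O)) = _
  rw [pull_comp_resHom]
  rfl

/-- Comparing the sheaf maps of `f` and `g` directly would require a transport along the equality of
base maps. Testing on every `W` inside both preimages avoids it. -/
theorem hom_ext_of_pull {f g : X ⟶ Y} (hb : ∀ x, f.base x = g.base x)
    (h : ∀ (O : Opens Y.carrier) (W : Opens X.carrier) (hf : W ≤ (Opens.map f.base).obj O)
      (hg : W ≤ (Opens.map g.base).obj O), pull f hf = pull g hg) : f = g := by
  obtain ⟨β, c⟩ := f
  obtain ⟨β', c'⟩ := g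
  obtain rfl : β = β' := TopCat.hom_ext (ContinuousMap.ext hb)
  congr 1
  refine NatTrans.ext (funext fun O => ?_)
  have := h O.unop ((Opens.map β).obj O.unop) le_rfl le_rfl
  unfold pull at this
  rw [resHom_refl] at this
  exact this

theorem pull_congr {f g : X ⟶ Y} (e : f = g) {O : Opens Y.carrier} {W : Opens X.carrier}
    (h : W ≤ (Opens.map f.base).obj O) (h' : W ≤ (Opens.map g.base).obj O) :
    pull f h = pull g h' := by
  subst e; rfl

/-- The inverse of the pull back of sections along an open immersion. -/
def push (f : X ⟶ Y) [PresheafedSpace.IsOpenImmersion f] {W : Opens X.carrier}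
    {O : Opens Y.carrier} (h : ∀ y ∈ O, ∃ x ∈ W, f.base x = y) : BandHom (Γ X W) (Γ Y O) :=
  BandHom.comp (resHom Y (V := O)
    (U := (PresheafedSpace.IsOpenImmersion.opensFunctor f).obj W) h)
    (PresheafedSpace.IsOpenImmersion.invApp f W)

/-- The open subsets on the two sides need not match exactly, so the composite is a restriction; for
`O' = O` it is the identity. The same remark applies to `pull_comp_push`. -/
theorem push_comp_pull (f : X ⟶ Y) [PresheafedSpace.IsOpenImmersion f] {W : Opens X.carrier}
    {O O' : Opens Y.carrier} (h : W ≤ (Opens.map f.base).obj O)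
    (h' : ∀ y ∈ O', ∃ x ∈ W, f.base x = y) :
    BandHom.comp (push f h') (pull f h) =
      resHom Y (fun y hy => by obtain ⟨x, hx, rfl⟩ := h' y hy; exact h hx) := by
  have e1 : BandHom.comp (PresheafedSpace.IsOpenImmersion.invApp f W) (resHom X h) =
      BandHom.comp (resHom Y (Set.image_mono h))
        (PresheafedSpace.IsOpenImmersion.invApp f ((Opens.map f.base).obj O)) :=
    PresheafedSpace.IsOpenImmersion.inv_naturality f (homOfLE h).op
  have e2 : BandHom.comp (PresheafedSpace.IsOpenImmersion.invApp f ((Opens.map f.base).obj O))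
      (f.c.app (op O)) = resHom Y _ := PresheafedSpace.IsOpenImmersion.app_invApp f O
  change BandHom.comp (resHom Y _) (BandHom.comp (BandHom.comp
    (PresheafedSpace.IsOpenImmersion.invApp f W) (resHom X h)) (f.c.app (op O))) = _
  rw [e1]
  change BandHom.comp (resHom Y _) (BandHom.comp (resHom Y _) (BandHom.comp
    (PresheafedSpace.IsOpenImmersion.invApp f ((Opens.map f.base).obj O)) (f.c.app (op O)))) = _
  rw [e2]
  have e3 := resHom_comp (X := Y) (U := O)
    (V := (PresheafedSpace.IsOpenImmersion.opensFunctor f).obj ((Opens.map f.base).obj O))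
    (W := (PresheafedSpace.IsOpenImmersion.opensFunctor f).obj W)
    (Set.image_preimage_subset f.base O.1) (Set.image_mono h)
  refine (congrArg (fun g => BandHom.comp (resHom Y _) g) e3).trans ?_
  exact resHom_comp _ _

theorem pull_comp_push (f : X ⟶ Y) [PresheafedSpace.IsOpenImmersion f] {W W' : Opens X.carrier}
    {O : Opens Y.carrier} (h : ∀ y ∈ O, ∃ x ∈ W, f.base x = y)
    (h' : W' ≤ (Opens.map f.base).obj O) :
    BandHom.comp (pull f h') (push f h) = resHom X (fun x hx => by
      obtain ⟨y, hy, e⟩ := h _ (h' hx)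
      exact (PresheafedSpace.IsOpenImmersion.base_open (f := f)).injective e ▸ hy) := by
  have hle : (Opens.map f.base).obj ((PresheafedSpace.IsOpenImmersion.opensFunctor f).obj W) ≤
      W := fun x hx => by
    obtain ⟨y, hy, e⟩ := hx
    exact (PresheafedSpace.IsOpenImmersion.base_open (f := f)).injective e ▸ hy
  have e2 : BandHom.comp
      (f.c.app (op ((PresheafedSpace.IsOpenImmersion.opensFunctor f).obj W)))
      (PresheafedSpace.IsOpenImmersion.invApp f W) = resHom X hle :=
    (PresheafedSpace.IsOpenImmersion.invApp_app f W).trans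
      (congrArg X.presheaf.map (Subsingleton.elim _ _))
  have e3 := pull_comp_resHom f
    (O := (PresheafedSpace.IsOpenImmersion.opensFunctor f).obj W) (O' := O) h h'
  refine (congrArg (fun g => BandHom.comp g (PresheafedSpace.IsOpenImmersion.invApp f W))
    e3).trans ?_
  refine (congrArg (fun g => BandHom.comp (resHom X _) g) e2).trans ?_
  exact resHom_comp _ _

theorem resHom_comp_push (f : X ⟶ Y) [PresheafedSpace.IsOpenImmersion f] {W : Opens X.carrier}
    {O O' : Opens Y.carrier} (h : ∀ y ∈ O, ∃ x ∈ W, f.base x = y) (h' : O' ≤ O) :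
    BandHom.comp (resHom Y h') (push f h) = push f fun y hy => h y (h' hy) := by
  have := resHom_comp (X := Y) (U := (PresheafedSpace.IsOpenImmersion.opensFunctor f).obj W) h h'
  exact congrArg (fun g => BandHom.comp g (PresheafedSpace.IsOpenImmersion.invApp f W)) this

theorem push_comp_resHom (f : X ⟶ Y) [PresheafedSpace.IsOpenImmersion f] {W W' : Opens X.carrier}
    {O : Opens Y.carrier} (h' : W' ≤ W) (h : ∀ y ∈ O, ∃ x ∈ W', f.base x = y) :
    BandHom.comp (push f h) (resHom X h') =
      push f fun y hy => (h y hy).imp fun _ hx => ⟨h' hx.1, hx.2⟩ := by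
  have e1 : BandHom.comp (PresheafedSpace.IsOpenImmersion.invApp f W') (resHom X h') =
      BandHom.comp (resHom Y (Set.image_mono h'))
        (PresheafedSpace.IsOpenImmersion.invApp f W) :=
    PresheafedSpace.IsOpenImmersion.inv_naturality f (homOfLE h').op
  have e2 := resHom_comp (X := Y)
    (U := (PresheafedSpace.IsOpenImmersion.opensFunctor f).obj W)
    (V := (PresheafedSpace.IsOpenImmersion.opensFunctor f).obj W') (Set.image_mono h') h
  refine (congrArg (fun g => BandHom.comp (resHom Y _) g) e1).trans ?_
  exact congrArg (fun g => BandHom.comp g (PresheafedSpace.IsOpenImmersion.invApp f W)) e2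

end Sections

/-! ### Germs of units -/

/-- The germ at `x` of a section over `U` is a unit. -/
def IsUnitAt (X : PresheafedSpace BandCat.{u}) (x : X.carrier) {U : Opens X.carrier} (a : Γ X U) :
    Prop :=
  ∃ (V : Opens X.carrier) (_ : x ∈ V) (h : V ≤ U), IsUnit (resHom X h a)

theorem isUnitAt_resHom {X : PresheafedSpace BandCat.{u}} {x : X.carrier} {U V : Opens X.carrier}
    (h : V ≤ U) (hx : x ∈ V) (a : Γ X U) : IsUnitAt X x (resHom X h a) ↔ IsUnitAt X x a := by
  constructor
  · rintro ⟨W, hW, hWV, hu⟩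
    exact ⟨W, hW, hWV.trans h, by rwa [resHom_resHom] at hu⟩
  · rintro ⟨W, hW, hWU, hu⟩
    refine ⟨W ⊓ V, ⟨hW, hx⟩, inf_le_right, ?_⟩
    have := hu.map (resHom X (inf_le_left : W ⊓ V ≤ W))
    rwa [resHom_resHom] at this ⊢

theorem isUnitAt_iff_isUnit_germ {X : PresheafedSpace BandCat.{u}} {x : X.carrier}
    {U : Opens X.carrier} (hx : x ∈ U) (a : Γ X U) :
    IsUnitAt X x a ↔ IsUnit (TopCat.Presheaf.germ (X.presheaf ⋙ BandCat.toMon) U x hx a) := by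
  rw [isUnit_germ_iff]
  exact ⟨fun ⟨V, hV, h, hu⟩ => ⟨V, hV, homOfLE h, hu⟩, fun ⟨V, hV, i, hu⟩ => ⟨V, hV, i.le, hu⟩⟩

theorem IsUnitAt.pull {X Y : PresheafedSpace BandCat.{u}} (f : X ⟶ Y) {x : X.carrier}
    {O : Opens Y.carrier} {W : Opens X.carrier} (h : W ≤ (Opens.map f.base).obj O) (hx : x ∈ W)
    {a : Γ Y O} (ha : IsUnitAt Y (f.base x) a) : IsUnitAt X x (BandTheory.pull f h a) := by
  obtain ⟨V, hV, hVO, hu⟩ := ha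
  let W' := W ⊓ (Opens.map f.base).obj V
  have h1 : W' ≤ (Opens.map f.base).obj V := inf_le_right
  refine ⟨W', ⟨hx, hV⟩, inf_le_left, ?_⟩
  have e1 := DFunLike.congr_fun (pull_comp_resHom f hVO h1) a
  have e2 := DFunLike.congr_fun (resHom_comp_pull f h (inf_le_left : W' ≤ W)) a
  have := hu.map (BandTheory.pull f h1)
  exact (congrArg IsUnit (e1.trans e2.symm)).mp this

/-- This is the locality of the stalk maps, phrased without stalks. It is what makes the image of a
point of the null space meet the target stalk in the non-units. -/
theorem isUnitAt_pull {X Y : BandSpace.{u}} (f : X ⟶ Y) {x : X.carrier}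
    {O : Opens Y.carrier} {W : Opens X.carrier} (h : W ≤ (Opens.map f.hom.base).obj O) (hx : x ∈ W)
    {a : Γ Y.toPresheafedSpace O} :
    IsUnitAt X.toPresheafedSpace x (pull f.hom h a) ↔
      IsUnitAt Y.toPresheafedSpace (f.hom.base x) a := by
  refine ⟨fun H => ?_, IsUnitAt.pull f.hom h hx⟩
  have H' := (isUnitAt_resHom h hx (f.hom.c.app (op O) a)).1 H
  rw [isUnitAt_iff_isUnit_germ (h hx)] at H'
  refine (isUnitAt_iff_isUnit_germ (X := Y.toPresheafedSpace) (U := O) (h hx) a).2 ?_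
  refine (f.isLocal x).map_nonunit _ ?_
  have e := ConcreteCategory.congr_hom (PresheafedSpace.stalkMap_germ
    (BandCat.toMon.mapPresheaf.map f.hom) O x (h hx)) a
  exact (congrArg IsUnit e).mpr H'

theorem isLocalHom_stalkMap_of {X Y : PresheafedSpace BandCat.{u}} (f : X ⟶ Y) (x : X.carrier)
    (H : ∀ (O : Opens Y.carrier) (_ : f.base x ∈ O) (a : Γ Y O),
      IsUnitAt X x (pull f (le_refl ((Opens.map f.base).obj O)) a) → IsUnitAt Y (f.base x) a) :
    IsLocalHom
      (PresheafedSpace.Hom.stalkMap (BandCat.toMon.mapPresheaf.map f) x).hom := by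
  refine ⟨fun t ht => ?_⟩
  obtain ⟨O, hO, a, rfl⟩ := TopCat.Presheaf.exists_germ_eq (Y.presheaf ⋙ BandCat.toMon) t
  have e := ConcreteCategory.congr_hom (PresheafedSpace.stalkMap_germ
    (BandCat.toMon.mapPresheaf.map f) O x hO) a
  have h1 := (congrArg IsUnit e).mp ht
  refine (isUnitAt_iff_isUnit_germ hO a).1 (H O hO a ?_)
  refine (isUnitAt_resHom (le_refl ((Opens.map f.base).obj O)) hO (f.c.app (op O) a)).2 ?_
  exact (isUnitAt_iff_isUnit_germ (U := (Opens.map f.base).obj O) hO (f.c.app (op O) a)).2 h1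

/-- If the pull back of a section becomes invertible on `V`, then `push` carries the inverse to the
image of `V`. -/
theorem isLocalHom_stalkMap_of_isOpenImmersion {X Y : PresheafedSpace BandCat.{u}} (f : X ⟶ Y)
    [PresheafedSpace.IsOpenImmersion f] (x : X.carrier) : IsLocalHom
      (PresheafedSpace.Hom.stalkMap (BandCat.toMon.mapPresheaf.map f) x).hom := by
  refine isLocalHom_stalkMap_of f x ?_
  rintro O - a ⟨V, hV, hVO, hu⟩
  let V' : Opens Y.carrier := (PresheafedSpace.IsOpenImmersion.opensFunctor f).obj V
  have hp : ∀ y ∈ V', ∃ x ∈ V, f.base x = y := fun y hy => hy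
  refine ⟨V', ⟨x, hV, rfl⟩, ?_, ?_⟩
  · rintro _ ⟨z, hz, rfl⟩
    exact hVO hz
  · have h1 := hu.map (push f hp)
    have e1 := DFunLike.congr_fun (resHom_comp_pull f (le_refl ((Opens.map f.base).obj O)) hVO) a
    have e2 := DFunLike.congr_fun (push_comp_pull f hVO hp) a
    exact (congrArg IsUnit ((congrArg (push f hp) e1).trans e2)).mp h1

/-! ### The null space of a band space -/

theorem PrimeNullIdeal.mem_comap {B C : Type u} [Band B] [Band C] (f : BandHom B C)
    (p : PrimeNullIdeal C) (x : Ambient B) : x ∈ (comap f p).ideal ↔ f.plus x ∈ p.ideal :=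
  Iff.rfl

theorem BandHom.plus_of {B C : Type u} [Band B] [Band C] (f : BandHom B C) (b : B) :
    f.plus (Ambient.of B b) = Ambient.of C (f b) :=
  Ambient.map_of _ _

theorem BandHom.plus_comp {B C D : Type u} [Band B] [Band C] [Band D] (g : BandHom C D)
    (f : BandHom B C) (x : Ambient B) : (BandHom.comp g f).plus x = g.plus (f.plus x) :=
  congrArg (fun h : Ambient B →+* Ambient D => h x)
    (Ambient.map_comp g.toMonoidWithZeroHom f.toMonoidWithZeroHom)

/-- A point of the null space of a band space: a point `x` together with a prime null ideal of the
stalk at `x` that meets the stalk in the set of non-units. The prime null ideal of the stalk is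
recorded by the compatible family of its inverse images. -/
structure NullPoint (X : PresheafedSpace BandCat.{u}) : Type u where
  pt : X.carrier
  ideal : ∀ U : Opens X.carrier, pt ∈ U → PrimeNullIdeal (Γ X U)
  comap_ideal : ∀ {U V : Opens X.carrier} (h : V ≤ U) (hx : pt ∈ V),
    PrimeNullIdeal.comap (resHom X h) (ideal V hx) = ideal U (h hx)
  -- Without this condition the ideal could lie over a proper generization of `pt`; the condition
  -- ties the ideal to the point, so that each ideal is counted once.
  of_mem_iff : ∀ {U : Opens X.carrier} (hx : pt ∈ U) (a : Γ X U),
    Ambient.of _ a ∈ (ideal U hx).ideal ↔ ¬ IsUnitAt X pt a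

namespace NullPoint

theorem ext {X : PresheafedSpace BandCat.{u}} {ξ ζ : NullPoint X} (h : ξ.pt = ζ.pt)
    (h' : ∀ U h1 h2, ξ.ideal U h1 = ζ.ideal U h2) : ξ = ζ := by
  obtain ⟨x, I, h3, h4⟩ := ξ
  obtain ⟨y, J, h5, h6⟩ := ζ
  obtain rfl : x = y := h
  obtain rfl : I = J := funext fun U => funext fun hU => h' U hU hU
  rfl

/-- The set of points over `U` at which `h ∈ 𝒪(U)⁺` does not vanish. -/
def basicOpen {X : PresheafedSpace BandCat.{u}} {U : Opens X.carrier} (h : Ambient (Γ X U)) :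
    Set (NullPoint X) :=
  {ξ | ∃ hx : ξ.pt ∈ U, h ∉ (ξ.ideal U hx).ideal}

instance (X : PresheafedSpace BandCat.{u}) : TopologicalSpace (NullPoint X) :=
  TopologicalSpace.generateFrom
    (Set.range fun h : (Σ U : Opens X.carrier, Ambient (Γ X U)) => basicOpen h.2)

theorem isOpen_basicOpen {X : PresheafedSpace BandCat.{u}} {U : Opens X.carrier}
    (h : Ambient (Γ X U)) : IsOpen (basicOpen h) :=
  TopologicalSpace.isOpen_generateFrom_of_mem ⟨⟨U, h⟩, rfl⟩

theorem basicOpen_one {X : PresheafedSpace BandCat.{u}} (U : Opens X.carrier) :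
    basicOpen (1 : Ambient (Γ X U)) = {ξ | ξ.pt ∈ U} :=
  Set.ext fun ξ => ⟨fun h => h.1, fun h => ⟨h, (ξ.ideal U h).one_notMem⟩⟩

/-- The part of the null space over `U` is the locus where `1 ∈ 𝒪(U)⁺` does not vanish. -/
theorem continuous_pt {X : PresheafedSpace BandCat.{u}} :
    Continuous (pt : NullPoint X → X.carrier) := by
  refine continuous_def.2 fun U hU => ?_
  have := isOpen_basicOpen (1 : Ambient (Γ X (⟨U, hU⟩ : Opens X.carrier)))
  rwa [basicOpen_one] at this

variable {X Y Z : BandSpace.{u}}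

theorem comap_pull_ideal (f : X ⟶ Y) (ξ : NullPoint X.toPresheafedSpace) {O : Opens Y.carrier}
    {W : Opens X.carrier} (h : W ≤ (Opens.map f.hom.base).obj O) (hx : ξ.pt ∈ W) :
    PrimeNullIdeal.comap (pull f.hom h) (ξ.ideal W hx) =
      PrimeNullIdeal.comap (pull f.hom le_rfl) (ξ.ideal ((Opens.map f.hom.base).obj O) (h hx)) := by
  rw [← ξ.comap_ideal h hx, ← PrimeNullIdeal.comap_comp, resHom_comp_pull]

/-- The map of null spaces induced by a morphism of band spaces. -/
def map (f : X ⟶ Y) (ξ : NullPoint X.toPresheafedSpace) : NullPoint Y.toPresheafedSpace where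
  pt := f.hom.base ξ.pt
  ideal O hO := PrimeNullIdeal.comap (pull f.hom (le_refl ((Opens.map f.hom.base).obj O)))
    (ξ.ideal _ hO)
  comap_ideal {U V} h hx := by
    rw [← PrimeNullIdeal.comap_comp, pull_comp_resHom]
    exact comap_pull_ideal f ξ (fun _ hx => h hx) hx
  of_mem_iff {U} hx a := by
    rw [PrimeNullIdeal.mem_comap, BandHom.plus_of]
    exact (ξ.of_mem_iff _ _).trans (not_congr (isUnitAt_pull f _ hx))

theorem map_ideal (f : X ⟶ Y) (ξ : NullPoint X.toPresheafedSpace) {O : Opens Y.carrier}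
    {W : Opens X.carrier} (h : W ≤ (Opens.map f.hom.base).obj O) (hx : ξ.pt ∈ W) :
    (map f ξ).ideal O (h hx) = PrimeNullIdeal.comap (pull f.hom h) (ξ.ideal W hx) :=
  (comap_pull_ideal f ξ h hx).symm

theorem continuous_map (f : X ⟶ Y) : Continuous (map f) := by
  refine continuous_generateFrom_iff.2 ?_
  rintro _ ⟨⟨O, h⟩, rfl⟩
  exact isOpen_basicOpen ((pull f.hom (le_refl ((Opens.map f.hom.base).obj O))).plus h)

theorem map_id (ξ : NullPoint X.toPresheafedSpace) : map (𝟙 X) ξ = ξ := by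
  refine ext rfl fun U h1 h2 => ?_
  change PrimeNullIdeal.comap (pull (𝟙 X.toPresheafedSpace) (le_refl U)) _ = _
  rw [pull_id]
  exact ξ.comap_ideal le_rfl h2

theorem map_comp (f : X ⟶ Y) (g : Y ⟶ Z) (ξ : NullPoint X.toPresheafedSpace) :
    map (f ≫ g) ξ = map g (map f ξ) := by
  refine ext rfl fun U h1 h2 => ?_
  change _ = PrimeNullIdeal.comap _ (PrimeNullIdeal.comap _ _)
  rw [← PrimeNullIdeal.comap_comp, pull_comp]
  rfl

end NullPoint

/-- The null space functor. -/
def nullSpace : BandScheme.{u} ⥤ TopCat.{u} where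
  obj X := TopCat.of (NullPoint X.obj.toPresheafedSpace)
  map f := TopCat.ofHom ⟨NullPoint.map f.hom, NullPoint.continuous_map f.hom⟩
  map_id _ := TopCat.hom_ext (ContinuousMap.ext NullPoint.map_id)
  map_comp f g := TopCat.hom_ext (ContinuousMap.ext (NullPoint.map_comp f.hom g.hom))

/-- The projection from the null space to the underlying space. -/
def nullSpacePi : nullSpace.{u} ⟶ toTop where
  app _ := TopCat.ofHom ⟨NullPoint.pt, NullPoint.continuous_pt⟩
  naturality _ _ _ := rfl

end

end BandTheory

/-! ### Prime null ideals of localizations and the null space of a spectrum. -/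

namespace BandTheory

noncomputable section

open AlgebraicGeometry

/-! ### Prime null ideals of localizations -/

section Localization

variable {B : Type u} [Band B] (S : Submonoid B)

/-- The localization map as a band morphism. -/
def locBandHom : BandHom B (Localization S) where
  toMonoidWithZeroHom := locMap S
  map_nullSet _ hx := Ideal.mem_map_of_mem _ hx

theorem exists_mul_eq_plus (r : Ambient (Localization S)) :
    ∃ (s : S) (x : Ambient B),
      Ambient.of _ (locMap S s) * r = (locBandHom S).plus x :=
  exists_mul_eq_map S r

variable {S}

/-- Two numerators of `z` become proportional in `B⁺` after multiplication by elements of `S`, and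
these factors can be cancelled because `p` is prime and avoids `S`. Membership in the extended ideal
can therefore be tested on any one numerator. -/
theorem mem_iff_of_mul_eq (p : PrimeNullIdeal B) (hS : ∀ s : S, Ambient.of B s ∉ p.ideal)
    {z : Ambient (Localization S)} {s t : S} {x y : Ambient B}
    (hx : Ambient.of _ (locMap S s) * z = (locBandHom S).plus x)
    (hy : Ambient.of _ (locMap S t) * z = (locBandHom S).plus y) (h : x ∈ p.ideal) :
    y ∈ p.ideal := by
  have key : (locBandHom S).plus (Ambient.of B t * x) =
      (locBandHom S).plus (Ambient.of B s * y) := by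
    rw [map_mul, map_mul, ← hx, ← hy, BandHom.plus_of, BandHom.plus_of]
    change Ambient.of _ (locMap S t) * _ = Ambient.of _ (locMap S s) * _
    ring
  obtain ⟨w, hw⟩ := exists_mul_eq_of_map_eq S key
  by_contra hy'
  refine p.mul_notMem (hS w) (p.mul_notMem (hS s) hy') ?_
  rw [← hw]
  exact Ideal.mul_mem_left _ _ (Ideal.mul_mem_left _ _ h)

/-- The extension to `S⁻¹B` of a prime null ideal of `B` that does not meet `S`. -/
def locIdeal (p : PrimeNullIdeal B) (_hS : ∀ s : S, Ambient.of B s ∉ p.ideal) :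
    Ideal (Ambient (Localization S)) where
  carrier := {z | ∃ (s : S), ∃ x ∈ p.ideal,
    Ambient.of _ (locMap S s) * z = (locBandHom S).plus x}
  zero_mem' := ⟨1, 0, zero_mem _, by simp⟩
  add_mem' := by
    rintro z w ⟨s, x, hx, hs⟩ ⟨t, y, hy, ht⟩
    refine ⟨s * t, Ambient.of B t * x + Ambient.of B s * y,
      add_mem (Ideal.mul_mem_left _ _ hx) (Ideal.mul_mem_left _ _ hy), ?_⟩
    rw [map_add, map_mul, map_mul, BandHom.plus_of, BandHom.plus_of, ← hs, ← ht]
    change _ = Ambient.of _ (locMap S t) * _ + Ambient.of _ (locMap S s) * _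
    simp only [Submonoid.coe_mul, map_mul]
    ring
  smul_mem' := by
    rintro r z ⟨s, x, hx, hs⟩
    obtain ⟨t, y, ht⟩ := exists_mul_eq_plus S r
    refine ⟨s * t, y * x, Ideal.mul_mem_left _ _ hx, ?_⟩
    rw [map_mul, ← hs, ← ht]
    simp only [Submonoid.coe_mul, map_mul, smul_eq_mul]
    ring

theorem mem_locIdeal_iff {p : PrimeNullIdeal B} (hS : ∀ s : S, Ambient.of B s ∉ p.ideal)
    {z : Ambient (Localization S)} {s : S} {x : Ambient B}
    (hx : Ambient.of _ (locMap S s) * z = (locBandHom S).plus x) :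
    z ∈ locIdeal p hS ↔ x ∈ p.ideal :=
  ⟨fun ⟨_, _, hy, ht⟩ => mem_iff_of_mul_eq p hS ht hx hy, fun h => ⟨s, x, h, hx⟩⟩

theorem exists_mul_eq_locMap (a : Localization S) :
    ∃ (s : S) (b : B), locMap S s * a = locMap S b := by
  induction a using Localization.induction_on with
  | H p => exact ⟨p.2, p.1, locMap_mul_mk S p.1 p.2⟩

/-- The extension to `S⁻¹B` of a prime null ideal of `B` that does not meet `S`. -/
def locExt (p : PrimeNullIdeal B) (hS : ∀ s : S, Ambient.of B s ∉ p.ideal) :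
    PrimeNullIdeal (Localization S) where
  ideal := locIdeal p hS
  isNullIdeal :=
    { nullSet_le := fun z hz => by
        obtain ⟨s, y, hy, h⟩ := exists_mul_eq_of_mem S hz
        exact ⟨s, y, p.isNullIdeal.nullSet_le hy, h⟩
      subst := fun a c z h1 h2 => by
        -- With the common denominator `s * t * v` for `a`, `c` and `z`, both hypotheses and the
        -- conclusion turn into statements about numerators in `B⁺`, where the substitution rule of
        -- `p` applies.
        obtain ⟨s, a', ha⟩ := exists_mul_eq_locMap a
        obtain ⟨t, c', hc⟩ := exists_mul_eq_locMap c
        obtain ⟨v, z', hz⟩ := exists_mul_eq_plus S z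
        have ea : locMap S ↑(s * t * v) * a = locMap S (t * v * a') := by
          simp only [Submonoid.coe_mul, map_mul, ← ha]; ac_rfl
        have ec : locMap S ↑(s * t * v) * c = locMap S (s * v * c') := by
          simp only [Submonoid.coe_mul, map_mul, ← hc]; ac_rfl
        have ez : Ambient.of _ (locMap S ↑(s * t * v)) * z =
            (locBandHom S).plus (Ambient.of B (s * t) * z') := by
          rw [map_mul, ← hz, BandHom.plus_of]
          change _ = Ambient.of _ (locMap S (s * t)) * _
          simp only [Submonoid.coe_mul, map_mul]; ring
        have hof : ∀ b : B, (locBandHom S).plus (Ambient.of B b) =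
          Ambient.of _ (locMap S b) := fun b => BandHom.plus_of _ b
        have hneg : locMap S (negB (s * v * c')) = negB (locMap S (s * v * c')) :=
          BandHom.map_neg (locBandHom S) _
        rw [mem_locIdeal_iff hS (s := s * t * v)
          (x := Ambient.of B (t * v * a') + Ambient.of B (negB (s * v * c')))
          (by rw [mul_add, ← map_mul, ← map_mul, map_add, hof, hof, ea, mul_neg_eq, ec, hneg])]
          at h1
        rw [mem_locIdeal_iff hS (s := s * t * v)
          (x := Ambient.of B (s * v * c') + Ambient.of B (s * t) * z')
          (by rw [mul_add, ← map_mul, map_add, hof, ez, ec])] at h2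
        rw [mem_locIdeal_iff hS (s := s * t * v)
          (x := Ambient.of B (t * v * a') + Ambient.of B (s * t) * z')
          (by rw [mul_add, ← map_mul, map_add, hof, ez, ea])]
        exact p.isNullIdeal.subst _ _ _ h1 h2 }
  one_notMem := by
    rw [mem_locIdeal_iff hS (s := 1) (x := 1) (by simp)]
    exact p.one_notMem
  mul_notMem {z w} hz hw := by
    obtain ⟨s, x, hs⟩ := exists_mul_eq_plus S z
    obtain ⟨t, y, ht⟩ := exists_mul_eq_plus S w
    rw [mem_locIdeal_iff hS hs] at hz
    rw [mem_locIdeal_iff hS ht] at hw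
    rw [mem_locIdeal_iff hS (s := s * t) (x := x * y) (by
      rw [map_mul, ← hs, ← ht]
      simp only [Submonoid.coe_mul, map_mul]
      ring)]
    exact p.mul_notMem hz hw

theorem mem_locExt_iff {p : PrimeNullIdeal B} (hS : ∀ s : S, Ambient.of B s ∉ p.ideal)
    {z : Ambient (Localization S)} {s : S} {x : Ambient B}
    (hx : Ambient.of _ (locMap S s) * z = (locBandHom S).plus x) :
    z ∈ (locExt p hS).ideal ↔ x ∈ p.ideal :=
  mem_locIdeal_iff hS hx

theorem comap_locExt (p : PrimeNullIdeal B) (hS : ∀ s : S, Ambient.of B s ∉ p.ideal) :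
    PrimeNullIdeal.comap (locBandHom S) (locExt p hS) = p :=
  PrimeNullIdeal.ext (Ideal.ext fun _ => mem_locExt_iff hS (s := 1) (by simp))

end Localization

/-! ### Sections over the spectrum -/

section SpecSections

open PrimeMIdeal

variable {B : Type u} [Band B] {U V : Opens (specTop B)}

/-- The element `b` of `B` as a section over `U`. -/
def toSections (U : Opens (specTop B)) : BandHom B (Sections U) where
  toFun b := ⟨fun p => locMap p.1.compl b,
    fun _ => ⟨⊤, trivial, b, 1, fun _ _ => ⟨one_mem _, rfl⟩⟩⟩
  map_zero' := Sections.ext fun p => map_zero (locMap p.1.compl)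
  map_one' := Sections.ext fun p => map_one (locMap p.1.compl)
  map_mul' _ _ := Sections.ext fun p => map_mul (locMap p.1.compl) _ _
  map_nullSet x hx := by
    rw [Sections.mem_nullSet]
    intro p
    rw [← RingHom.comp_apply, ← Ambient.map_comp]
    exact (locBandHom p.1.compl).map_nullSet x hx

/-- Evaluation of sections at a point as a band morphism. -/
def evalHom (p : U) : BandHom (Sections U) (LocAt p.1) where
  toMonoidWithZeroHom := Sections.eval p
  map_nullSet _ hx := Sections.mem_nullSet.1 hx p

theorem evalHom_comp_toSections (p : U) :
    BandHom.comp (evalHom p) (toSections U) = locBandHom p.1.compl := rfl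

theorem res_comp_toSections (h : V ≤ U) :
    BandHom.comp (Sections.res h) (toSections U) = toSections V := rfl

theorem isUnit_mk {p : PrimeMIdeal B} {a : B} (ha : a ∉ p.carrier) (s : p.compl) :
    IsUnit (Localization.mk a s : LocAt p) := by
  refine IsUnit.of_mul_eq_one (Localization.mk s ⟨a, ha⟩) ?_
  rw [Localization.mk_mul, ← Localization.mk_one, Localization.mk_eq_mk_iff,
    Localization.r_iff_exists]
  exact ⟨1, by simp [mul_comm]⟩

theorem isUnitAt_spec_iff {B : BandCat.{u}} {U : Opens (specTop B)} {p : PrimeMIdeal B}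
    (hp : p ∈ U) (s : Sections U) :
    IsUnitAt (specObj B).toPresheafedSpace p (U := U) s ↔ IsUnit (s.1 ⟨p, hp⟩) := by
  constructor
  · rintro ⟨V, hV, h, hu⟩
    exact hu.map (Sections.eval (⟨p, hV⟩ : V))
  · intro hu
    -- The extension of a unit value to a neighbourhood is available for pull backs along a band
    -- morphism; the identity of `B` gives the case needed here.
    obtain ⟨V, h, hV, hu'⟩ := exists_isUnit_res (BandHom.id B) p U hp s
      ((congrArg IsUnit (locHom_id p _)).mpr hu)
    exact ⟨V, hV, h, hu'⟩

/-- An element of `𝒪(U)⁺` is a finite sum of sections, each a fraction near `p`, so a common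
denominator exists on some neighbourhood. That `b` stays outside every prime of `V`, and not just
outside `p`, is what yields continuity of `ofNull`. -/
theorem exists_mul_res_eq (p : PrimeMIdeal B) (hp : p ∈ U) (x : Ambient (Sections U)) :
    ∃ (V : Opens (specTop B)) (h : V ≤ U) (_ : p ∈ V) (b : B) (_ : ∀ q ∈ V, b ∉ q.carrier)
      (y : Ambient B),
      Ambient.of _ (toSections V b) * (Sections.res h).plus x = (toSections V).plus y := by
  induction x using Ambient.induction with
  | h0 => exact ⟨U, le_rfl, hp, 1, fun q _ => q.one_notMem, 0, by simp⟩
  | hadd s x ih =>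
    obtain ⟨V, h, hV, b, hb, y, hy⟩ := ih
    obtain ⟨W, hW, a, k, H⟩ := s.2 ⟨p, hp⟩
    have h1 : V ⊓ W ≤ V := inf_le_left
    have hk : ∀ q ∈ V ⊓ W, k ∉ q.carrier := fun q hq => (H ⟨q, h hq.1⟩ hq.2).1
    refine ⟨V ⊓ W, h1.trans h, ⟨hV, hW⟩, k * b, fun q hq => q.mul_notMem (hk q hq) (hb q hq.1),
      Ambient.of B (a * b) + Ambient.of B k * y, ?_⟩
    have e1 : toSections (V ⊓ W) k * Sections.res (h1.trans h) s = toSections (V ⊓ W) a := by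
      refine Sections.ext fun q => ?_
      obtain ⟨h2, e2⟩ := H ⟨q.1, h q.2.1⟩ q.2.2
      change locMap _ k * s.1 ⟨q.1, _⟩ = locMap _ a
      rw [e2]
      exact locMap_mul_mk q.1.compl a ⟨k, h2⟩
    have e2 : Ambient.of _ (toSections (V ⊓ W) b) * (Sections.res (h1.trans h)).plus x =
        (toSections (V ⊓ W)).plus y := by
      have := congrArg (Sections.res h1).plus hy
      rw [map_mul, BandHom.plus_of, ← BandHom.plus_comp, ← BandHom.plus_comp,
        res_comp_toSections] at this
      exact this
    rw [map_add, map_add, map_mul (toSections (V ⊓ W)).plus, ← e2, BandHom.plus_of,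
      BandHom.plus_of, BandHom.plus_of, map_mul (toSections (V ⊓ W)),
      map_mul (toSections (V ⊓ W)), ← e1]
    simp only [map_mul]
    ring

end SpecSections

/-! ### The null space of a spectrum -/

section SpecNull

variable {B : BandCat.{u}}

/-- The prime null ideal of `B` given by a point of the null space of `Spec B`. -/
def toNull (ξ : NullPoint (specObj B).toPresheafedSpace) : PrimeNullIdeal B :=
  PrimeNullIdeal.comap (toSections (B := B) ⊤) (ξ.ideal ⊤ trivial)

theorem comap_toSections_ideal (ξ : NullPoint (specObj B).toPresheafedSpace)
    (U : Opens (specTop B)) (hU : ξ.pt ∈ U) :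
    PrimeNullIdeal.comap (toSections U) (ξ.ideal U hU) = toNull ξ := by
  refine Eq.trans ?_ (congrArg (PrimeNullIdeal.comap (toSections ⊤))
    (ξ.comap_ideal (U := ⊤) (V := U) le_top hU))
  exact PrimeNullIdeal.comap_comp (Sections.res le_top) (toSections ⊤) (ξ.ideal U hU)

/-- This is where the condition on units in `NullPoint` enters: `b` lies in the ideal iff its germ
at the point is not a unit, iff `b` lies in the prime `m`-ideal that is the point. -/
theorem inter_toNull (ξ : NullPoint (specObj B).toPresheafedSpace) :
    PrimeNullIdeal.inter (toNull ξ) = ξ.pt := by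
  refine PrimeMIdeal.ext (Set.ext fun b => ?_)
  change (toSections (B := B) ⊤).plus (Ambient.of B b) ∈ (ξ.ideal ⊤ trivial).ideal ↔ _
  rw [BandHom.plus_of]
  refine (ξ.of_mem_iff (U := ⊤) trivial _).trans ?_
  refine (not_congr (isUnitAt_spec_iff (U := ⊤) (p := ξ.pt) trivial _)).trans ?_
  have : IsUnit ((toSections (B := B) ⊤ b).1 ⟨ξ.pt, trivial⟩) ↔ b ∉ PrimeMIdeal.carrier ξ.pt :=
    ⟨notMem_of_isUnit_mk, fun h => isUnit_mk h _⟩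
  rw [this, not_not]

theorem of_notMem_of_mem_compl (p : PrimeNullIdeal B) (s : (PrimeNullIdeal.inter p).compl) :
    Ambient.of B s ∉ p.ideal := s.2

/-- The point of the null space of `Spec B` given by a prime null ideal of `B`. -/
def ofNull (p : PrimeNullIdeal B) : NullPoint (specObj B).toPresheafedSpace where
  pt := PrimeNullIdeal.inter p
  ideal (U : Opens (specTop B)) hU := PrimeNullIdeal.comap (evalHom (U := U) ⟨PrimeNullIdeal.inter p, hU⟩)
    (locExt p (of_notMem_of_mem_compl p))
  comap_ideal {U V : Opens (specTop B)} (h : V ≤ U) hx :=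
    (PrimeNullIdeal.comap_comp (evalHom (U := V) ⟨PrimeNullIdeal.inter p, hx⟩) (Sections.res h)
      (locExt p (of_notMem_of_mem_compl p))).symm
  of_mem_iff {U : Opens (specTop B)} hx (s : Sections U) := by
    refine Iff.trans ?_ (not_congr (isUnitAt_spec_iff (U := U) hx s)).symm
    change (evalHom (U := U) ⟨PrimeNullIdeal.inter p, hx⟩).plus (Ambient.of (Sections U) s) ∈
      (locExt p (of_notMem_of_mem_compl p)).ideal ↔ _
    rw [BandHom.plus_of]
    change Ambient.of _ (Sections.val s ⟨PrimeNullIdeal.inter p, hx⟩) ∈ _ ↔ _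
    generalize Sections.val s ⟨PrimeNullIdeal.inter p, hx⟩ = z
    induction z using Localization.induction_on with
    | H w =>
      obtain ⟨a, t⟩ := w
      rw [mem_locExt_iff (of_notMem_of_mem_compl p) (s := t) (x := Ambient.of B a)
        (by rw [← map_mul, locMap_mul_mk, BandHom.plus_of]; rfl)]
      exact ⟨fun h hu => notMem_of_isUnit_mk hu h, fun h => by_contra fun h' => h (isUnit_mk h' t)⟩

/-- Membership is read off from a local numerator `y`. `mem_ideal_iff_mem_toNull` gives the same
criterion for an arbitrary point over `Spec B`, and comparing the two shows that `ofNull` and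
`toNull` are inverse to each other. -/
theorem mem_ofNull_iff (p : PrimeNullIdeal B) {U V : Opens (specTop B)} (h : V ≤ U)
    (hp : PrimeNullIdeal.inter p ∈ V) {b : B} (hb : b ∉ (PrimeNullIdeal.inter p).carrier)
    {x : Ambient (Sections U)} {y : Ambient B}
    (hy : Ambient.of _ (toSections V b) * (Sections.res h).plus x = (toSections V).plus y) :
    x ∈ ((ofNull p).ideal U (h hp)).ideal ↔ y ∈ p.ideal := by
  refine mem_locExt_iff (of_notMem_of_mem_compl p) (s := ⟨b, hb⟩) ?_
  have := congrArg (evalHom (U := V) ⟨PrimeNullIdeal.inter p, hp⟩).plus hy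
  rw [map_mul, BandHom.plus_of, ← BandHom.plus_comp, ← BandHom.plus_comp] at this
  exact this

theorem toNull_ofNull (p : PrimeNullIdeal B) : toNull (ofNull p) = p :=
  (PrimeNullIdeal.comap_comp _ _ _).symm.trans (comap_locExt p (of_notMem_of_mem_compl p))

theorem mem_ideal_iff_mem_toNull (ξ : NullPoint (specObj B).toPresheafedSpace)
    {U V : Opens (specTop B)} (h : V ≤ U)
    (hp : ξ.pt ∈ V) {b : B} (hb : b ∉ PrimeMIdeal.carrier ξ.pt)
    {x : Ambient (Sections U)} {y : Ambient B}
    (hy : Ambient.of _ (toSections V b) * (Sections.res h).plus x = (toSections V).plus y) :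
    x ∈ (ξ.ideal U (h hp)).ideal ↔ y ∈ (toNull ξ).ideal := by
  let I : PrimeNullIdeal (Sections V) := ξ.ideal V hp
  have hI : PrimeNullIdeal.comap (toSections V) I = toNull ξ := comap_toSections_ideal ξ V hp
  have hU : PrimeNullIdeal.comap (Sections.res h) I = ξ.ideal U (h hp) := ξ.comap_ideal h hp
  rw [← hU, ← hI]
  change (Sections.res h).plus x ∈ I.ideal ↔ (toSections V).plus y ∈ I.ideal
  rw [← hy]
  refine ⟨fun hx => Ideal.mul_mem_left _ _ hx, fun hx => ?_⟩
  -- The factor `b` is not in the ideal because it is not in the prime `ξ.pt`, so primality allows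
  -- cancelling it.
  by_contra hx'
  refine I.mul_notMem ?_ hx' hx
  rw [← BandHom.plus_of, ← PrimeNullIdeal.mem_comap, hI]
  rw [← inter_toNull ξ] at hb
  exact hb

theorem ofNull_toNull (ξ : NullPoint (specObj B).toPresheafedSpace) : ofNull (toNull ξ) = ξ := by
  refine NullPoint.ext (inter_toNull ξ) fun U h1 h2 => ?_
  refine PrimeNullIdeal.ext (Ideal.ext fun x => ?_)
  obtain ⟨V, h, hV, b, hb, y, hy⟩ := exists_mul_res_eq ξ.pt h2 x
  have hV' : PrimeNullIdeal.inter (toNull ξ) ∈ V := (inter_toNull ξ).symm ▸ hV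
  exact (mem_ofNull_iff (toNull ξ) h hV' (hb _ hV') hy).trans
    (mem_ideal_iff_mem_toNull ξ h hV (hb _ hV) hy).symm

theorem continuous_toNull : Continuous (toNull (B := B)) := by
  refine continuous_generateFrom_iff.2 ?_
  rintro _ ⟨h, rfl⟩
  have := NullPoint.isOpen_basicOpen (X := (specObj B).toPresheafedSpace) (U := ⊤)
    ((toSections (B := B) ⊤).plus h)
  refine (congrArg IsOpen (Set.ext fun ξ => ?_)).mp this
  exact ⟨fun ⟨_, h⟩ => h, fun h => ⟨trivial, h⟩⟩

/-- The expression of `x` by the numerator `y` is valid on all of `V`, so over `V` the locus of `x`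
is the nonvanishing locus of `y`. -/
theorem continuous_ofNull : Continuous (ofNull (B := B)) := by
  refine continuous_generateFrom_iff.2 ?_
  rintro _ ⟨⟨U, x⟩, rfl⟩
  refine isOpen_iff_mem_nhds.2 fun p hp => ?_
  obtain ⟨hpU, hpx⟩ := hp
  obtain ⟨V, h, hV, b, hb, y, hy⟩ := exists_mul_res_eq (PrimeNullIdeal.inter p) hpU x
  have h1 : IsOpen (PrimeNullIdeal.inter ⁻¹' V.1 ∩ PrimeNullIdeal.basicOpen y) :=
    (V.2.preimage PrimeNullIdeal.continuous_inter).inter (PrimeNullIdeal.isOpen_basicOpen y)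
  refine Filter.mem_of_superset (h1.mem_nhds ⟨hV, ?_⟩) ?_
  · exact fun hy' => hpx ((mem_ofNull_iff p h hV (hb _ hV) hy).2 hy')
  · rintro q ⟨hqV, hq⟩
    exact ⟨h hqV, fun hx => hq ((mem_ofNull_iff q h hqV (hb _ hqV) hy).1 hx)⟩

variable (B) in
/-- The null space of `Spec B` is the space of prime null ideals of `B`. -/
def specNullHomeo : NullPoint (specObj B).toPresheafedSpace ≃ₜ PrimeNullIdeal B where
  toFun := toNull
  invFun := ofNull
  left_inv := ofNull_toNull
  right_inv := toNull_ofNull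
  continuous_toFun := continuous_toNull
  continuous_invFun := continuous_ofNull

theorem pullSections_comp_toSections {C : BandCat.{u}} (f : BandHom B C) (U : Opens (specTop B)) :
    BandHom.comp (pullSections f U) (toSections U) =
      BandHom.comp (toSections ((Opens.map (specBase f)).obj U)) f := by
  refine BandHom.ext (B := B) (C := Sections _) fun b => Sections.ext fun q => ?_
  exact PrimeMIdeal.locMonoidHom_locMap f q.1 b

theorem toNull_map {B C : BandCat.{u}ᵒᵖ} (f : C ⟶ B) (ξ : NullPoint
    (specObj C.unop).toPresheafedSpace) :
    toNull (NullPoint.map (specFunctor.map f) ξ) = PrimeNullIdeal.comap f.unop (toNull ξ) := by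
  unfold toNull
  refine (PrimeNullIdeal.comap_comp _ _ _).symm.trans
    (Eq.trans ?_ (PrimeNullIdeal.comap_comp _ _ _))
  exact congrArg (fun g => PrimeNullIdeal.comap g (ξ.ideal ⊤ trivial))
    (pullSections_comp_toSections f.unop ⊤)

/-- The natural isomorphism between `Null` and the null space of the spectrum. -/
def nullSpaceEta : Null.{u} ≅ Spec ⋙ nullSpace :=
  (NatIso.ofComponents (F := Spec ⋙ nullSpace) (G := Null)
    (fun B => TopCat.isoOfHomeo (specNullHomeo B.unop))
    (fun f => TopCat.hom_ext (ContinuousMap.ext fun ξ => toNull_map f ξ))).symm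

/-- The point underlying `ofNull p` is `p ∩ B` by construction. -/
theorem piBar_eq_nullSpaceEta : piBar.{u} =
    nullSpaceEta.hom ≫ Functor.whiskerLeft Spec nullSpacePi := by
  rfl

end SpecNull

end

end BandTheory

/-! ### Principal open subsets and global sections of spectra. -/

namespace BandTheory

noncomputable section

open AlgebraicGeometry

/-! ### The universal property of localizations -/

section LocLift

variable {B C : Type u} [Band B] [Band C] (S : Submonoid B)

/-- The universal property of the localization of a band. -/
def locLift (f : BandHom B C) (hf : ∀ s : S, IsUnit (f s)) : BandHom (Localization S) C where
  toMonoidWithZeroHom := (Localization.monoidOf S).lift₀ f.toMonoidWithZeroHom hf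
  map_nullSet := by
    have : nullSet (Localization S) ≤ (nullSet C).comap
        (Ambient.map ((Localization.monoidOf S).lift₀ f.toMonoidWithZeroHom hf)) := by
      refine Ideal.map_le_iff_le_comap.2 fun y hy => ?_
      rw [Ideal.mem_comap, Ideal.mem_comap]
      have e : ((Localization.monoidOf S).lift₀ f.toMonoidWithZeroHom hf).comp (locMap S) =
          f.toMonoidWithZeroHom :=
        MonoidWithZeroHom.ext fun a => (Localization.monoidOf S).lift_eq hf a
      rw [← RingHom.comp_apply, ← Ambient.map_comp, e]
      exact f.map_nullSet y hy
    exact fun x hx => this hx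

theorem locLift_locMap (f : BandHom B C) (hf : ∀ s : S, IsUnit (f s)) (b : B) :
    locLift S f hf (locMap S b) = f b :=
  (Localization.monoidOf S).lift_eq hf b

variable {S}

theorem isUnit_locMap (s : S) : IsUnit (locMap S s) :=
  IsUnit.of_mul_eq_one (Localization.mk 1 s) ((locMap_mul_mk S 1 s).trans (map_one _))

theorem eq_mk_of_mul_eq {a : B} {s : S} {z : Localization S}
    (h : locMap S s * z = locMap S a) : z = Localization.mk a s :=
  (isUnit_locMap s).mul_left_cancel (h.trans (locMap_mul_mk S a s).symm)

theorem exists_mul_eq_of_locMap_eq {a b : B} (h : locMap S a = locMap S b) :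
    ∃ s : S, (s : B) * a = s * b := by
  change Localization.mk a 1 = Localization.mk b 1 at h
  rw [Localization.mk_eq_mk_iff, Localization.r_iff_exists] at h
  simpa using h

end LocLift

/-! ### Principal open subsets of the spectrum -/

section BasicOpen

open PrimeMIdeal

variable {B : Type u} [Band B] {S : Submonoid B}

/-- The extension of a prime `m`-ideal to `S⁻¹B`. -/
def extCarrier (S : Submonoid B) (p : PrimeMIdeal B) : Set (Localization S) :=
  {z | ∃ (s : S), ∃ b ∈ p.carrier, locMap S s * z = locMap S b}

/-- As for null ideals, any numerator of `z` decides membership, since `p` is prime and avoids `S`.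
-/
theorem mem_extCarrier_iff {p : PrimeMIdeal B} (hp : ∀ s : S, (s : B) ∉ p.carrier)
    {z : Localization S} {s : S} {b : B} (hb : locMap S s * z = locMap S b) :
    z ∈ extCarrier S p ↔ b ∈ p.carrier := by
  refine ⟨fun ⟨t, c, hc, htc⟩ => ?_, fun h => ⟨s, b, h, hb⟩⟩
  have e : locMap S (t * b) = locMap S (s * c) := by
    rw [map_mul, map_mul, ← hb, ← htc]; ac_rfl
  obtain ⟨w, hw⟩ := exists_mul_eq_of_locMap_eq e
  by_contra hb'
  refine p.mul_notMem (hp w) (p.mul_notMem (hp t) hb') ?_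
  rw [hw]
  exact p.mul_mem _ (p.mul_mem _ hc)

/-- The extension to `S⁻¹B` of a prime `m`-ideal that does not meet `S`. -/
def extPrime (p : PrimeMIdeal B) (hp : ∀ s : S, (s : B) ∉ p.carrier) :
    PrimeMIdeal (Localization S) where
  carrier := extCarrier S p
  zero_mem := ⟨1, 0, p.zero_mem, by simp⟩
  mul_mem := by
    rintro r z ⟨s, b, hb, h⟩
    obtain ⟨t, c, hc⟩ := exists_mul_eq_locMap r
    refine ⟨s * t, c * b, p.mul_mem _ hb, ?_⟩
    rw [map_mul, ← h, ← hc, Submonoid.coe_mul, map_mul]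
    ac_rfl
  one_notMem := fun h => p.one_notMem ((mem_extCarrier_iff hp (s := 1) (b := 1) (by simp)).1 h)
  mul_notMem := by
    intro z w hz hw h
    obtain ⟨s, b, hb⟩ := exists_mul_eq_locMap z
    obtain ⟨t, c, hc⟩ := exists_mul_eq_locMap w
    refine p.mul_notMem (fun h => hz ((mem_extCarrier_iff hp hb).2 h))
      (fun h => hw ((mem_extCarrier_iff hp hc).2 h))
      ((mem_extCarrier_iff hp (s := s * t) ?_).1 h)
    rw [map_mul, ← hb, ← hc, Submonoid.coe_mul, map_mul]
    ac_rfl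

theorem comap_extPrime (p : PrimeMIdeal B) (hp : ∀ s : S, (s : B) ∉ p.carrier) :
    comap (locBandHom S) (extPrime p hp) = p :=
  PrimeMIdeal.ext (Set.ext fun b => mem_extCarrier_iff (b := b) hp (s := 1)
    (by rw [Submonoid.coe_one, map_one, one_mul]; rfl))

theorem isUnit_notMem {p : PrimeMIdeal B} {b : B} (hb : IsUnit b) : b ∉ p.carrier := by
  obtain ⟨c, hc⟩ := hb.exists_left_inv
  exact fun h => p.one_notMem (hc ▸ p.mul_mem c h)

theorem mem_comap_locBandHom_iff (q : PrimeMIdeal (Localization S)) {z : Localization S} {s : S}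
    {b : B} (hb : locMap S s * z = locMap S b) :
    b ∈ (comap (locBandHom S) q).carrier ↔ z ∈ q.carrier := by
  change locMap S b ∈ q.carrier ↔ _
  rw [← hb]
  refine ⟨fun h => ?_, fun h => q.mul_mem _ h⟩
  by_contra hz
  exact q.mul_notMem (isUnit_notMem (isUnit_locMap s)) hz h

theorem comap_locBandHom_injective : Function.Injective (comap (locBandHom S)) := by
  intro q q' h
  refine PrimeMIdeal.ext (Set.ext fun z => ?_)
  obtain ⟨s, b, hb⟩ := exists_mul_eq_locMap z
  rw [← mem_comap_locBandHom_iff q hb, h, mem_comap_locBandHom_iff q' hb]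

theorem notMem_comap_locBandHom (q : PrimeMIdeal (Localization S)) (s : S) :
    (s : B) ∉ (comap (locBandHom S) q).carrier :=
  isUnit_notMem (p := q) (isUnit_locMap s)

/-- An element of `S⁻¹B` and its numerator differ by a unit, so they define the same principal open
subset of the spectrum of `S⁻¹B`. -/
theorem isInducing_comap_locBandHom : IsInducing (comap (locBandHom S)) := by
  refine ⟨le_antisymm (continuous_comap _).le_induced (le_generateFrom ?_)⟩
  rintro _ ⟨z, rfl⟩
  obtain ⟨s, b, hb⟩ := exists_mul_eq_locMap z
  exact ⟨basicOpen b, isOpen_basicOpen b,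
    Set.ext fun q => not_congr (mem_comap_locBandHom_iff q hb)⟩

theorem range_comap_locBandHom :
    Set.range (comap (locBandHom S)) = {p | ∀ s : S, (s : B) ∉ p.carrier} := by
  refine Set.ext fun p => ⟨?_, fun hp => ⟨extPrime p hp, comap_extPrime p hp⟩⟩
  rintro ⟨q, rfl⟩
  exact notMem_comap_locBandHom q

theorem range_comap_powers (h : B) :
    Set.range (comap (locBandHom (Submonoid.powers h))) = basicOpen h := by
  rw [range_comap_locBandHom]
  refine Set.ext fun p => ⟨fun H => H ⟨h, Submonoid.mem_powers h⟩, fun H => ?_⟩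
  rintro ⟨_, n, rfl⟩
  exact pow_mem (S := p.compl) H n

theorem isOpenEmbedding_comap_powers (h : B) :
    IsOpenEmbedding (comap (locBandHom (Submonoid.powers h))) :=
  ⟨⟨isInducing_comap_locBandHom, comap_locBandHom_injective⟩,
    (range_comap_powers h).symm ▸ isOpen_basicOpen h⟩

theorem isUnit_locBandHom_of_notMem (p : PrimeMIdeal B) (hp : ∀ s : S, (s : B) ∉ p.carrier)
    (s : S) : IsUnit (locBandHom p.compl s) :=
  isUnit_locMap (S := p.compl) ⟨s, hp s⟩

/-- The canonical morphism from `S⁻¹B` to `B_p`. -/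
def locToLocAt (p : PrimeMIdeal B) (hp : ∀ s : S, (s : B) ∉ p.carrier) :
    BandHom (Localization S) (LocAt p) :=
  locLift S (locBandHom p.compl) (isUnit_locBandHom_of_notMem p hp)

theorem locToLocAt_locMap (p : PrimeMIdeal B) (hp : ∀ s : S, (s : B) ∉ p.carrier) (b : B) :
    locToLocAt p hp (locMap S b) = locMap p.compl b :=
  locLift_locMap _ _ _ _

/-- The canonical morphism from the localization of `S⁻¹B` at the extension of `p` to `B_p`. -/
def locExtHom (p : PrimeMIdeal B) (hp : ∀ s : S, (s : B) ∉ p.carrier) :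
    BandHom (LocAt (extPrime p hp)) (LocAt p) :=
  locLift _ (locToLocAt p hp) fun z => by
    obtain ⟨s, b, hb⟩ := exists_mul_eq_locMap z.1
    have h1 := congrArg (locToLocAt p hp) hb
    rw [map_mul, locToLocAt_locMap, locToLocAt_locMap] at h1
    have h2 : IsUnit (locMap p.compl b) :=
      isUnit_locMap (S := p.compl) ⟨b, fun h => z.2 ((mem_extCarrier_iff hp hb).2 h)⟩
    rw [← h1] at h2
    exact isUnit_of_mul_isUnit_right h2

theorem locExtHom_locMap (p : PrimeMIdeal B) (hp : ∀ s : S, (s : B) ∉ p.carrier) (b : B) :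
    locExtHom p hp (locMap _ (locMap S b)) = locMap p.compl b :=
  (locLift_locMap _ _ _ _).trans (locToLocAt_locMap _ _ _)

/-- With `c = a / s` and `d = b / t`, this is the rule `(a / s) / (b / t) = (t * a) / (s * b)`. It
shows that `pushSections` preserves local fractions. -/
theorem locExtHom_mk {p : PrimeMIdeal B} (hp : ∀ s : S, (s : B) ∉ p.carrier)
    {c : Localization S} {d : (extPrime p hp).compl} {s t : S} {a b : B}
    (hc : locMap S s * c = locMap S a) (hd : locMap S t * d = locMap S b) :
    ∃ h : s * b ∈ p.compl, locExtHom p hp (Localization.mk c d) =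
      Localization.mk (t * a) ⟨s * b, h⟩ := by
  have hb : b ∉ p.carrier := fun h => d.2 ((mem_extCarrier_iff hp hd).2 h)
  refine ⟨p.mul_notMem (hp s) hb, eq_mk_of_mul_eq ?_⟩
  change locMap _ ((s : B) * b) * _ = _
  rw [← locExtHom_locMap p hp, ← locExtHom_locMap p hp, ← map_mul]
  congr 1
  rw [map_mul, ← hd, map_mul (locMap S) (t : B), ← hc]
  have := locMap_mul_mk _ c d
  rw [map_mul, map_mul, map_mul, map_mul, ← this]
  ac_rfl

theorem locExtHom_locHom_mk {p : PrimeMIdeal B} (hp : ∀ s : S, (s : B) ∉ p.carrier) {a k : B}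
    (hk : k ∈ (comap (locBandHom S) (extPrime p hp)).compl) (hk' : k ∈ p.compl) :
    locExtHom p hp (locHom (locBandHom S) (extPrime p hp) (Localization.mk a ⟨k, hk⟩)) =
      Localization.mk a ⟨k, hk'⟩ := by
  refine eq_mk_of_mul_eq ?_
  change locMap _ k * _ = _
  rw [locHom_mk, ← locExtHom_locMap p hp, ← locExtHom_locMap p hp, ← map_mul]
  congr 1
  exact locMap_mul_mk (extPrime p hp).compl (locMap S a) ⟨locMap S k, hk⟩

variable {h : B}

theorem powers_notMem {p : PrimeMIdeal B} (hp : p ∈ basicOpen h) (s : Submonoid.powers h) :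
    (s : B) ∉ p.carrier := by
  obtain ⟨_, n, rfl⟩ := s
  exact pow_mem (S := p.compl) hp n

/-- The inverse of the pull back of sections to a principal open subset. -/
def pushSections {O : Opens (specTop B)} (hO : ∀ p ∈ O, p ∈ basicOpen h)
    {W : Opens (specTop (Localization (Submonoid.powers h)))}
    (hW : ∀ p (hp : p ∈ O), extPrime p (powers_notMem (hO p hp)) ∈ W) :
    BandHom (Sections W) (Sections O) where
  toFun t := ⟨fun p => locExtHom p.1 (powers_notMem (hO p.1 p.2)) (t.1 ⟨_, hW p.1 p.2⟩),
    fun p => by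
      obtain ⟨V, hV, c, d, H⟩ := t.2 ⟨_, hW p.1 p.2⟩
      obtain ⟨s, a, hc⟩ := exists_mul_eq_locMap c
      obtain ⟨r, b, hd⟩ := exists_mul_eq_locMap d
      refine ⟨⟨comap (locBandHom (Submonoid.powers h)) '' V,
        (isOpenEmbedding_comap_powers h).isOpenMap _ V.2⟩, ⟨_, hV, comap_extPrime _ (powers_notMem (hO p.1 p.2))⟩,
        r * a, s * b, ?_⟩
      rintro q ⟨w, hw, e⟩
      obtain rfl : w = extPrime q.1 (powers_notMem (hO q.1 q.2)) :=
        comap_locBandHom_injective (e.trans (comap_extPrime _ _).symm)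
      obtain ⟨h1, e1⟩ := H ⟨_, hW q.1 q.2⟩ hw
      obtain ⟨h2, e2⟩ := locExtHom_mk (powers_notMem (hO q.1 q.2)) (d := ⟨d, h1⟩) hc hd
      exact ⟨h2, (congrArg _ e1).trans e2⟩⟩
  map_zero' := Sections.ext fun p => map_zero (locExtHom p.1 _)
  map_one' := Sections.ext fun p => map_one (locExtHom p.1 _)
  map_mul' _ _ := Sections.ext fun p => map_mul (locExtHom p.1 _) _ _
  map_nullSet x hx := by
    rw [Sections.mem_nullSet] at hx ⊢
    intro p
    have h := (locExtHom p.1 (powers_notMem (hO p.1 p.2))).map_nullSet _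
      (hx ⟨_, hW p.1 p.2⟩)
    rw [← RingHom.comp_apply, ← Ambient.map_comp] at h ⊢
    exact h

theorem pushSections_comp_pullSections {O : Opens (specTop B)} (hO : ∀ p ∈ O, p ∈ basicOpen h)
    (hW : ∀ p (hp : p ∈ O), extPrime p (powers_notMem (hO p hp)) ∈
      (Opens.map (specBase (locBandHom (Submonoid.powers h)))).obj O) :
    BandHom.comp (pushSections hO hW) (pullSections (locBandHom (Submonoid.powers h)) O) =
      BandHom.id (Sections O) := by
  refine BandHom.ext (B := Sections O) (C := Sections O) fun s => Sections.ext fun p => ?_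
  obtain ⟨V, hV, a, k, H⟩ := s.2 p
  have e := comap_extPrime p.1 (powers_notMem (hO p.1 p.2))
  obtain ⟨h1, e1⟩ := H p hV
  -- The contraction of the extension of `p` is equal to `p` but is not literally the same point.
  -- Using the local fraction `a / k` at both avoids a transport between their localizations.
  obtain ⟨h2, e2⟩ := H ⟨comap (locBandHom (Submonoid.powers h)) (extPrime p.1 _),
    hW p.1 p.2⟩ ((congrArg (· ∈ V) e).mpr hV)
  change locExtHom p.1 _ (locHom _ (extPrime p.1 (powers_notMem (hO p.1 p.2)))
    (s.1 ⟨comap _ _, _⟩)) = s.1 p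
  rw [e1, e2]
  exact locExtHom_locHom_mk _ h2 h1

theorem pullSections_comp_pushSections {O : Opens (specTop B)} (hO : ∀ p ∈ O, p ∈ basicOpen h)
    (hW : ∀ p (hp : p ∈ O), extPrime p (powers_notMem (hO p hp)) ∈
      (Opens.map (specBase (locBandHom (Submonoid.powers h)))).obj O) :
    BandHom.comp (pullSections (locBandHom (Submonoid.powers h)) O) (pushSections hO hW) =
      BandHom.id (Sections _) := by
  refine BandHom.ext (B := Sections _) (C := Sections _) fun t => Sections.ext fun q => ?_
  obtain ⟨V, hV, c, d, H⟩ := t.2 q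
  obtain ⟨s, a, hc⟩ := exists_mul_eq_locMap c
  obtain ⟨r, b, hd⟩ := exists_mul_eq_locMap d
  have hp := powers_notMem (hO _ q.2)
  have e : extPrime (comap (locBandHom (Submonoid.powers h)) q.1) hp = q.1 :=
    comap_locBandHom_injective (comap_extPrime _ _)
  obtain ⟨h1, e1⟩ := H q hV
  -- Again the same fraction `c / d` is used at `q` and at the extension of its contraction.
  obtain ⟨h2, e2⟩ := H ⟨extPrime (comap (locBandHom (Submonoid.powers h)) q.1) hp,
    hW _ q.2⟩ ((congrArg (· ∈ V) e).mpr hV)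
  obtain ⟨h3, e3⟩ := locExtHom_mk hp (d := ⟨d, h2⟩) hc hd
  refine Eq.trans (congrArg (fun z => locHom _ q.1 (locExtHom _ hp z)) e2) ?_
  refine (congrArg (fun z => locHom _ q.1 z) e3).trans ?_
  refine Eq.trans ?_ e1.symm
  refine (locHom_mk _ _ _ _).trans ?_
  rw [Localization.mk_eq_mk_iff, Localization.r_iff_exists]
  have key : d * locMap _ (r * a) = locMap _ (s * b) * c := by
    rw [map_mul, map_mul, ← hc, ← hd]
    ac_rfl
  exact ⟨1, congrArg (1 * ·) key⟩

end BasicOpen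

/-- The morphism from the spectrum of `B[h⁻¹]` to the spectrum of `B`. -/
theorem isOpenImmersion_specPshMap_powers {B : BandCat.{u}} (h : B) :
    PresheafedSpace.IsOpenImmersion
      (specPshMap (C := ⟨Localization (Submonoid.powers h)⟩) (locBandHom (Submonoid.powers h))) where
  base_open := isOpenEmbedding_comap_powers h
  c_iso (U : Opens (specTop (Localization (Submonoid.powers h)))) := by
    let O : Opens (specTop B) :=
      ⟨PrimeMIdeal.comap (locBandHom (Submonoid.powers h)) '' U.1,
        (isOpenEmbedding_comap_powers h).isOpenMap _ U.2⟩
    have hO : ∀ p ∈ O, p ∈ PrimeMIdeal.basicOpen h := by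
      rintro _ ⟨q, _, rfl⟩
      exact (range_comap_powers h).subset ⟨q, rfl⟩
    have hW : ∀ p (hp : p ∈ O), extPrime p (powers_notMem (hO p hp)) ∈
        (Opens.map (specBase (locBandHom (Submonoid.powers h)))).obj O := by
      intro p hp
      change PrimeMIdeal.comap _ _ ∈ O
      rw [comap_extPrime]
      exact hp
    exact ⟨pushSections hO hW, pushSections_comp_pullSections hO hW,
      pullSections_comp_pushSections hO hW⟩

/-! ### Global sections of the spectrum -/

section GlobalSections

open PrimeMIdeal

/-- A bijective band morphism that reflects the null set has an inverse. -/
theorem exists_inverse {B C : Type u} [Band B] [Band C] (f : BandHom B C)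
    (hf : Function.Bijective f) (hn : ∀ x, f.plus x ∈ nullSet C → x ∈ nullSet B) :
    ∃ g : BandHom C B, BandHom.comp g f = BandHom.id B ∧ BandHom.comp f g = BandHom.id C := by
  let e := Equiv.ofBijective f hf
  let g₀ : C →*₀ B :=
    { toFun := e.symm
      map_zero' := e.symm_apply_eq.2 (map_zero f).symm
      map_one' := e.symm_apply_eq.2 (map_one f).symm
      map_mul' := fun a b => e.symm_apply_eq.2 (by
        change _ = f _
        rw [map_mul]
        exact (congrArg₂ (· * ·) (e.apply_symm_apply a) (e.apply_symm_apply b)).symm) }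
  have h1 : f.toMonoidWithZeroHom.comp g₀ = MonoidWithZeroHom.id C :=
    MonoidWithZeroHom.ext e.apply_symm_apply
  let g : BandHom C B :=
    { toMonoidWithZeroHom := g₀
      map_nullSet := fun x hx => hn _ (by
        change Ambient.map f.toMonoidWithZeroHom (Ambient.map g₀ x) ∈ _
        rw [← RingHom.comp_apply, ← Ambient.map_comp, h1, Ambient.map_id]
        exact hx) }
  exact ⟨g, BandHom.ext e.symm_apply_apply, BandHom.ext e.apply_symm_apply⟩

variable {B : Type u} [Band B]

/-- Stability under generization is clear for the sets `U_h` and survives finite intersections and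
arbitrary unions. -/
theorem mem_of_carrier_subset {p m : PrimeMIdeal B} (h : p.carrier ⊆ m.carrier)
    (O : Opens (specTop B)) (hm : m ∈ O) : p ∈ O := by
  have hO : TopologicalSpace.GenerateOpen (Set.range basicOpen) (O : Set (PrimeMIdeal B)) := O.2
  change p ∈ (O : Set (PrimeMIdeal B))
  change m ∈ (O : Set (PrimeMIdeal B)) at hm
  generalize (O : Set (PrimeMIdeal B)) = O' at *
  induction hO with
  | basic s hs =>
    obtain ⟨b, rfl⟩ := hs
    exact fun hb => hm (h hb)
  | univ => trivial
  | inter s t _ _ hs ht => exact ⟨hs hm.1, ht hm.2⟩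
  | sUnion S _ ih =>
    obtain ⟨s, hs, hms⟩ := hm
    exact ⟨s, hs, ih s hs hms⟩

/-- The closed point of the spectrum of a nontrivial band. -/
def closedPoint (B : Type u) [Band B] [Nontrivial B] : PrimeMIdeal B where
  carrier := {b | ¬ IsUnit b}
  zero_mem := not_isUnit_zero
  mul_mem _ _ hb := fun h => hb (isUnit_of_mul_isUnit_right h)
  one_notMem := fun h => h isUnit_one
  mul_notMem ha hb := fun h => h ((not_not.1 ha).mul (not_not.1 hb))

theorem mem_of_closedPoint_mem [Nontrivial B] {O : Opens (specTop B)} (h : closedPoint B ∈ O)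
    (p : PrimeMIdeal B) : p ∈ O :=
  mem_of_carrier_subset (p := p) (m := closedPoint B) (fun _ hb hu => isUnit_notMem hu hb) O h

/-- The only open subset containing the closed point is the whole spectrum. A fraction that
represents a section there represents it everywhere, and its denominator, lying outside the set of
non-units, is a unit. -/
theorem toSections_top_bijective : Function.Bijective (toSections (⊤ : Opens (specTop B))) := by
  cases subsingleton_or_nontrivial B with
  -- The trivial band has an empty spectrum and hence no closed point; both sides then have a single
  -- element.
  | inl hB =>
    have hS : Subsingleton (Sections (⊤ : Opens (specTop B))) := ⟨fun s t =>
      Sections.ext fun p => (p.1.one_notMem (Subsingleton.elim (0 : B) 1 ▸ p.1.zero_mem)).elim⟩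
    exact ⟨fun _ _ _ => Subsingleton.elim _ _, fun s => ⟨0, Subsingleton.elim _ _⟩⟩
  | inr hB =>
    constructor
    · intro a b hab
      have h1 : locMap (closedPoint B).compl a = locMap (closedPoint B).compl b :=
        congrArg (fun s : Sections (⊤ : Opens (specTop B)) => s.1 ⟨closedPoint B, trivial⟩) hab
      obtain ⟨s, hs⟩ := exists_mul_eq_of_locMap_eq h1
      exact (not_not.1 s.2 : IsUnit (s : B)).mul_left_cancel hs
    · intro s
      obtain ⟨V, hV, a, k, H⟩ := s.2 ⟨closedPoint B, trivial⟩
      obtain ⟨hk, -⟩ := H ⟨closedPoint B, trivial⟩ hV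
      obtain ⟨u, rfl⟩ : IsUnit k := not_not.1 hk
      refine ⟨a * ↑u⁻¹, Sections.ext fun p => ?_⟩
      obtain ⟨h1, e1⟩ := H p (mem_of_closedPoint_mem hV p.1)
      rw [e1]
      refine eq_mk_of_mul_eq ?_
      change locMap _ (u : B) * locMap _ (a * ↑u⁻¹) = _
      rw [← map_mul, mul_comm, mul_assoc, Units.inv_mul, mul_one]

/-- Bijectivity is not enough for an isomorphism of bands; the inverse must also preserve null sets.
Nullity at the closed point suffices, as the denominators there are units of `B` and can be removed.
-/
theorem mem_nullSet_of_toSections_top {x : Ambient B}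
    (hx : (toSections (⊤ : Opens (specTop B))).plus x ∈ nullSet _) : x ∈ nullSet B := by
  cases subsingleton_or_nontrivial B with
  | inl hB =>
    have : x = 0 := by
      rw [← one_mul x, ← map_one (Ambient.of B), Subsingleton.elim (1 : B) 0, map_zero, zero_mul]
    exact this ▸ zero_mem _
  | inr hB =>
    have h1 := Sections.mem_nullSet.1 hx ⟨closedPoint B, trivial⟩
    have h2 : (locBandHom (closedPoint B).compl).plus x ∈ nullSet (LocAt (closedPoint B)) := by
      rw [← evalHom_comp_toSections (U := ⊤) ⟨closedPoint B, trivial⟩, BandHom.plus_comp]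
      exact h1
    obtain ⟨s, y, hy, e⟩ := exists_mul_eq_of_mem _ h2
    have e' : Ambient.map (locMap (closedPoint B).compl) (Ambient.of B s * x) =
        Ambient.map (locMap (closedPoint B).compl) y := by
      rw [map_mul, Ambient.map_of]; exact e
    obtain ⟨t, ht⟩ := exists_mul_eq_of_map_eq _ e'
    obtain ⟨v, hv⟩ := (not_not.1 (s * t).2 : IsUnit (↑(s * t) : B)).exists_left_inv
    have : x = Ambient.of B v * (Ambient.of B t * y) := by
      rw [← ht, ← mul_assoc, ← mul_assoc, mul_assoc (Ambient.of B v), ← map_mul, ← map_mul]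
      rw [Submonoid.coe_mul, mul_comm (s : B)] at hv
      rw [hv, map_one, one_mul]
    rw [this]
    exact Ideal.mul_mem_left _ _ (Ideal.mul_mem_left _ _ hy)

theorem exists_inverse_toSections_top (B : Type u) [Band B] :
    ∃ g : BandHom (Sections (⊤ : Opens (specTop B))) B,
      BandHom.comp g (toSections ⊤) = BandHom.id B ∧
      BandHom.comp (toSections ⊤) g = BandHom.id (Sections ⊤) :=
  exists_inverse _ toSections_top_bijective fun _ => mem_nullSet_of_toSections_top

end GlobalSections

end

end BandTheory

/-! ### Fullness of `Spec`, and affine opens as a basis. -/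

namespace BandTheory

noncomputable section

open AlgebraicGeometry

/-! ### Morphisms between spectra -/

section Full

variable {B C : BandCat.{u}}

theorem isUnitAt_toSections_iff {U : Opens (specTop B)} {p : PrimeMIdeal B} (hp : p ∈ U) (b : B) :
    IsUnitAt (specObj B).toPresheafedSpace p (U := U) (toSections U b) ↔ b ∉ p.carrier :=
  (isUnitAt_spec_iff hp _).trans ⟨notMem_of_isUnit_mk, fun h => isUnit_mk h _⟩

/-- A morphism of spectra that is given by `f : B → C` on elements of `B`. -/
def Induces (f : BandHom B C)
    (g : (specObj C).toPresheafedSpace ⟶ (specObj B).toPresheafedSpace) : Prop :=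
  ∀ (O : Opens (specTop B)) (W : Opens (specTop C)) (h : W ≤ (Opens.map g.base).obj O) (b : B),
    pull g h (toSections O b) = toSections W (f b)

/-- If `s = a / k` near the image of `p`, pulling back `k * s = a` gives an equation that determines
the pull back of `s` at `p`, because `f k` is a unit in the localization there. -/
theorem Induces.exists_eval_eq {f : BandHom B C}
    {g : (specObj C).toPresheafedSpace ⟶ (specObj B).toPresheafedSpace} (H : Induces f g)
    {O : Opens (specTop B)} {W : Opens (specTop C)} (h : W ≤ (Opens.map g.base).obj O)
    {p : PrimeMIdeal C} (hp : p ∈ W) (s : Sections O) {V : Opens (specTop B)}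
    (hV : g.base p ∈ V) {a k : B}
    (hs : ∀ q : O, q.1 ∈ V → ∃ hq : k ∈ q.1.compl, s.1 q = Localization.mk a ⟨k, hq⟩) :
    locMap p.compl (f k) * (show Sections W from pull g h s).1 ⟨p, hp⟩ = locMap p.compl (f a) := by
  have hOV : O ⊓ V ≤ O := inf_le_left
  have e0 : toSections (O ⊓ V) k * Sections.res hOV s = toSections (O ⊓ V) a := by
    refine Sections.ext fun q => ?_
    obtain ⟨h2, e2⟩ := hs ⟨q.1, q.2.1⟩ q.2.2
    change locMap _ k * s.1 ⟨q.1, _⟩ = locMap _ a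
    rw [e2]
    exact locMap_mul_mk q.1.compl a ⟨k, h2⟩
  let W' : Opens (specTop C) := W ⊓ (Opens.map g.base).obj (O ⊓ V)
  have hW' : W' ≤ (Opens.map g.base).obj (O ⊓ V) := inf_le_right
  have hW'W : W' ≤ W := inf_le_left
  have e1 := congrArg (pull g hW') e0
  have e2 : pull g hW' (Sections.res hOV s) = Sections.res hW'W (pull g h s) :=
    (DFunLike.congr_fun (pull_comp_resHom g hOV hW') s).trans
      (DFunLike.congr_fun (resHom_comp_pull g h hW'W) s).symm
  have e3 : toSections W' (f k) * Sections.res hW'W (pull g h s) = toSections W' (f a) := by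
    rw [← H (O ⊓ V) W' hW' k, ← H (O ⊓ V) W' hW' a, ← e2]
    exact (map_mul (pull g hW') _ _).symm.trans e1
  exact congrArg (fun t : Sections W' => t.1 ⟨p, hp, h hp, hV⟩) e3

theorem Induces.eq_of_base_eq {f : BandHom B C}
    {g g' : (specObj C).toPresheafedSpace ⟶ (specObj B).toPresheafedSpace} (H : Induces f g)
    (H' : Induces f g') (e : ∀ p : PrimeMIdeal C, g.base p = PrimeMIdeal.comap f p)
    (e' : ∀ p : PrimeMIdeal C, g'.base p = PrimeMIdeal.comap f p) : g = g' := by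
  refine hom_ext_of_pull (fun p => (e p).trans (e' p).symm)
    fun (O : Opens (specTop B)) (W : Opens (specTop C)) h h' => ?_
  refine BandHom.ext (B := Sections O) (C := Sections W) fun s => Sections.ext fun p => ?_
  have hp : PrimeMIdeal.comap f p.1 ∈ O := e p.1 ▸ h p.2
  obtain ⟨V, hV, a, k, hs⟩ := s.2 ⟨PrimeMIdeal.comap f p.1, hp⟩
  have hk : k ∈ (PrimeMIdeal.comap f p.1).compl := (hs ⟨PrimeMIdeal.comap f p.1, hp⟩ hV).1
  have e1 := H.exists_eval_eq h p.2 s ((congrArg (· ∈ V) (e p.1)).mpr hV) hs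
  have e2 := H'.exists_eval_eq h' p.2 s ((congrArg (· ∈ V) (e' p.1)).mpr hV) hs
  exact (isUnit_locMap (S := p.1.compl) ⟨f k, hk⟩).mul_left_cancel (e1.trans e2.symm)

theorem induces_specPshMap (f : BandHom B C) : Induces f (specPshMap f) := fun O _ h b =>
  congrArg (Sections.res h) (DFunLike.congr_fun (pullSections_comp_toSections f O) b)

/-- The band morphism is read off from global sections, which are `B` and `C`. Locality then forces
the map on points: `b` lies outside the image of `p` iff its pull back is a unit at `p`, iff `f b ∉
p`. -/
theorem exists_specPshMap_eq (g : specObj C ⟶ specObj B) :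
    ∃ f : BandHom B C, specPshMap f = g.hom := by
  obtain ⟨γ, -, hγ⟩ := exists_inverse_toSections_top C
  let P : BandHom (Sections (⊤ : Opens (specTop B))) (Sections (⊤ : Opens (specTop C))) :=
    pull g.hom (O := ⊤) (W := ⊤) le_top
  let f : BandHom B C := BandHom.comp γ (BandHom.comp P (toSections ⊤))
  have hf : ∀ b, toSections (⊤ : Opens (specTop C)) (f b) = P (toSections ⊤ b) := fun b =>
    DFunLike.congr_fun hγ _
  have H : Induces f g.hom := fun O W h b => by
    have e1 : pull g.hom h (toSections O b) = pull g.hom (O := ⊤) (W := W) le_top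
        (toSections (⊤ : Opens (specTop B)) b) :=
      DFunLike.congr_fun (pull_comp_resHom g.hom (le_top : O ≤ ⊤) h) (toSections ⊤ b)
    have e2 : Sections.res (le_top : W ≤ ⊤) (P (toSections ⊤ b)) = pull g.hom (O := ⊤) (W := W)
        le_top (toSections (⊤ : Opens (specTop B)) b) :=
      DFunLike.congr_fun (resHom_comp_pull g.hom (O := ⊤) (W := ⊤) le_top (le_top : W ≤ ⊤))
        (toSections ⊤ b)
    rw [e1, ← e2, ← hf]
    rfl
  refine ⟨f, (induces_specPshMap f).eq_of_base_eq H (fun _ => rfl) fun p => ?_⟩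
  refine PrimeMIdeal.ext (Set.ext fun b => not_iff_not.1 ?_)
  refine (isUnitAt_toSections_iff (U := ⊤) (p := g.hom.base p) trivial b).symm.trans ?_
  refine (isUnitAt_pull g (O := ⊤) (W := ⊤) (x := p) le_top trivial).symm.trans ?_
  refine (iff_of_eq (congrArg (fun s => IsUnitAt (specObj C).toPresheafedSpace p (U := ⊤) s)
    (hf b).symm)).trans ?_
  exact isUnitAt_toSections_iff (U := ⊤) trivial (f b)

end Full

/-! ### Open immersions of band spaces -/

namespace BandSpace

variable {X Y Z : BandSpace.{u}}

/-- The inclusion of an open subspace. -/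
def ι (X : BandSpace.{u}) (U : Opens X.carrier) : X.restrict U ⟶ X where
  hom := X.toPresheafedSpace.ofRestrict U.isOpenEmbedding
  isLocal x := isLocalHom_stalkMap_of_isOpenImmersion
    (X.toPresheafedSpace.ofRestrict U.isOpenEmbedding) x

instance (U : Opens X.carrier) : PresheafedSpace.IsOpenImmersion (X.ι U).hom :=
  inferInstanceAs
    (PresheafedSpace.IsOpenImmersion (X.toPresheafedSpace.ofRestrict U.isOpenEmbedding))

theorem range_ι (U : Opens X.carrier) : Set.range (X.ι U).hom.base = U :=
  Subtype.range_coe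

instance isOpenImmersion_comp (f : X ⟶ Y) (g : Y ⟶ Z) [PresheafedSpace.IsOpenImmersion f.hom]
    [PresheafedSpace.IsOpenImmersion g.hom] : PresheafedSpace.IsOpenImmersion (f ≫ g).hom :=
  inferInstanceAs (PresheafedSpace.IsOpenImmersion (f.hom ≫ g.hom))

/-- The isomorphism of presheafed spaces underlying an isomorphism of band spaces. -/
def pshIso (e : X ≅ Y) : X.toPresheafedSpace ≅ Y.toPresheafedSpace where
  hom := e.hom.hom
  inv := e.inv.hom
  hom_inv_id := congrArg Hom.hom e.hom_inv_id
  inv_hom_id := congrArg Hom.hom e.inv_hom_id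

theorem isOpenImmersion_of_iso (e : X ≅ Y) : PresheafedSpace.IsOpenImmersion e.hom.hom :=
  PresheafedSpace.IsOpenImmersion.ofIso (pshIso e)

theorem hom_cancel (i : Y ⟶ X) [PresheafedSpace.IsOpenImmersion i.hom] {f g : Z ⟶ Y}
    (h : f ≫ i = g ≫ i) : f = g :=
  Hom.ext ((cancel_mono i.hom).1 (congrArg Hom.hom h))

/-- The factorization of a morphism through an open immersion. -/
def lift (i : Y ⟶ X) [PresheafedSpace.IsOpenImmersion i.hom] (f : Z ⟶ X)
    (h : Set.range f.hom.base ⊆ Set.range i.hom.base) : Z ⟶ Y where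
  hom := PresheafedSpace.IsOpenImmersion.lift i.hom f.hom h
  isLocal := fun z => by
    have fac := PresheafedSpace.IsOpenImmersion.lift_fac i.hom f.hom h
    have hbase : ∀ w, i.hom.base
        ((PresheafedSpace.IsOpenImmersion.lift i.hom f.hom h).base w) = f.hom.base w :=
      fun w => ConcreteCategory.congr_hom (congrArg PresheafedSpace.Hom.base fac) w
    generalize PresheafedSpace.IsOpenImmersion.lift i.hom f.hom h = l at fac hbase
    refine isLocalHom_stalkMap_of l z fun O hO a ha => ?_
    let O' : Opens X.carrier := (PresheafedSpace.IsOpenImmersion.opensFunctor i.hom).obj O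
    have hp : ∀ y ∈ O', ∃ x ∈ O, i.hom.base x = y := fun y hy => hy
    have hiO : O ≤ (Opens.map i.hom.base).obj O' := fun y hy => ⟨y, hy, rfl⟩
    let W := (Opens.map l.base).obj O
    have hW : W ≤ (Opens.map f.hom.base).obj O' := fun w hw => ⟨l.base w, hw, hbase w⟩
    -- The section `a` is the pull back of its push forward along `i`. Locality of `f` makes the
    -- latter a unit at `f z = i (l z)`, and pulling it back along `i` makes `a` a unit at `l z`.
    have e1 : pull i.hom hiO (push i.hom hp a) = a := by
      have := DFunLike.congr_fun (pull_comp_push i.hom hp hiO) a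
      rwa [resHom_refl] at this
    have e2 : pull f.hom hW (push i.hom hp a) = pull l (le_refl W) a := by
      refine Eq.trans ?_ (congrArg (pull l (le_refl W)) e1)
      refine Eq.trans ?_ (DFunLike.congr_fun (pull_comp l i.hom (le_refl W) hiO) _).symm
      exact DFunLike.congr_fun (pull_congr fac.symm _ _) _
    rw [← e2, isUnitAt_pull f hW hO, ← hbase] at ha
    have := ha.pull i.hom hiO (x := l.base z) hO
    rwa [e1] at this

@[simp]
theorem lift_fac (i : Y ⟶ X) [PresheafedSpace.IsOpenImmersion i.hom] (f : Z ⟶ X)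
    (h : Set.range f.hom.base ⊆ Set.range i.hom.base) : lift i f h ≫ i = f :=
  Hom.ext (PresheafedSpace.IsOpenImmersion.lift_fac i.hom f.hom h)

/-- Two open immersions with the same image have isomorphic sources. -/
def isoOfRangeEq (i : Y ⟶ X) (j : Z ⟶ X) [PresheafedSpace.IsOpenImmersion i.hom]
    [PresheafedSpace.IsOpenImmersion j.hom]
    (h : Set.range i.hom.base = Set.range j.hom.base) : Y ≅ Z :=
  isoMk (PresheafedSpace.IsOpenImmersion.isoOfRangeEq i.hom j.hom h)

end BandSpace

open BandSpace

theorem isAffine_spec (B : BandCat.{u}) : IsAffine (specObj B) := ⟨B, ⟨Iso.refl _⟩⟩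

theorem IsAffine.of_iso {X Y : BandSpace.{u}} (e : X ≅ Y) (h : IsAffine Y) : IsAffine X := by
  obtain ⟨B, ⟨e'⟩⟩ := h
  exact ⟨B, ⟨e ≪≫ e'⟩⟩

theorem IsAffine.restrict {X Y : BandSpace.{u}} (h : IsAffine Y) (i : Y ⟶ X)
    [PresheafedSpace.IsOpenImmersion i.hom] {U : Opens X.carrier}
    (hU : Set.range i.hom.base = U) : IsAffine (X.restrict U) :=
  h.of_iso (isoOfRangeEq (X.ι U) i ((range_ι U).trans hU.symm))

theorem IsAffine.isBandScheme {X : BandSpace.{u}} (h : IsAffine X) : IsBandScheme X := fun _ =>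
  ⟨⊤, trivial, h.of_iso (BandSpace.isoMk (PresheafedSpace.restrictTopIso _))⟩

theorem IsAffine.exists_openImmersion {X : BandSpace.{u}} {U : Opens X.carrier}
    (h : IsAffine (X.restrict U)) : ∃ (B : BandCat.{u}) (i : specObj B ⟶ X),
      PresheafedSpace.IsOpenImmersion i.hom ∧ Set.range i.hom.base = U := by
  obtain ⟨B, ⟨(e : X.restrict U ≅ specObj B)⟩⟩ := h
  have h1 : PresheafedSpace.IsOpenImmersion e.inv.hom := isOpenImmersion_of_iso e.symm
  refine ⟨B, e.inv ≫ X.ι U, inferInstance, ?_⟩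
  have h2 : Function.Surjective e.inv.hom.base :=
    (TopCat.homeoOfIso ((PresheafedSpace.forget _).mapIso (pshIso e).symm)).surjective
  have h3 : ⇑(e.inv ≫ X.ι U).hom.base = (X.ι U).hom.base ∘ e.inv.hom.base := rfl
  rw [h3, h2.range_comp, range_ι]

/-- The sets `U_h` generate the topology by definition; they form a basis because `U_h ∩ U_k =
U_{hk}`. -/
theorem exists_basicOpen_subset {B : Type u} [Band B] (p : PrimeMIdeal B) (O : Opens (specTop B))
    (hp : p ∈ O) : ∃ h : B, p ∈ PrimeMIdeal.basicOpen h ∧ PrimeMIdeal.basicOpen h ⊆ O := by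
  have hO : TopologicalSpace.GenerateOpen (Set.range PrimeMIdeal.basicOpen)
    (O : Set (PrimeMIdeal B)) := O.2
  change p ∈ (O : Set (PrimeMIdeal B)) at hp
  generalize (O : Set (PrimeMIdeal B)) = O' at *
  induction hO with
  | basic s hs =>
    obtain ⟨b, rfl⟩ := hs
    exact ⟨b, hp, le_rfl⟩
  | univ => exact ⟨1, p.one_notMem, fun _ _ => trivial⟩
  | inter s t _ _ hs ht =>
    obtain ⟨h, h1, h2⟩ := hs hp.1
    obtain ⟨k, k1, k2⟩ := ht hp.2
    refine ⟨h * k, p.mul_notMem h1 k1, fun q hq => ⟨h2 fun hh => hq ?_, k2 fun hk => hq ?_⟩⟩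
    · rw [mul_comm]; exact q.mul_mem _ hh
    · exact q.mul_mem _ hk
  | sUnion S _ ih =>
    obtain ⟨s, hs, hms⟩ := hp
    obtain ⟨h, h1, h2⟩ := ih s hs hms
    exact ⟨h, h1, h2.trans (Set.subset_sUnion_of_mem hs)⟩

/-- The affine open subsets of a band scheme form a basis of its topology. -/
theorem IsBandScheme.exists_affine {X : BandSpace.{u}} (hX : IsBandScheme X) (x : X.carrier)
    (O : Opens X.carrier) (hx : x ∈ O) :
    ∃ U : Opens X.carrier, x ∈ U ∧ U ≤ O ∧ IsAffine (X.restrict U) := by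
  obtain ⟨U, hxU, hU⟩ := hX x
  obtain ⟨B, i, hi, hr⟩ := hU.exists_openImmersion
  obtain ⟨p, rfl⟩ : x ∈ Set.range i.hom.base := hr.symm ▸ hxU
  obtain ⟨h, hp, hh⟩ := exists_basicOpen_subset (B := B) p ((Opens.map i.hom.base).obj O) hx
  have := isOpenImmersion_specPshMap_powers h
  -- A principal open subset of an affine chart is again a spectrum, namely that of `B[h⁻¹]`.
  let j : specObj ⟨Localization (Submonoid.powers h)⟩ ⟶ specObj B :=
    ⟨specPshMap (locBandHom (Submonoid.powers h)), isLocal_specPshMap _⟩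
  have hj : PresheafedSpace.IsOpenImmersion j.hom := this
  have hrange : Set.range (j ≫ i).hom.base = i.hom.base '' PrimeMIdeal.basicOpen h := by
    have h3 : ⇑(j ≫ i).hom.base = i.hom.base ∘ j.hom.base := rfl
    rw [h3, Set.range_comp]
    exact congrArg _ (range_comap_powers h)
  refine ⟨⟨Set.range (j ≫ i).hom.base,
    (PresheafedSpace.IsOpenImmersion.base_open (f := (j ≫ i).hom)).isOpen_range⟩, ?_, ?_,
    (isAffine_spec _).restrict (j ≫ i) rfl⟩
  · exact hrange.superset ⟨p, hp, rfl⟩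
  · intro y hy
    obtain ⟨q, hq, rfl⟩ := hrange.subset hy
    exact hh hq

end

end BandTheory

/-! ### Open and closed immersions. -/

namespace BandTheory

noncomputable section

open AlgebraicGeometry BandSpace

/-! ### Open immersions and null spaces -/

namespace NullPoint

variable {X Y : BandSpace.{u}} (i : Y ⟶ X) [PresheafedSpace.IsOpenImmersion i.hom]

/-- The image of an open subset under an open immersion. -/
def image (V : Opens Y.carrier) : Opens X.carrier :=
  (PresheafedSpace.IsOpenImmersion.opensFunctor i.hom).obj V

theorem le_map_image (V : Opens Y.carrier) : V ≤ (Opens.map i.hom.base).obj (image i V) :=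
  fun y hy => ⟨y, hy, rfl⟩

theorem exists_of_mem_image (V : Opens Y.carrier) :
    ∀ x ∈ image i V, ∃ y ∈ V, i.hom.base y = x := fun _ h => h

/-- The ideals of a point are recovered from those of its image. Injectivity and the comparison of
topologies follow, and the formula dictates the preimage constructed in `range_map`. -/
theorem ideal_eq_comap_push (ξ : NullPoint Y.toPresheafedSpace) (V : Opens Y.carrier)
    (hV : ξ.pt ∈ V) : ξ.ideal V hV = PrimeNullIdeal.comap (push i.hom (exists_of_mem_image i V))
      ((map i ξ).ideal (image i V) (le_map_image i V hV)) := by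
  rw [map_ideal i ξ (le_map_image i V) hV, ← PrimeNullIdeal.comap_comp, pull_comp_push]
  exact (ξ.comap_ideal le_rfl hV).symm

theorem map_injective : Function.Injective (map i) := by
  intro ξ ζ h
  have hpt : ξ.pt = ζ.pt :=
    (PresheafedSpace.IsOpenImmersion.base_open (f := i.hom)).injective (congrArg pt h)
  refine ext hpt fun V h1 h2 => ?_
  rw [ideal_eq_comap_push i ξ V h1, ideal_eq_comap_push i ζ V h2]
  congr 1
  generalize_proofs a b
  revert a b
  rw [h]
  intros; rfl

theorem isInducing_map : IsInducing (map i) := by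
  refine ⟨le_antisymm (continuous_map i).le_induced (le_generateFrom ?_)⟩
  rintro _ ⟨⟨V, h⟩, rfl⟩
  refine ⟨basicOpen (U := image i V) ((push i.hom (exists_of_mem_image i V)).plus h), isOpen_basicOpen _,
    Set.ext fun ξ => ?_⟩
  constructor
  · rintro ⟨⟨y, hy, e⟩, hh⟩
    obtain rfl : y = ξ.pt :=
      (PresheafedSpace.IsOpenImmersion.base_open (f := i.hom)).injective e
    refine ⟨hy, fun h' => hh ?_⟩
    rw [ideal_eq_comap_push i ξ V hy] at h'
    exact h'
  · rintro ⟨hy, hh⟩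
    refine ⟨le_map_image i V hy, fun h' => hh ?_⟩
    rw [ideal_eq_comap_push i ξ V hy]
    exact h'

theorem range_map : Set.range (map i) = {ξ | ξ.pt ∈ Set.range i.hom.base} := by
  refine Set.ext fun ζ => ⟨?_, ?_⟩
  · rintro ⟨ξ, rfl⟩
    exact ⟨ξ.pt, rfl⟩
  · rintro ⟨y, hy⟩
    have hmem : ∀ V : Opens Y.carrier, y ∈ V → ζ.pt ∈ image i V := fun V hV => ⟨y, hV, hy⟩
    -- The ideals of a preimage are forced by `ideal_eq_comap_push`.
    let ξ : NullPoint Y.toPresheafedSpace :=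
      { pt := y
        ideal := fun V hV => PrimeNullIdeal.comap (push i.hom (exists_of_mem_image i V))
          (ζ.ideal (image i V) (hmem V hV))
        comap_ideal := fun {U V} h hV => by
          have hUV : image i V ≤ image i U := Set.image_mono h
          rw [← ζ.comap_ideal hUV (hmem V hV), ← PrimeNullIdeal.comap_comp,
            ← PrimeNullIdeal.comap_comp, push_comp_resHom, resHom_comp_push]
        of_mem_iff := fun {V} hV a => by
          rw [PrimeNullIdeal.mem_comap, BandHom.plus_of]
          refine (ζ.of_mem_iff _ _).trans (not_congr ?_)
          rw [← hy, ← isUnitAt_pull i (le_map_image i V) hV]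
          refine iff_of_eq (congrArg (IsUnitAt Y.toPresheafedSpace y) ?_)
          have := DFunLike.congr_fun (pull_comp_push i.hom (W := V) (O := image i V)
            (exists_of_mem_image i V) (le_map_image i V)) a
          rwa [resHom_refl] at this }
    refine ⟨ξ, ext hy fun U h1 h2 => ?_⟩
    have h3 : ζ.pt ∈ image i ((Opens.map i.hom.base).obj U) := ⟨y, h1, hy⟩
    have h4 : image i ((Opens.map i.hom.base).obj U) ≤ U := Set.image_preimage_subset _ _
    rw [← ζ.comap_ideal h4 h3]
    change PrimeNullIdeal.comap _ (PrimeNullIdeal.comap _ (ζ.ideal (image i _) h3)) = _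
    rw [← PrimeNullIdeal.comap_comp, push_comp_pull]

theorem isOpenEmbedding_map : IsOpenEmbedding (map i) := by
  refine ⟨⟨isInducing_map i, map_injective i⟩, ?_⟩
  rw [range_map]
  exact ((PresheafedSpace.IsOpenImmersion.base_open (f := i.hom)).isOpen_range).preimage
    continuous_pt

end NullPoint

/-! ### Null spaces of affine open subsets -/

/-- Inverse band isomorphisms induce a homeomorphism on prime null ideals. -/
def PrimeNullIdeal.homeoOfInverse {B C : Type u} [Band B] [Band C] (f : BandHom B C)
    (g : BandHom C B) (h : BandHom.comp g f = BandHom.id B) (h' : BandHom.comp f g = BandHom.id C) :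
    PrimeNullIdeal C ≃ₜ PrimeNullIdeal B where
  toFun := comap f
  invFun := comap g
  left_inv p := by rw [← comap_comp, h', comap_id]
  right_inv p := by rw [← comap_comp, h, comap_id]
  continuous_toFun := continuous_comap f
  continuous_invFun := continuous_comap g

/-- The prime null ideal of `𝒪(U)` at a point over `U`. -/
def NullPoint.evalAt {X : PresheafedSpace BandCat.{u}} (U : Opens X.carrier)
    (ξ : {ξ : NullPoint X | ξ.pt ∈ U}) : PrimeNullIdeal (Γ X U) :=
  ξ.1.ideal U ξ.2

/-- Combines the open embedding of the chart `Spec B ≅ U` with the description of the null space of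
`Spec B` and the isomorphism of `B` with `𝒪(U)`. It reduces closed immersions to surjections of
bands. -/
theorem isHomeomorph_evalAt {X : BandSpace.{u}} {U : Opens X.carrier}
    (hU : IsAffine (X.restrict U)) :
    IsHomeomorph (NullPoint.evalAt (X := X.toPresheafedSpace) U) := by
  obtain ⟨B, i, hi, hr⟩ := hU.exists_openImmersion
  obtain ⟨γ, hγ, hγ'⟩ := exists_inverse_toSections_top B
  have hle : (⊤ : Opens (specObj B).carrier) ≤ (Opens.map i.hom.base).obj U := fun x _ =>
    hr.subset ⟨x, rfl⟩
  have hsurj : ∀ y ∈ U, ∃ x ∈ (⊤ : Opens (specObj B).carrier), i.hom.base x = y := fun y hy =>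
    (hr.superset hy).imp fun x hx => ⟨trivial, hx⟩
  have e1 : BandHom.comp (push i.hom hsurj) (pull i.hom hle) =
      BandHom.id (Γ X.toPresheafedSpace U) := by
    rw [push_comp_pull, resHom_refl]
  have e2 : BandHom.comp (pull i.hom hle) (push i.hom hsurj) =
      BandHom.id (Γ (specObj B).toPresheafedSpace ⊤) := by
    rw [pull_comp_push, resHom_refl]
  let f : BandHom (Γ X.toPresheafedSpace U) B := BandHom.comp γ (pull i.hom hle)
  let g : BandHom B (Γ X.toPresheafedSpace U) := BandHom.comp (push i.hom hsurj) (toSections ⊤)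
  have hgf : BandHom.comp g f = BandHom.id _ := by
    refine BandHom.ext fun a => ?_
    refine (congrArg (push i.hom hsurj) (DFunLike.congr_fun hγ' (pull i.hom hle a))).trans ?_
    exact DFunLike.congr_fun e1 a
  have hfg : BandHom.comp f g = BandHom.id _ := by
    refine BandHom.ext fun a => ?_
    refine (congrArg γ (DFunLike.congr_fun e2 (toSections ⊤ a))).trans ?_
    exact DFunLike.congr_fun hγ a
  have hrange : Set.range (NullPoint.map i) = {ξ : NullPoint X.toPresheafedSpace | ξ.pt ∈ U} := by
    rw [NullPoint.range_map, hr]; rfl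
  let φ : NullPoint (specObj B).toPresheafedSpace ≃ₜ
      {ξ : NullPoint X.toPresheafedSpace | ξ.pt ∈ U} :=
    (NullPoint.isOpenEmbedding_map i).isEmbedding.toHomeomorph.trans
      (Homeomorph.setCongr hrange)
  let ψ := (specNullHomeo B).trans (PrimeNullIdeal.homeoOfInverse f g hgf hfg)
  have key : NullPoint.evalAt (X := X.toPresheafedSpace) U = ψ ∘ φ.symm := by
    refine funext fun ξ => ?_
    obtain ⟨ζ, rfl⟩ := φ.surjective ξ
    rw [Function.comp_apply, φ.symm_apply_apply]
    refine (NullPoint.map_ideal i ζ hle trivial).trans ?_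
    change _ = PrimeNullIdeal.comap f (PrimeNullIdeal.comap (toSections ⊤) (ζ.ideal ⊤ trivial))
    refine Eq.trans ?_ (PrimeNullIdeal.comap_comp (toSections ⊤) f (ζ.ideal ⊤ trivial))
    refine congrArg (fun g => PrimeNullIdeal.comap g (ζ.ideal ⊤ trivial)) ?_
    exact BandHom.ext fun a => (DFunLike.congr_fun hγ' (pull i.hom hle a)).symm
  rw [key]
  exact ψ.isHomeomorph.comp φ.symm.isHomeomorph

/-! ### Surjective band morphisms -/

section Surjective

variable {B C : Type u} [Band B] [Band C]

theorem plus_surjective {f : BandHom B C} (hf : Function.Surjective f) :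
    Function.Surjective f.plus := by
  intro y
  induction y using Ambient.induction with
  | h0 => exact ⟨0, map_zero _⟩
  | hadd c y ih =>
    obtain ⟨x, rfl⟩ := ih
    obtain ⟨b, rfl⟩ := hf c
    exact ⟨Ambient.of B b + x, by rw [map_add, BandHom.plus_of]⟩

/-- The congruence on `B⁺` given by an ideal. -/
def idealCon (I : Ideal (Ambient B)) : RingCon (Ambient B) where
  r x y := ∀ w z, w * x + z ∈ I ↔ w * y + z ∈ I
  iseqv := ⟨fun _ _ _ => Iff.rfl, fun h w z => (h w z).symm, fun h h' w z =>
    (h w z).trans (h' w z)⟩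
  add' {a b c d} h h' w z := by
    rw [mul_add, mul_add, add_assoc, h, add_left_comm, h', add_left_comm, add_assoc]
  mul' {a b c d} h h' w z := by
    have h1 := h' (w * a) z
    have h2 := h (w * d) z
    rw [mul_assoc] at h1
    rw [h1, mul_right_comm w a d, h2, mul_right_comm, mul_assoc]

/-- The substitution rule exchanges a single summand `a` for `b`. It also exchanges `c * a` for `c *
b`, because `c * a - c * b` lies in the ideal; as `w` is a finite sum of such `c`, induction
replaces all of `w * a`. -/
theorem idealCon_of {p : PrimeNullIdeal B} {a b : B}
    (h : Ambient.of B a + Ambient.of B (negB b) ∈ p.ideal)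
    (h' : Ambient.of B b + Ambient.of B (negB a) ∈ p.ideal) :
    idealCon p.ideal (Ambient.of B a) (Ambient.of B b) := by
  intro w
  induction w using Ambient.induction with
  | h0 => intro z; rw [zero_mul, zero_mul]
  | hadd c w ih =>
    intro z
    have key : ∀ {a b : B}, Ambient.of B a + Ambient.of B (negB b) ∈ p.ideal → ∀ x,
        Ambient.of B (c * b) + x ∈ p.ideal → Ambient.of B (c * a) + x ∈ p.ideal := by
      intro a b h x hx
      refine p.isNullIdeal.subst _ (c * b) x ?_ hx
      rw [← mul_neg_eq, map_mul, map_mul, ← mul_add]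
      exact Ideal.mul_mem_left _ _ h
    rw [add_mul, add_mul, add_assoc, add_assoc, ← map_mul, ← map_mul]
    refine ⟨fun H => key h' _ ?_, fun H => key h _ ?_⟩
    · rw [add_left_comm, ← ih, add_left_comm]; exact H
    · rw [add_left_comm, ih, add_left_comm]; exact H

/-- In semirings a quotient is governed by a congruence and not by a kernel. If `f a = f b`, then `a
- b` maps into `N_C` and so lies in `p`, whence `a` and `b` are congruent. The projection of `B⁺` to
the quotient by `idealCon p.ideal` thus factors through `f⁺`, and membership in `p` depends only on
the congruence class. -/
theorem mem_of_plus_eq {f : BandHom B C} (hf : Function.Surjective f) {p : PrimeNullIdeal B}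
    (hp : ∀ x, f.plus x ∈ nullSet C → x ∈ p.ideal) {x y : Ambient B} (h : f.plus x = f.plus y)
    (hy : y ∈ p.ideal) : x ∈ p.ideal := by
  have hab : ∀ a b : B, f a = f b → idealCon p.ideal (Ambient.of B a) (Ambient.of B b) := by
    intro a b hab
    refine idealCon_of (hp _ ?_) (hp _ ?_) <;>
    · rw [map_add, BandHom.plus_of, BandHom.plus_of, BandHom.map_neg, hab]
      exact add_neg_mem _
  let q : Ambient B →+* (idealCon p.ideal).Quotient := (idealCon p.ideal).mk'
  have hq : ∀ a b : B, f a = f b → q (Ambient.of B a) = q (Ambient.of B b) := fun a b h =>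
    (RingCon.eq _).2 (hab a b h)
  choose σ hσ using hf
  let l : C →*₀ (idealCon p.ideal).Quotient :=
    { toFun := fun c => q (Ambient.of B (σ c))
      map_zero' := by
        rw [hq (σ 0) 0 (by rw [hσ, map_zero]), map_zero, map_zero]
      map_one' := by
        rw [hq (σ 1) 1 (by rw [hσ, map_one]), map_one, map_one]
      map_mul' := fun c d => by
        rw [hq (σ (c * d)) (σ c * σ d) (by rw [map_mul, hσ, hσ, hσ]), map_mul, map_mul] }
  have e : (Ambient.lift l).comp f.plus = q := Ambient.hom_ext fun b => by
    rw [RingHom.comp_apply, BandHom.plus_of, Ambient.lift_of]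
    exact hq _ _ (hσ _)
  have h1 : q x = q y := by rw [← e, RingHom.comp_apply, RingHom.comp_apply, h]
  have h2 : idealCon p.ideal x y := (RingCon.eq _).1 h1
  -- For `w = 1` and `z = 0` the congruence compares membership of `x` and `y` themselves.
  have h3 := h2 1 0
  rw [one_mul, one_mul, add_zero, add_zero] at h3
  exact h3.2 hy

/-- When `p` contains the preimage of `N_C`, membership in `p` can be tested after applying `f⁺`.
The image ideal then inherits all properties of `p` and contracts back to `p`. -/
theorem PrimeNullIdeal.mem_range_comap_iff {f : BandHom B C} (hf : Function.Surjective f)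
    (p : PrimeNullIdeal B) :
    p ∈ Set.range (comap f) ↔ ∀ x, f.plus x ∈ nullSet C → x ∈ p.ideal := by
  constructor
  · rintro ⟨q, rfl⟩ x hx
    exact q.isNullIdeal.nullSet_le hx
  · intro hp
    have hmem : ∀ x, f.plus x ∈ p.ideal.map f.plus ↔ x ∈ p.ideal := by
      intro x
      refine ⟨fun h => ?_, Ideal.mem_map_of_mem _⟩
      obtain ⟨y, hy, e⟩ := (Ideal.mem_map_iff_of_surjective _ (plus_surjective hf)).1 h
      exact mem_of_plus_eq hf hp e.symm hy
    have hs := plus_surjective hf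
    refine ⟨⟨p.ideal.map f.plus, ⟨fun y hy => ?_, fun a c y h1 h2 => ?_⟩, ?_, ?_⟩, ?_⟩
    · obtain ⟨x, rfl⟩ := hs y
      exact (hmem x).2 (hp x hy)
    · obtain ⟨a, rfl⟩ := hf a
      obtain ⟨c, rfl⟩ := hf c
      obtain ⟨x, rfl⟩ := hs y
      rw [← BandHom.map_neg, ← BandHom.plus_of, ← BandHom.plus_of, ← map_add, hmem] at h1
      rw [← BandHom.plus_of, ← map_add, hmem] at h2 ⊢
      exact p.isNullIdeal.subst _ _ _ h1 h2
    · rw [← map_one f.plus, hmem]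
      exact p.one_notMem
    · intro y z hy hz
      obtain ⟨y, rfl⟩ := hs y
      obtain ⟨z, rfl⟩ := hs z
      rw [← map_mul, hmem]
      rw [hmem] at hy hz
      exact p.mul_notMem hy hz
    · exact PrimeNullIdeal.ext (Ideal.ext hmem)

/-- The image is an intersection of vanishing loci, one for each element that `f⁺` sends into `N_C`.
Since `f⁺` is surjective, every basic open subset of the source comes from the target. -/
theorem PrimeNullIdeal.isClosedEmbedding_comap {f : BandHom B C} (hf : Function.Surjective f) :
    IsClosedEmbedding (comap f) := by
  have hs := plus_surjective hf
  refine ⟨⟨⟨le_antisymm (continuous_comap f).le_induced (le_generateFrom ?_)⟩, ?_⟩, ?_⟩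
  · rintro _ ⟨h, rfl⟩
    obtain ⟨h, rfl⟩ := hs h
    exact ⟨basicOpen h, isOpen_basicOpen h, rfl⟩
  · intro p q h
    refine PrimeNullIdeal.ext (Ideal.ext fun y => ?_)
    obtain ⟨x, rfl⟩ := hs y
    rw [← mem_comap, h, mem_comap]
  · have : Set.range (comap f) = ⋂ x ∈ {x | f.plus x ∈ nullSet C}, (basicOpen x)ᶜ := by
      refine Set.ext fun p => (mem_range_comap_iff hf p).trans ?_
      simp only [Set.mem_iInter, Set.mem_compl_iff, basicOpen, Set.mem_ofPred_eq, not_not]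
    rw [this]
    exact isClosed_biInter fun x _ => (isOpen_basicOpen x).isClosed_compl

end Surjective

/-! ### Closed immersions and null spaces -/

/-- Being a closed embedding is local on the target, and the parts over affine opens cover the null
space of `X`. Over such an open both null spaces are spaces of prime null ideals, and the map is
`comap` of a surjection. -/
theorem NullPoint.isClosedEmbedding_map {X Y : BandScheme.{u}} (i : Y ⟶ X)
    (hi : IsClosedImmersion i) : IsClosedEmbedding (NullPoint.map i.hom) := by
  let U : {U : Opens X.obj.carrier // IsAffineOpen X U} →
      Opens (NullPoint X.obj.toPresheafedSpace) := fun U =>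
    ⟨{ξ | ξ.pt ∈ U.1}, U.1.2.preimage NullPoint.continuous_pt⟩
  have hU : IsOpenCover U := by
    refine IsOpenCover.mk (eq_top_iff.2 fun ξ _ => Opens.mem_iSup.2 ?_)
    obtain ⟨V, hV, hV'⟩ := X.property ξ.pt
    exact ⟨⟨V, hV'⟩, hV⟩
  refine (hU.isClosedEmbedding_iff_restrictPreimage (NullPoint.continuous_map i.hom)).2 ?_
  rintro ⟨V, hV⟩
  obtain ⟨hV', hs⟩ := hi V hV
  have h1 := isHomeomorph_evalAt hV
  have h2 := isHomeomorph_evalAt hV'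
  have h3 : IsClosedEmbedding (PrimeNullIdeal.comap (pull i.hom.hom
      (le_refl ((Opens.map i.hom.hom.base).obj V)))) := by
    refine PrimeNullIdeal.isClosedEmbedding_comap ?_
    unfold pull
    rw [resHom_refl]
    exact hs
  have h4 := h3.comp h2.isClosedEmbedding
  -- Evaluation over `V` after the restricted map equals `comap` after evaluation over the preimage
  -- of `V`; the closed embedding on the left can be cancelled.
  refine (h1.isClosedEmbedding.of_comp_iff).1 h4

end

end BandTheory

/-! ### Gluing over open coverings and the doubled band scheme. -/

namespace BandTheory

noncomputable section

open AlgebraicGeometry BandSpace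

/-! ### Gluing of band morphisms into sections -/

/-- Band morphisms into the sections of a sheaf of bands glue along open coverings. -/
theorem existsUnique_glue (X : BandSpace.{u}) {E : Type u} [Band E] {ι : Type u}
    {W : Opens X.carrier} (U : ι → Opens X.carrier) (hU : ∀ i, U i ≤ W)
    (hW : ∀ x ∈ W, ∃ i, x ∈ U i) (f : ∀ i, BandHom E (Γ X.toPresheafedSpace (U i)))
    (hf : ∀ (i j : ι) (P : Opens X.carrier) (hi : P ≤ U i) (hj : P ≤ U j),
      BandHom.comp (resHom X.toPresheafedSpace hi) (f i) =
        BandHom.comp (resHom X.toPresheafedSpace hj) (f j)) :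
    ∃! g : BandHom E (Γ X.toPresheafedSpace W),
      ∀ i, BandHom.comp (resHom X.toPresheafedSpace (hU i)) g = f i := by
  obtain rfl : W = iSup U :=
    le_antisymm (fun x hx => Opens.mem_iSup.2 (hW x hx)) (iSup_le hU)
  have hs := (TopCat.Presheaf.isSheaf_iff_isSheafUniqueGluing_types
    (F := X.presheaf ⋙ coyoneda.obj (op (⟨E⟩ : BandCat.{u})))).1
      ((isSheaf_iff_isSheaf_of_type _ _).2 (X.IsSheaf ⟨E⟩))
  obtain ⟨g, hg, hg'⟩ := hs U f fun i j => hf i j (U i ⊓ U j) inf_le_left inf_le_right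
  exact ⟨g, fun i => hg i, fun g' h => hg' g' fun i => h i⟩

theorem bandHom_ext_of_cover (X : BandSpace.{u}) {E : Type u} [Band E] {ι : Type u}
    {W : Opens X.carrier} (U : ι → Opens X.carrier) (hU : ∀ i, U i ≤ W)
    (hW : ∀ x ∈ W, ∃ i, x ∈ U i) {f g : BandHom E (Γ X.toPresheafedSpace W)}
    (h : ∀ i, BandHom.comp (resHom X.toPresheafedSpace (hU i)) f =
      BandHom.comp (resHom X.toPresheafedSpace (hU i)) g) : f = g :=
  (existsUnique_glue X U hU hW (fun i => BandHom.comp (resHom X.toPresheafedSpace (hU i)) g)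
    fun i j P hi hj => by
      change BandHom.comp (BandHom.comp _ _) g = BandHom.comp (BandHom.comp _ _) g
      rw [resHom_comp, resHom_comp]).unique h fun _ => rfl

/-! ### Doubling a band scheme along the complement of an open subset -/

section Double

variable (X : BandSpace.{u}) (V : Opens X.carrier)

/-- The relation that identifies the two copies of `V`. -/
def doubleSetoid : Setoid (Bool × X.carrier) where
  r p q := p.2 = q.2 ∧ (p.1 = q.1 ∨ p.2 ∈ V)
  iseqv := ⟨fun _ => ⟨rfl, Or.inl rfl⟩, fun h => ⟨h.1.symm, h.2.imp Eq.symm fun hp => h.1 ▸ hp⟩,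
    fun h h' => ⟨h.1.trans h'.1, by
      rcases h.2 with h2 | h2
      · exact h'.2.imp h2.trans fun hp => h.1 ▸ hp
      · exact Or.inr h2⟩⟩

/-- The set underlying two copies of `X` glued along `V`. -/
def DoublePt : Type u := Quotient (doubleSetoid X V)

variable {X V}

/-- The inclusion of one of the copies of `X`. -/
def sheetPt (V : Opens X.carrier) (b : Bool) (x : X.carrier) : DoublePt X V :=
  Quotient.mk (doubleSetoid X V) (b, x)

theorem sheetPt_eq_iff {b b' : Bool} {x x' : X.carrier} :
    sheetPt V b x = sheetPt V b' x' ↔ x = x' ∧ (b = b' ∨ x ∈ V) :=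
  Quotient.eq (r := doubleSetoid X V)

theorem exists_sheetPt_eq (t : DoublePt X V) : ∃ b x, sheetPt V b x = t := by
  induction t using Quotient.inductionOn with
  | h p => exact ⟨p.1, p.2, rfl⟩

instance : TopologicalSpace (DoublePt X V) where
  IsOpen O := ∀ b, IsOpen (sheetPt V b ⁻¹' O)
  isOpen_univ _ := isOpen_univ
  isOpen_inter _ _ h h' b := (h b).inter (h' b)
  isOpen_sUnion S h b := by
    rw [Set.preimage_sUnion]
    exact isOpen_biUnion fun t ht => h t ht b

theorem continuous_sheetPt (b : Bool) : Continuous (sheetPt V b) :=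
  continuous_def.2 fun _ h => h b

theorem sheetPt_injective (b : Bool) : Function.Injective (sheetPt V b) := fun _ _ h =>
  (sheetPt_eq_iff.1 h).1

/-- The image of `W` in one sheet meets the same sheet in `W` and the other sheet in `W ∩ V`. -/
theorem isOpenEmbedding_sheetPt (b : Bool) : IsOpenEmbedding (sheetPt V b) := by
  refine .of_continuous_injective_isOpenMap (continuous_sheetPt b) (sheetPt_injective b)
    fun W hW b' => ?_
  by_cases hb : b = b'
  · subst hb
    rwa [Set.preimage_image_eq _ (sheetPt_injective b)]
  · have : sheetPt V b' ⁻¹' (sheetPt V b '' W) = W ∩ V := by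
      refine Set.ext fun x => ⟨?_, fun hx => ⟨x, hx.1, sheetPt_eq_iff.2 ⟨rfl, Or.inr hx.2⟩⟩⟩
      rintro ⟨y, hy, e⟩
      obtain ⟨rfl, h⟩ := sheetPt_eq_iff.1 e
      exact ⟨hy, h.resolve_left hb⟩
    rw [this]
    exact hW.inter V.2

/-- The inverse image of an open subset in one of the copies of `X`. -/
def sheetPre (b : Bool) (O : Opens (DoublePt X V)) : Opens X.carrier :=
  ⟨sheetPt V b ⁻¹' O, O.2.preimage (continuous_sheetPt b)⟩

/-- The sections over an open subset of two copies of `X` glued along `V`. -/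
structure DoubleSections (O : Opens (DoublePt X V)) : Type u where
  val : ∀ b, Γ X.toPresheafedSpace (sheetPre b O)
  compat : ∀ (b b' : Bool) (W : Opens X.carrier) (_ : W ≤ V) (h : W ≤ sheetPre b O)
    (h' : W ≤ sheetPre b' O),
    resHom X.toPresheafedSpace h (val b) = resHom X.toPresheafedSpace h' (val b')

namespace DoubleSections

variable {O O' : Opens (DoublePt X V)}

theorem ext {s t : DoubleSections O} (h : ∀ b, s.1 b = t.1 b) : s = t := by
  cases s; cases t; congr; exact funext h

instance : Mul (DoubleSections O) where
  mul s t := ⟨fun b => s.1 b * t.1 b, fun b b' W hW h h' => by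
    rw [map_mul, map_mul, s.2 b b' W hW h h', t.2 b b' W hW h h']⟩

instance : One (DoubleSections O) where
  one := ⟨fun _ => 1, fun b b' W hW h h' => by rw [map_one, map_one]⟩

instance : Zero (DoubleSections O) where
  zero := ⟨fun _ => 0, fun b b' W hW h h' => by rw [map_zero, map_zero]⟩

instance : CommMonoidWithZero (DoubleSections O) where
  mul_assoc _ _ _ := ext fun _ => mul_assoc _ _ _
  one_mul _ := ext fun _ => one_mul _
  mul_one _ := ext fun _ => mul_one _
  mul_comm _ _ := ext fun _ => mul_comm _ _
  zero_mul _ := ext fun _ => zero_mul _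
  mul_zero _ := ext fun _ => mul_zero _

/-- The projection to the sections over one of the copies of `X`. -/
def proj (b : Bool) : DoubleSections O →*₀ Γ X.toPresheafedSpace (sheetPre b O) where
  toFun s := s.1 b
  map_zero' := rfl
  map_one' := rfl
  map_mul' _ _ := rfl

instance : Band (DoubleSections O) where
  nullSet := ⨅ b, (nullSet (Γ X.toPresheafedSpace (sheetPre b O))).comap (Ambient.map (proj b))
  existsUnique_add_mem s := by
    refine ⟨⟨fun b => negB (s.1 b), fun b b' W hW h h' => ?_⟩, ?_, ?_⟩
    · rw [BandHom.map_neg, BandHom.map_neg, s.2 b b' W hW h h']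
    · simp only [Ideal.mem_iInf, Ideal.mem_comap, map_add, Ambient.map_of]
      exact fun b => add_neg_mem (s.1 b)
    · intro t ht
      simp only [Ideal.mem_iInf, Ideal.mem_comap, map_add, Ambient.map_of] at ht
      exact ext fun b => eq_neg (ht b)

theorem mem_nullSet {x : Ambient (DoubleSections O)} :
    x ∈ nullSet (DoubleSections O) ↔ ∀ b, Ambient.map (proj b) x ∈ nullSet _ := by
  change x ∈ (⨅ b, (nullSet (Γ X.toPresheafedSpace (sheetPre b O))).comap _) ↔ _
  simp only [Ideal.mem_iInf, Ideal.mem_comap]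

/-- The projection as a band morphism. -/
def projHom (O : Opens (DoublePt X V)) (b : Bool) :
    BandHom (DoubleSections O) (Γ X.toPresheafedSpace (sheetPre b O)) where
  toMonoidWithZeroHom := proj b
  map_nullSet _ hx := mem_nullSet.1 hx b

/-- A compatible pair of band morphisms. -/
def pair {E : Type u} [Band E] (f : ∀ b, BandHom E (Γ X.toPresheafedSpace (sheetPre b O)))
    (hf : ∀ (b b' : Bool) (W : Opens X.carrier) (_ : W ≤ V) (h : W ≤ sheetPre b O)
      (h' : W ≤ sheetPre b' O), BandHom.comp (resHom X.toPresheafedSpace h) (f b) =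
        BandHom.comp (resHom X.toPresheafedSpace h') (f b')) :
    BandHom E (DoubleSections O) where
  toFun e := ⟨fun b => f b e, fun b b' W hW h h' => DFunLike.congr_fun (hf b b' W hW h h') e⟩
  map_zero' := ext fun b => map_zero (f b)
  map_one' := ext fun b => map_one (f b)
  map_mul' _ _ := ext fun b => map_mul (f b) _ _
  map_nullSet x hx := by
    rw [mem_nullSet]
    intro b
    rw [← RingHom.comp_apply, ← Ambient.map_comp]
    exact (f b).map_nullSet x hx

theorem hom_ext {E : Type u} [Band E] {f g : BandHom E (DoubleSections O)}
    (h : ∀ b, BandHom.comp (projHom O b) f = BandHom.comp (projHom O b) g) : f = g :=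
  BandHom.ext fun e => ext fun b => DFunLike.congr_fun (h b) e

theorem res_projHom (b b' : Bool) {W : Opens X.carrier} (hW : W ≤ V) (h : W ≤ sheetPre b O)
    (h' : W ≤ sheetPre b' O) :
    BandHom.comp (resHom X.toPresheafedSpace h) (projHom O b) =
      BandHom.comp (resHom X.toPresheafedSpace h') (projHom O b') :=
  BandHom.ext fun s => s.2 b b' W hW h h'

theorem sheetPre_mono (b : Bool) (h : O' ≤ O) :
    (sheetPre b O' : Opens X.carrier) ≤ sheetPre b O := fun _ hx => h hx

/-- Restriction of sections. -/
def res (h : O' ≤ O) : BandHom (DoubleSections O) (DoubleSections O') :=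
  pair (fun b => BandHom.comp (resHom X.toPresheafedSpace (sheetPre_mono b h)) (projHom O b))
    fun b b' W hW h1 h2 => by
      change BandHom.comp (BandHom.comp _ _) _ = BandHom.comp (BandHom.comp _ _) _
      rw [resHom_comp, resHom_comp]
      exact res_projHom b b' hW _ _

theorem projHom_comp_res (h : O' ≤ O) (b : Bool) :
    BandHom.comp (projHom O' b) (res h) =
      BandHom.comp (resHom X.toPresheafedSpace (sheetPre_mono b h)) (projHom O b) := rfl

end DoubleSections

open DoubleSections

variable (X V)

/-- The structure presheaf of two copies of `X` glued along `V`. -/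
def doublePresheaf : TopCat.Presheaf BandCat.{u} (TopCat.of (DoublePt X V)) where
  obj O := ⟨DoubleSections O.unop⟩
  map i := DoubleSections.res i.unop.le
  map_id O := DoubleSections.hom_ext (E := DoubleSections O.unop) fun b => by
    refine (projHom_comp_res (le_refl O.unop) b).trans ?_
    rw [resHom_refl]
    rfl
  map_comp {O O' O''} i j := DoubleSections.hom_ext (E := DoubleSections O.unop) fun b => by
    have := resHom_comp (X := X.toPresheafedSpace) (sheetPre_mono b i.unop.le)
      (sheetPre_mono b j.unop.le)
    exact (congrArg (fun g => BandHom.comp g (projHom O.unop b)) this).symm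

theorem doublePresheaf_isSheaf : TopCat.Presheaf.IsSheaf (doublePresheaf X V) := by
  intro E
  refine (isSheaf_iff_isSheaf_of_type _ _).1
    ((TopCat.Presheaf.isSheaf_iff_isSheafUniqueGluing_types
      (F := doublePresheaf X V ⋙ coyoneda.obj (op E))).2 ?_)
  intro ι U sf hsf
  let F : ∀ i, BandHom E (DoubleSections (U i)) := sf
  have hcov : ∀ (b : Bool) (x : X.carrier), x ∈ sheetPre b (iSup U) → ∃ i, x ∈ sheetPre b (U i) :=
    fun b x hx => (Opens.mem_iSup (x := sheetPt V b x)).1 hx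
  have hle : ∀ i, U i ≤ iSup U := le_iSup U
  have hF : ∀ (b : Bool) (i j : ι) (P : Opens X.carrier) (hi : P ≤ sheetPre b (U i))
      (hj : P ≤ sheetPre b (U j)),
      BandHom.comp (resHom X.toPresheafedSpace hi) (BandHom.comp (projHom (U i) b) (F i)) =
        BandHom.comp (resHom X.toPresheafedSpace hj) (BandHom.comp (projHom (U j) b) (F j)) := by
    intro b i j P hi hj
    have h1 : BandHom.comp (res (inf_le_left : U i ⊓ U j ≤ U i)) (F i) =
        BandHom.comp (res (inf_le_right : U i ⊓ U j ≤ U j)) (F j) := hsf i j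
    have hP : P ≤ sheetPre b (U i ⊓ U j) := fun x hx => ⟨hi hx, hj hx⟩
    have h2 := congrArg (fun g => BandHom.comp (resHom X.toPresheafedSpace hP)
      (BandHom.comp (projHom _ b) g)) h1
    have h3 := resHom_comp (X := X.toPresheafedSpace)
      (sheetPre_mono b (inf_le_left : U i ⊓ U j ≤ U i)) hP
    have h4 := resHom_comp (X := X.toPresheafedSpace)
      (sheetPre_mono b (inf_le_right : U i ⊓ U j ≤ U j)) hP
    rw [← h3, ← h4]
    exact h2
  have hglue := fun b => existsUnique_glue X (W := sheetPre b (iSup U))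
    (fun i => sheetPre b (U i)) (fun i => sheetPre_mono b (hle i)) (hcov b)
    (fun i => BandHom.comp (projHom (U i) b) (F i)) (hF b)
  choose g hg hg' using hglue
  -- The sections glued on each sheet agree over `V`: locally both come from one `F i`, whose two
  -- components already agree there.
  let G : BandHom E (DoubleSections (iSup U)) := pair g fun b b' W hW h h' => by
    refine bandHom_ext_of_cover X (fun i => W ⊓ sheetPre b (U i)) (fun i => inf_le_left)
      (fun x hx => (hcov b x (h hx)).imp fun i hi => ⟨hx, hi⟩) fun i => ?_
    have h1 : W ⊓ sheetPre b (U i) ≤ sheetPre b (U i) := inf_le_right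
    have h2 : W ⊓ sheetPre b (U i) ≤ sheetPre b' (U i) := fun x hx => by
      have : sheetPt V b x = sheetPt V b' x := sheetPt_eq_iff.2 ⟨rfl, Or.inr (hW hx.1)⟩
      exact (congrArg (· ∈ U i) this).mp hx.2
    have e1 := congrArg (fun k => BandHom.comp (resHom X.toPresheafedSpace h1) k) (hg b i)
    have e2 := congrArg (fun k => BandHom.comp (resHom X.toPresheafedSpace h2) k) (hg b' i)
    have e3 := congrArg (fun k => BandHom.comp k (F i)) (res_projHom b b' (inf_le_left.trans hW)
      h1 h2)
    have e4 := resHom_comp (X := X.toPresheafedSpace) (sheetPre_mono b (hle i)) h1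
    have e5 := resHom_comp (X := X.toPresheafedSpace) (sheetPre_mono b' (hle i)) h2
    have e6 := resHom_comp (X := X.toPresheafedSpace) h (inf_le_left : W ⊓ sheetPre b (U i) ≤ W)
    have e7 := resHom_comp (X := X.toPresheafedSpace) h' (inf_le_left : W ⊓ sheetPre b (U i) ≤ W)
    change BandHom.comp (BandHom.comp _ _) (g b) = BandHom.comp (BandHom.comp _ _) (g b')
    rw [e6, e7, ← e4, ← e5]
    exact e1.trans (e3.trans e2.symm)
  refine ⟨G, fun i => ?_, fun G' hG' => ?_⟩
  · exact DoubleSections.hom_ext (E := E) (O := U i) fun b => hg b i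
  · refine DoubleSections.hom_ext (E := E) (O := iSup U) fun b => ?_
    refine hg' b _ fun i => ?_
    exact congrArg (fun k => BandHom.comp (projHom (U i) b) k) (hG' i)

/-- Two copies of `X` glued along `V`. -/
def double : BandSpace.{u} where
  carrier := TopCat.of (DoublePt X V)
  presheaf := doublePresheaf X V
  IsSheaf := doublePresheaf_isSheaf X V

/-- The inclusion of one of the copies of `X` on presheafed spaces. -/
def sheetPsh (b : Bool) : X.toPresheafedSpace ⟶ (double X V).toPresheafedSpace where
  base := TopCat.ofHom ⟨sheetPt V b, continuous_sheetPt b⟩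
  c := { app := fun O => projHom O.unop b, naturality := fun _ _ _ => rfl }

/-- Over the image of one sheet the other component of a section lives inside `V`, so it is the
restriction of the first. -/
instance isOpenImmersion_sheetPsh (b : Bool) :
    PresheafedSpace.IsOpenImmersion (sheetPsh X V b) where
  base_open := isOpenEmbedding_sheetPt b
  c_iso U := by
    let O : Opens (DoublePt X V) := ⟨sheetPt V b '' U, (isOpenEmbedding_sheetPt b).isOpenMap _ U.2⟩
    have hpre : ∀ b', sheetPre b' O ≤ (sheetPre b O : Opens X.carrier) := by
      rintro b' x ⟨y, hy, e⟩
      obtain ⟨rfl, -⟩ := sheetPt_eq_iff.1 e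
      exact ⟨y, hy, rfl⟩
    have hV : ∀ b', b' ≠ b → sheetPre b' O ≤ V := by
      rintro b' hb' x ⟨y, hy, e⟩
      obtain ⟨rfl, h⟩ := sheetPt_eq_iff.1 e
      exact h.resolve_left hb'.symm
    let inv : BandHom (Γ X.toPresheafedSpace (sheetPre b O)) (DoubleSections O) :=
      pair (fun b' => resHom X.toPresheafedSpace (hpre b')) fun b1 b2 W hW h1 h2 => by
        rw [resHom_comp, resHom_comp]
    have e1 : BandHom.comp inv (projHom O b) = BandHom.id _ := by
      refine DoubleSections.hom_ext fun b' => ?_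
      change BandHom.comp (resHom X.toPresheafedSpace (hpre b')) (projHom O b) = projHom O b'
      by_cases hb : b' = b
      · subst hb
        rw [resHom_refl]
        rfl
      · rw [res_projHom b b' (hV b' hb) (hpre b') le_rfl, resHom_refl]
        rfl
    have e2 : BandHom.comp (projHom O b) inv = BandHom.id _ :=
      resHom_refl (X := X.toPresheafedSpace) (sheetPre b O) (hpre b)
    exact ⟨inv, e1, e2⟩

/-- The inclusion of one of the copies of `X`. -/
def sheet (b : Bool) : X ⟶ double X V where
  hom := sheetPsh X V b
  isLocal x := isLocalHom_stalkMap_of_isOpenImmersion (sheetPsh X V b) x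

instance isOpenImmersion_sheet (b : Bool) : PresheafedSpace.IsOpenImmersion (sheet X V b).hom :=
  isOpenImmersion_sheetPsh X V b

variable {X V}

theorem sheet_base_eq_iff {b b' : Bool} {x : X.carrier} :
    (sheet X V b).hom.base x = (sheet X V b').hom.base x ↔ b = b' ∨ x ∈ V :=
  sheetPt_eq_iff.trans (and_iff_right rfl)

theorem comp_sheet_eq {Z : BandSpace.{u}} (f : Z ⟶ X) (h : ∀ z, f.hom.base z ∈ V) (b b' : Bool) :
    f ≫ sheet X V b = f ≫ sheet X V b' := by
  have hb : ∀ z, sheetPt V b (f.hom.base z) = sheetPt V b' (f.hom.base z) := fun z =>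
    sheetPt_eq_iff.2 ⟨rfl, Or.inr (h z)⟩
  refine Hom.ext (hom_ext_of_pull hb fun O W hf hg => ?_)
  let P : Opens X.carrier := sheetPre b O ⊓ V
  have hP : W ≤ (Opens.map f.hom.base).obj P := fun z hz => ⟨hf hz, h z⟩
  have h1 : P ≤ sheetPre b O := inf_le_left
  have h2 : P ≤ sheetPre b' O := fun x hx =>
    (congrArg (· ∈ O) (sheetPt_eq_iff.2 ⟨rfl, Or.inr hx.2⟩)).mp hx.1
  have e1 := pull_comp f.hom (sheet X V b).hom hP h1
  have e2 := pull_comp f.hom (sheet X V b').hom hP h2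
  refine e1.symm.trans (Eq.trans ?_ e2)
  exact congrArg (fun k => BandHom.comp (pull f.hom hP) k) (res_projHom b b' inf_le_right h1 h2)

theorem isBandScheme_double (hX : IsBandScheme X) : IsBandScheme (double X V) := by
  intro t
  obtain ⟨b, x, rfl⟩ := exists_sheetPt_eq t
  obtain ⟨U, hxU, hU⟩ := hX x
  refine ⟨⟨Set.range (X.ι U ≫ sheet X V b).hom.base,
    (PresheafedSpace.IsOpenImmersion.base_open (f := (X.ι U ≫ sheet X V b).hom)).isOpen_range⟩,
    ⟨⟨x, hxU⟩, rfl⟩, hU.restrict (X.ι U ≫ sheet X V b) rfl⟩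

end Double

end

end BandTheory

/-! ### Affine presentations and the colimit property. -/

namespace BandTheory

noncomputable section

open AlgebraicGeometry BandSpace Limits

/-! ### Affine presentations -/

section Presentation

variable {J : Type u} [Category.{u} J] {D : J ⥤ BandScheme.{u}} {c : Cocone D}

/-- The set of points of the apex of a cocone in the image of a leg. -/
def legRange (c : Cocone D) (k : J) : Set c.pt.obj.carrier :=
  Set.range (c.ι.app k).hom.hom.base

theorem leg_base (c : Cocone D) {k l : J} (a : k ⟶ l) (u : (D.obj k).obj.carrier) :
    (c.ι.app l).hom.hom.base ((D.map a).hom.hom.base u) = (c.ι.app k).hom.hom.base u := by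
  rw [← c.w a]
  rfl

theorem legRange_mono (c : Cocone D) {k l : J} (a : k ⟶ l) : legRange c k ⊆ legRange c l := by
  rintro _ ⟨u, rfl⟩
  exact ⟨_, leg_base c a u⟩

/-- Two indices are linked at `x` if they are joined by an arrow between pieces containing `x`. -/
def LinkedAt (c : Cocone D) (x : c.pt.obj.carrier) (k l : J) : Prop :=
  x ∈ legRange c k ∧ Nonempty (k ⟶ l)

/-- The complement of the closure of a point. -/
def closureCompl {X : BandSpace.{u}} (x : X.carrier) : Opens X.carrier :=
  ⟨(closure {x})ᶜ, isClosed_closure.isOpen_compl⟩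

theorem notMem_closureCompl {X : BandSpace.{u}} (x : X.carrier) : x ∉ closureCompl x :=
  fun h => h (subset_closure rfl)

/-- The complement of the closure of `x` is the largest open subset avoiding `x`. Every piece of a
presentation that misses `x` thus lands in the locus where the two sheets are glued. -/
theorem subset_closureCompl {X : BandSpace.{u}} {x : X.carrier} {W : Set X.carrier}
    (hW : IsOpen W) (hx : x ∉ W) : W ⊆ closureCompl x := fun y hy hc => by
  obtain ⟨z, hz, rfl⟩ := mem_closure_iff.1 hc W hW hy
  exact hx hz

variable (hc : IsAffinePresentation D c)

include hc

theorem IsAffinePresentation.isOpen_legRange (k : J) : IsOpen (legRange c k) :=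
  have : PresheafedSpace.IsOpenImmersion (c.ι.app k).hom.hom := hc.ι_open k
  (PresheafedSpace.IsOpenImmersion.base_open (f := (c.ι.app k).hom.hom)).isOpen_range

theorem IsAffinePresentation.comp_sheet_eq {x : c.pt.obj.carrier} {k : J}
    (hx : x ∉ legRange c k) (b b' : Bool) :
    (c.ι.app k).hom ≫ sheet c.pt.obj (closureCompl x) b =
      (c.ι.app k).hom ≫ sheet c.pt.obj (closureCompl x) b' :=
  BandTheory.comp_sheet_eq _
    (fun z => subset_closureCompl (hc.isOpen_legRange k) hx ⟨z, rfl⟩) b b'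

/-- If every piece missed `x`, the two inclusions of `X` in the double would agree on all pieces and
hence be equal, yet they differ at `x`. -/
theorem IsAffinePresentation.exists_mem_legRange (x : c.pt.obj.carrier) :
    ∃ k, x ∈ legRange c k := by
  by_contra! h
  obtain ⟨hl⟩ := hc.isColimit
  let T : BandScheme.{u} :=
    ⟨double c.pt.obj (closureCompl x), isBandScheme_double c.pt.property⟩
  let σ : Bool → (c.pt ⟶ T) := fun b => ObjectProperty.homMk (sheet c.pt.obj (closureCompl x) b)
  have e : σ true = σ false := hl.hom_ext fun k => by
    apply ObjectProperty.hom_ext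
    exact hc.comp_sheet_eq (h k) true false
  have e' : (sheet c.pt.obj (closureCompl x) true).hom.base x =
      (sheet c.pt.obj (closureCompl x) false).hom.base x :=
    congrArg (fun f : c.pt ⟶ T => f.hom.hom.base x) e
  exact (sheet_base_eq_iff.1 e').elim (by simp) (notMem_closureCompl x)

/-- Pieces linked to `i` are sent to one sheet of the double and all others to the second sheet. The
induced morphism takes a single value at `x`, so every piece containing `x` uses the sheet of `i`.
-/
theorem IsAffinePresentation.eqvGen_linkedAt {x : c.pt.obj.carrier} {i j : J}
    (hi : x ∈ legRange c i) (hj : x ∈ legRange c j) : Relation.EqvGen (LinkedAt c x) i j := by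
  classical
  obtain ⟨hl⟩ := hc.isColimit
  let T : BandScheme.{u} :=
    ⟨double c.pt.obj (closureCompl x), isBandScheme_double c.pt.property⟩
  let σ : Bool → (c.pt ⟶ T) := fun b => ObjectProperty.homMk (sheet c.pt.obj (closureCompl x) b)
  let ε : J → Bool := fun k => decide (Relation.EqvGen (LinkedAt c x) i k)
  let s : Cocone D :=
    { pt := T
      ι :=
        { app := fun k => c.ι.app k ≫ σ (ε k)
          naturality := fun k l a => by
            change D.map a ≫ c.ι.app l ≫ σ (ε l) = (c.ι.app k ≫ σ (ε k)) ≫ 𝟙 T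
            rw [Category.comp_id, ← Category.assoc, c.w a]
            -- If the source of the arrow contains `x`, both ends lie in one class and use the same
            -- sheet; otherwise the choice of sheet makes no difference on that source.
            by_cases hx : x ∈ legRange c k
            · have h1 : Relation.EqvGen (LinkedAt c x) k l := .rel _ _ ⟨hx, ⟨a⟩⟩
              have h2 : ε k = ε l := decide_eq_decide.2
                ⟨fun h => h.trans _ _ _ h1, fun h => h.trans _ _ _ (h1.symm _ _)⟩
              rw [h2]
            · apply ObjectProperty.hom_ext
              exact hc.comp_sheet_eq hx _ _ } }
  have hφ : ∀ k, x ∈ legRange c k → (hl.desc s).hom.hom.base x =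
      (sheet c.pt.obj (closureCompl x) (ε k)).hom.base x := by
    rintro k ⟨u, rfl⟩
    exact congrArg (fun f : D.obj k ⟶ T => f.hom.hom.base u) (hl.fac s k)
  have h1 : ε i = true := decide_eq_true (.refl i)
  have h2 := ((hφ i hi).symm.trans (hφ j hj))
  have h3 := (sheet_base_eq_iff.1 h2).resolve_right (notMem_closureCompl x)
  exact of_decide_eq_true (h3.symm.trans h1)

theorem IsAffinePresentation.isOpenEmbedding_leg (k : J) :
    IsOpenEmbedding (NullPoint.map (c.ι.app k).hom) :=
  have : PresheafedSpace.IsOpenImmersion (c.ι.app k).hom.hom := hc.ι_open k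
  NullPoint.isOpenEmbedding_map _

theorem IsAffinePresentation.exists_map_eq (ξ : NullPoint c.pt.obj.toPresheafedSpace) {k : J}
    (h : ξ.pt ∈ legRange c k) : ∃ ζ, NullPoint.map (c.ι.app k).hom ζ = ξ := by
  have : PresheafedSpace.IsOpenImmersion (c.ι.app k).hom.hom := hc.ι_open k
  have := (NullPoint.range_map (c.ι.app k).hom).superset h
  exact this

/-- The value of a cocone at `ξ` is carried along the zigzag. The first component is needed for
transitivity: the middle piece must contain the point so that `ξ` lifts to it. -/
theorem IsAffinePresentation.leg_eq (s : Cocone (D ⋙ nullSpace))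
    (ξ : NullPoint c.pt.obj.toPresheafedSpace) {i j : J}
    (h : Relation.EqvGen (LinkedAt c ξ.pt) i j) :
    (ξ.pt ∈ legRange c i ↔ ξ.pt ∈ legRange c j) ∧ ∀ ζ ζ',
      NullPoint.map (c.ι.app i).hom ζ = ξ → NullPoint.map (c.ι.app j).hom ζ' = ξ →
        s.ι.app i ζ = s.ι.app j ζ' := by
  induction h with
  | rel k l h =>
    obtain ⟨hk, ⟨a⟩⟩ := h
    refine ⟨iff_of_true hk (legRange_mono c a hk), fun ζ ζ' h1 h2 => ?_⟩
    have h3 : NullPoint.map (c.ι.app l).hom (NullPoint.map (D.map a).hom ζ) = ξ := by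
      rw [← NullPoint.map_comp, ← h1]
      exact congrArg (fun f : D.obj k ⟶ c.pt => NullPoint.map f.hom ζ) (c.w a)
    have h4 : NullPoint.map (D.map a).hom ζ = ζ' :=
      (hc.isOpenEmbedding_leg l).injective (h3.trans h2.symm)
    rw [← h4]
    exact (ConcreteCategory.congr_hom (s.w a) ζ).symm
  | refl k =>
    refine ⟨Iff.rfl, fun ζ ζ' h1 h2 => ?_⟩
    rw [(hc.isOpenEmbedding_leg k).injective (h1.trans h2.symm)]
  | symm k l _ ih => exact ⟨ih.1.symm, fun ζ ζ' h1 h2 => (ih.2 ζ' ζ h2 h1).symm⟩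
  | trans k l m _ _ ih ih' =>
    refine ⟨ih.1.trans ih'.1, fun ζ ζ' h1 h2 => ?_⟩
    have hk : ξ.pt ∈ legRange c k := ⟨ζ.pt, congrArg NullPoint.pt h1⟩
    obtain ⟨ζ'', h3⟩ := hc.exists_map_eq ξ (ih.1.1 hk)
    exact (ih.2 ζ ζ'' h1 h3).trans (ih'.2 ζ'' ζ' h3 h2)

/-- The null space of an affine presentation is a colimit of the null spaces of its pieces. -/
theorem IsAffinePresentation.nonempty_isColimit_nullSpace :
    Nonempty (IsColimit (nullSpace.mapCocone c)) := by
  have hex : ∀ ξ : NullPoint c.pt.obj.toPresheafedSpace, ∃ k ζ,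
      NullPoint.map (c.ι.app k).hom ζ = ξ := fun ξ => by
    obtain ⟨k, hk⟩ := hc.exists_mem_legRange ξ.pt
    exact ⟨k, hc.exists_map_eq ξ hk⟩
  choose κ ζ hζ using hex
  -- The value defined from the chosen piece and lift agrees with that of any other piece, by the
  -- zigzag between the two.
  have hwd : ∀ (s : Cocone (D ⋙ nullSpace)) (k : J) (z : NullPoint (D.obj k).obj.toPresheafedSpace),
      s.ι.app (κ (NullPoint.map (c.ι.app k).hom z)) (ζ (NullPoint.map (c.ι.app k).hom z)) =
        s.ι.app k z := fun s k z => by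
    have h1 : (NullPoint.map (c.ι.app k).hom z).pt ∈ legRange c k := ⟨z.pt, rfl⟩
    have h2 : (NullPoint.map (c.ι.app k).hom z).pt ∈
        legRange c (κ (NullPoint.map (c.ι.app k).hom z)) :=
      ⟨(ζ _).pt, congrArg NullPoint.pt (hζ _)⟩
    exact (hc.leg_eq s _ (hc.eqvGen_linkedAt h2 h1)).2 _ _ (hζ _) rfl
  refine ⟨{ desc := fun s => TopCat.ofHom ⟨fun ξ => s.ι.app (κ ξ) (ζ ξ), ?_⟩,
            fac := fun s k => ?_, uniq := fun s m hm => ?_ }⟩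
  · refine continuous_iff_continuousAt.2 fun ξ => ?_
    obtain ⟨k, z, rfl⟩ : ∃ k z, NullPoint.map (c.ι.app k).hom z = ξ := ⟨κ ξ, ζ ξ, hζ ξ⟩
    -- Continuity may be tested on a leg, since legs are open embeddings; there the map is the given
    -- one of the cocone.
    rw [← (hc.isOpenEmbedding_leg k).continuousAt_iff]
    have : (fun ξ => s.ι.app (κ ξ) (ζ ξ)) ∘ NullPoint.map (c.ι.app k).hom = s.ι.app k :=
      funext fun z => hwd s k z
    rw [this]
    exact (s.ι.app k).hom.continuous.continuousAt
  · exact TopCat.hom_ext (ContinuousMap.ext fun z => hwd s k z)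
  · refine TopCat.hom_ext (ContinuousMap.ext fun ξ => ?_)
    have := ConcreteCategory.congr_hom (hm (κ ξ)) (ζ ξ)
    refine Eq.trans ?_ this
    exact congrArg m (hζ ξ).symm

end Presentation

theorem isNullSpaceFunctor_nullSpace :
    IsNullSpaceFunctor nullSpace.{u} nullSpacePi nullSpaceEta where
  piBar_eq := piBar_eq_nullSpaceEta
  isColimit _ _ hc := hc.nonempty_isColimit_nullSpace
  isOpenEmbedding i hi :=
    have : PresheafedSpace.IsOpenImmersion i.hom.hom := hi
    NullPoint.isOpenEmbedding_map i.hom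
  isClosedEmbedding i hi := NullPoint.isClosedEmbedding_map i hi

end

end BandTheory

/-! ### Every band scheme is the colimit of its affine opens. -/

namespace BandTheory

noncomputable section

open AlgebraicGeometry BandSpace Limits

namespace BandSpace

/-! ### Gluing of morphisms -/

theorem range_ι_mono (X : BandSpace.{u}) {U V : Opens X.carrier} (h : V ≤ U) :
    Set.range (X.ι V).hom.base ⊆ Set.range (X.ι U).hom.base := by
  rw [range_ι, range_ι]
  exact h

/-- The inclusion of an open subspace into a larger one. -/
def incl (X : BandSpace.{u}) {U V : Opens X.carrier} (h : V ≤ U) : X.restrict V ⟶ X.restrict U :=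
  lift (X.ι U) (X.ι V) (X.range_ι_mono h)

@[simp]
theorem incl_ι (X : BandSpace.{u}) {U V : Opens X.carrier} (h : V ≤ U) :
    X.incl h ≫ X.ι U = X.ι V :=
  lift_fac _ _ _

theorem isOpenImmersion_incl (X : BandSpace.{u}) {U V : Opens X.carrier} (h : V ≤ U) :
    PresheafedSpace.IsOpenImmersion (X.incl h).hom := by
  let W : Opens (X.restrict U).carrier := (Opens.map (X.ι U).hom.base).obj V
  have hr : Set.range (X.ι V).hom.base = Set.range ((X.restrict U).ι W ≫ X.ι U).hom.base := by
    have h1 : Set.range ((X.restrict U).ι W ≫ X.ι U).hom.base =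
        (X.ι U).hom.base '' Set.range ((X.restrict U).ι W).hom.base :=
      Set.range_comp (X.ι U).hom.base ((X.restrict U).ι W).hom.base
    rw [h1, range_ι, range_ι]
    have h2 : (V : Set X.carrier) ⊆ Set.range (X.ι U).hom.base := by
      rw [range_ι]
      exact h
    exact (Set.image_preimage_eq_of_subset h2).symm
  have e : X.incl h = (isoOfRangeEq (X.ι V) ((X.restrict U).ι W ≫ X.ι U) hr).hom ≫
      (X.restrict U).ι W := hom_cancel (X.ι U) (by
    rw [incl_ι, Category.assoc]
    exact (Hom.ext (PresheafedSpace.IsOpenImmersion.lift_fac _ _ hr.le)).symm)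
  have := isOpenImmersion_of_iso (isoOfRangeEq (X.ι V) ((X.restrict U).ι W ≫ X.ι U) hr)
  rw [e]
  infer_instance

section Glue

variable {X Z : BandSpace.{u}} {𝓑 : Set (Opens X.carrier)}

/-- A compatible family of morphisms on the members of a basis of open subsets. -/
structure GlueData (𝓑 : Set (Opens X.carrier)) (Z : BandSpace.{u}) where
  basis : ∀ (x : X.carrier) (O : Opens X.carrier), x ∈ O → ∃ U ∈ 𝓑, x ∈ U ∧ U ≤ O
  hom : ∀ U : 𝓑, X.restrict U.1 ⟶ Z
  compat : ∀ (U V : 𝓑) (h : V.1 ≤ U.1), X.incl h ≫ hom U = hom V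

namespace GlueData

variable (G : GlueData 𝓑 Z)

/-- Compatibility is only assumed for nested members; a member of the basis inside the intersection,
containing the point, compares any two. -/
theorem hom_base_eq {U V : 𝓑} (y : (X.restrict U.1).carrier) (z : (X.restrict V.1).carrier)
    (h : (X.ι U.1).hom.base y = (X.ι V.1).hom.base z) :
    (G.hom U).hom.base y = (G.hom V).hom.base z := by
  have hy : (X.ι U.1).hom.base y ∈ U.1 ⊓ V.1 :=
    ⟨(range_ι U.1).subset ⟨y, rfl⟩, h ▸ (range_ι V.1).subset ⟨z, rfl⟩⟩
  obtain ⟨P, hP, hyP, hle⟩ := G.basis _ _ hy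
  obtain ⟨t, ht⟩ := (range_ι P).superset hyP
  have aux : ∀ (U : 𝓑) (hU : P ≤ U.1) (y : (X.restrict U.1).carrier),
      (X.ι U.1).hom.base y = (X.ι P).hom.base t →
        (G.hom U).hom.base y = (G.hom ⟨P, hP⟩).hom.base t := by
    intro U hU y e
    have e1 : (X.ι U.1).hom.base ((X.incl hU).hom.base t) = (X.ι P).hom.base t :=
      congrArg (fun f : X.restrict P ⟶ X => f.hom.base t) (X.incl_ι hU)
    have e2 : (X.incl hU).hom.base t = y :=
      (PresheafedSpace.IsOpenImmersion.base_open (f := (X.ι U.1).hom)).injective (e1.trans e.symm)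
    rw [← e2]
    exact congrArg (fun f : X.restrict P ⟶ Z => f.hom.base t) (G.compat U ⟨P, hP⟩ hU)
  exact (aux U (hle.trans inf_le_left) y ht.symm).trans
    (aux V (hle.trans inf_le_right) z (h.symm.trans ht.symm)).symm

theorem exists_ι_eq (G : GlueData 𝓑 Z) (x : X.carrier) :
    ∃ (U : 𝓑) (y : (X.restrict U.1).carrier), (X.ι U.1).hom.base y = x := by
  obtain ⟨U, hU, hx, -⟩ := G.basis x ⊤ trivial
  obtain ⟨y, hy⟩ := (range_ι U).superset hx
  exact ⟨⟨U, hU⟩, y, hy⟩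

/-- The glued map on points. -/
def pt (x : X.carrier) : Z.carrier :=
  (G.hom (G.exists_ι_eq x).choose).hom.base (G.exists_ι_eq x).choose_spec.choose

theorem pt_ι {U : 𝓑} (y : (X.restrict U.1).carrier) :
    G.pt ((X.ι U.1).hom.base y) = (G.hom U).hom.base y :=
  G.hom_base_eq _ _ (G.exists_ι_eq _).choose_spec.choose_spec

theorem continuous_pt : Continuous G.pt := by
  refine continuous_iff_continuousAt.2 fun x => ?_
  obtain ⟨U, y, rfl⟩ := G.exists_ι_eq x
  rw [← (PresheafedSpace.IsOpenImmersion.base_open (f := (X.ι U.1).hom)).continuousAt_iff]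
  have : G.pt ∘ (X.ι U.1).hom.base = (G.hom U).hom.base := funext G.pt_ι
  rw [this]
  exact (G.hom U).hom.base.hom.continuous.continuousAt

/-- The glued continuous map. -/
def base : X.carrier ⟶ Z.carrier := TopCat.ofHom ⟨G.pt, G.continuous_pt⟩

theorem le_map_hom (U : 𝓑) {O : Opens Z.carrier} {P : Opens X.carrier}
    (h : P ≤ (Opens.map G.base).obj O) :
    (Opens.map (X.ι U.1).hom.base).obj P ≤ (Opens.map (G.hom U).hom.base).obj O := fun y hy =>
  show (G.hom U).hom.base y ∈ O from G.pt_ι y ▸ h hy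

theorem exists_mem_map_ι (U : 𝓑) {P : Opens X.carrier} (h : P ≤ U.1) :
    ∀ x ∈ P, ∃ y ∈ (Opens.map (X.ι U.1).hom.base).obj P, (X.ι U.1).hom.base y = x := fun x hx => by
  obtain ⟨y, rfl⟩ := (range_ι U.1).superset (h hx)
  exact ⟨y, hx, rfl⟩

/-- Pull back of sections along a member of the family, as sections of `X`. -/
def sec (U : 𝓑) {O : Opens Z.carrier} {P : Opens X.carrier} (h : P ≤ (Opens.map G.base).obj O)
    (h' : P ≤ U.1) : BandHom (Γ Z.toPresheafedSpace O) (Γ X.toPresheafedSpace P) :=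
  BandHom.comp (push (X.ι U.1).hom (exists_mem_map_ι U h')) (pull (G.hom U).hom (G.le_map_hom U h))

theorem resHom_comp_sec (U : 𝓑) {O : Opens Z.carrier} {P Q : Opens X.carrier}
    (h : P ≤ (Opens.map G.base).obj O) (h' : P ≤ U.1) (hQ : Q ≤ P) :
    BandHom.comp (resHom X.toPresheafedSpace hQ) (G.sec U h h') =
      G.sec U (hQ.trans h) (hQ.trans h') := by
  have e1 := push_comp_resHom (X.ι U.1).hom
    (W := (Opens.map (X.ι U.1).hom.base).obj P) (W' := (Opens.map (X.ι U.1).hom.base).obj Q)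
    (fun y hy => hQ hy) (exists_mem_map_ι U (hQ.trans h'))
  have e2 := resHom_comp_pull (G.hom U).hom (G.le_map_hom U h)
    (W' := (Opens.map (X.ι U.1).hom.base).obj Q) (fun y hy => hQ hy)
  have e3 := resHom_comp_push (X.ι U.1).hom (exists_mem_map_ι U h') hQ
  refine (congrArg (fun g => BandHom.comp g (pull (G.hom U).hom (G.le_map_hom U h))) e3).trans ?_
  refine (congrArg (fun g => BandHom.comp g (pull (G.hom U).hom (G.le_map_hom U h)))
    e1.symm).trans ?_
  exact congrArg (BandHom.comp (push (X.ι U.1).hom (exists_mem_map_ι U (hQ.trans h')))) e2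

/-- Pulling back to `V` factors through the inclusion of `V` in `U`, and this inclusion followed by
`push` from `V` is `push` from `U`. -/
theorem sec_eq_of_le {U V : 𝓑} (hVU : V.1 ≤ U.1) {O : Opens Z.carrier} {P : Opens X.carrier}
    (h : P ≤ (Opens.map G.base).obj O) (hV : P ≤ V.1) :
    G.sec U h (hV.trans hVU) = G.sec V h hV := by
  have hi : (Opens.map (X.ι V.1).hom.base).obj P ≤
      (Opens.map (X.incl hVU).hom.base).obj ((Opens.map (X.ι U.1).hom.base).obj P) := fun t ht => by
    have e1 : (X.ι U.1).hom.base ((X.incl hVU).hom.base t) = (X.ι V.1).hom.base t :=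
      congrArg (fun f : X.restrict V.1 ⟶ X => f.hom.base t) (X.incl_ι hVU)
    change (X.ι U.1).hom.base ((X.incl hVU).hom.base t) ∈ P
    rw [e1]
    exact ht
  have e1 : pull (G.hom V).hom (G.le_map_hom V h) =
      BandHom.comp (pull (X.incl hVU).hom hi) (pull (G.hom U).hom (G.le_map_hom U h)) := by
    rw [pull_comp]
    exact pull_congr (congrArg Hom.hom (G.compat U V hVU)).symm _ _
  -- Since the inclusion of `V` in `X` factors through `U`, this follows by inserting the inverse
  -- pair `pull`, `push` along `U` and cancelling the pair along `V`.
  have e2 : BandHom.comp (push (X.ι V.1).hom (exists_mem_map_ι V hV)) (pull (X.incl hVU).hom hi) =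
      push (X.ι U.1).hom (exists_mem_map_ι U (hV.trans hVU)) := by
    have a1 := pull_comp_push (X.ι U.1).hom (exists_mem_map_ι U (hV.trans hVU)) le_rfl
    rw [resHom_refl] at a1
    have a2 : BandHom.comp (pull (X.incl hVU).hom hi) (pull (X.ι U.1).hom le_rfl) =
        pull (X.ι V.1).hom (O := P) le_rfl := by
      rw [pull_comp]
      exact pull_congr (congrArg Hom.hom (X.incl_ι hVU)) _ _
    have a3 := push_comp_pull (X.ι V.1).hom (O := P) le_rfl (exists_mem_map_ι V hV)
    rw [resHom_refl] at a3
    let p := push (X.ι U.1).hom (exists_mem_map_ι U (hV.trans hVU))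
    let q := push (X.ι V.1).hom (exists_mem_map_ι V hV)
    refine (congrArg (fun g => BandHom.comp q (BandHom.comp (pull (X.incl hVU).hom hi) g))
      a1.symm).trans ?_
    refine (congrArg (fun g => BandHom.comp q (BandHom.comp g p)) a2).trans ?_
    exact congrArg (fun g => BandHom.comp g p) a3
  exact (congrArg (fun g => BandHom.comp g (pull (G.hom U).hom (G.le_map_hom U h)))
    e2.symm).trans (congrArg (BandHom.comp (push (X.ι V.1).hom (exists_mem_map_ι V hV))) e1.symm)

/-- The two sides agree on every member of the basis contained in `P`, by the nested case, and these
members cover `P`. -/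
theorem sec_eq (U V : 𝓑) {O : Opens Z.carrier} {P : Opens X.carrier}
    (h : P ≤ (Opens.map G.base).obj O) (hU : P ≤ U.1) (hV : P ≤ V.1) :
    G.sec U h hU = G.sec V h hV := by
  refine bandHom_ext_of_cover X (ι := {Q : 𝓑 // Q.1 ≤ P}) (fun Q => Q.1.1) (fun Q => Q.2)
    (fun x hx => ?_) fun Q => ?_
  · obtain ⟨Q, hQ, hxQ, hle⟩ := G.basis x P hx
    exact ⟨⟨⟨Q, hQ⟩, hle⟩, hxQ⟩
  · rw [resHom_comp_sec, resHom_comp_sec, G.sec_eq_of_le (V := Q.1) (Q.2.trans hU) _ le_rfl,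
      G.sec_eq_of_le (V := Q.1) (Q.2.trans hV) _ le_rfl]

theorem existsUnique_app (O : Opens Z.carrier) :
    ∃! g : BandHom (Γ Z.toPresheafedSpace O)
        (Γ X.toPresheafedSpace ((Opens.map G.base).obj O)),
      ∀ U : 𝓑, BandHom.comp (resHom X.toPresheafedSpace inf_le_left) g =
        G.sec U (P := (Opens.map G.base).obj O ⊓ U.1) inf_le_left inf_le_right :=
  existsUnique_glue X (fun U : 𝓑 => (Opens.map G.base).obj O ⊓ U.1) (fun _ => inf_le_left)
    (fun x hx => by
      obtain ⟨U, hU, hxU, -⟩ := G.basis x _ hx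
      exact ⟨⟨U, hU⟩, hx, hxU⟩) _ fun U V P hi hj => by
      rw [resHom_comp_sec, resHom_comp_sec]
      exact G.sec_eq _ _ _ _ _

/-- Pull back of sections along the glued map. -/
def app (O : Opens Z.carrier) : BandHom (Γ Z.toPresheafedSpace O)
    (Γ X.toPresheafedSpace ((Opens.map G.base).obj O)) :=
  (G.existsUnique_app O).choose

theorem resHom_comp_app (U : 𝓑) {O : Opens Z.carrier} {P : Opens X.carrier}
    (h : P ≤ (Opens.map G.base).obj O) (h' : P ≤ U.1) :
    BandHom.comp (resHom X.toPresheafedSpace h) (G.app O) = G.sec U h h' := by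
  have e := (G.existsUnique_app O).choose_spec.1 U
  have e2 := G.resHom_comp_sec U (P := (Opens.map G.base).obj O ⊓ U.1) inf_le_left inf_le_right
    (Q := P) (le_inf h h')
  rw [← e] at e2
  exact (congrArg (fun g => BandHom.comp g (G.app O)) (resHom_comp
    (X := X.toPresheafedSpace) (U := (Opens.map G.base).obj O) inf_le_left (le_inf h h'))).symm.trans
      e2

theorem app_naturality {O O' : Opens Z.carrier} (h : O' ≤ O) :
    BandHom.comp (G.app O') (resHom Z.toPresheafedSpace h) =
      BandHom.comp (resHom X.toPresheafedSpace ((Opens.map G.base).map (homOfLE h)).le)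
        (G.app O) := by
  refine bandHom_ext_of_cover X (fun U : 𝓑 => (Opens.map G.base).obj O' ⊓ U.1)
    (fun _ => inf_le_left) (fun x hx => ?_) fun U => ?_
  · obtain ⟨U, hU, hxU, -⟩ := G.basis x _ hx
    exact ⟨⟨U, hU⟩, hx, hxU⟩
  · have e1 := G.resHom_comp_app U (O := O') (P := (Opens.map G.base).obj O' ⊓ U.1) inf_le_left
      inf_le_right
    have e2 := G.resHom_comp_app U (O := O) (P := (Opens.map G.base).obj O' ⊓ U.1)
      (inf_le_left.trans ((Opens.map G.base).map (homOfLE h)).le) inf_le_right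
    refine (congrArg (fun g => BandHom.comp g (resHom Z.toPresheafedSpace h)) e1).trans ?_
    refine Eq.trans ?_ (congrArg (fun g => BandHom.comp g (G.app O)) (resHom_comp
      (X := X.toPresheafedSpace) _ _)).symm
    rw [e2]
    exact congrArg (BandHom.comp (push (X.ι U.1).hom (exists_mem_map_ι U inf_le_right)))
      (pull_comp_resHom (G.hom U).hom h (G.le_map_hom U inf_le_left))

/-- The glued morphism of presheafed spaces. -/
def pshHom : X.toPresheafedSpace ⟶ Z.toPresheafedSpace where
  base := G.base
  c := { app := fun O => G.app O.unop, naturality := fun _ _ a => G.app_naturality a.unop.le }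

theorem ι_comp_pshHom (U : 𝓑) : (X.ι U.1).hom ≫ G.pshHom = (G.hom U).hom := by
  refine hom_ext_of_pull (fun y => G.pt_ι y) fun O W hf hg => ?_
  have hW : (W : Opens (X.restrict U.1).carrier) ≤ (Opens.map (X.ι U.1).hom.base).obj
      ((Opens.map G.base).obj O ⊓ U.1) := fun y hy =>
    ⟨hf hy, (range_ι U.1).subset ⟨y, rfl⟩⟩
  have e1 := pull_comp (X.ι U.1).hom G.pshHom (O := O)
    (V := (Opens.map G.base).obj O ⊓ U.1) hW inf_le_left
  have e2 : pull G.pshHom (O := O) (W := (Opens.map G.base).obj O ⊓ U.1) inf_le_left =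
      G.sec U inf_le_left inf_le_right := G.resHom_comp_app U inf_le_left inf_le_right
  rw [e2] at e1
  refine e1.symm.trans ?_
  have e3 := pull_comp_push (X.ι U.1).hom (exists_mem_map_ι U
    (P := (Opens.map G.base).obj O ⊓ U.1) inf_le_right) hW
  refine (congrArg (fun g => BandHom.comp g (pull (G.hom U).hom (G.le_map_hom U (O := O)
    inf_le_left))) e3).trans ?_
  exact resHom_comp_pull _ _ _

/-- The glued morphism. -/
def desc : X ⟶ Z where
  hom := G.pshHom
  isLocal x := by
    refine isLocalHom_stalkMap_of G.pshHom x fun O hO a ha => ?_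
    obtain ⟨U, y, rfl⟩ := G.exists_ι_eq x
    -- Invertibility of germs survives restriction to a member `U` around the point. There the glued
    -- morphism is `hom U`, which is local.
    have h1 := IsUnitAt.pull (X.ι U.1).hom
      (W := (Opens.map (X.ι U.1).hom.base).obj ((Opens.map G.base).obj O)) le_rfl hO ha
    have h2 : pull (X.ι U.1).hom
        (W := (Opens.map (X.ι U.1).hom.base).obj ((Opens.map G.base).obj O)) le_rfl
          (pull G.pshHom (O := O) le_rfl a) = pull (G.hom U).hom (G.le_map_hom U le_rfl) a :=
      DFunLike.congr_fun ((pull_comp (X.ι U.1).hom G.pshHom (O := O) le_rfl le_rfl).trans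
        (pull_congr (G.ι_comp_pshHom U) _ _)) a
    have h3 := (isUnitAt_pull (G.hom U) (G.le_map_hom U le_rfl) hO).1 (h2 ▸ h1)
    exact Eq.mpr (congrArg (fun z => IsUnitAt Z.toPresheafedSpace z a) (G.pt_ι y)) h3

theorem ι_comp_desc (U : 𝓑) : X.ι U.1 ≫ G.desc = G.hom U := Hom.ext (G.ι_comp_pshHom U)

theorem hom_ext (hB : ∀ (x : X.carrier) (O : Opens X.carrier), x ∈ O → ∃ U ∈ 𝓑, x ∈ U ∧ U ≤ O)
    {f g : X ⟶ Z} (h : ∀ U ∈ 𝓑, X.ι U ≫ f = X.ι U ≫ g) : f = g := by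
  refine Hom.ext (hom_ext_of_pull (fun x => ?_) fun O W hf hg => ?_)
  · obtain ⟨U, hU, hx, -⟩ := hB x ⊤ trivial
    obtain ⟨y, rfl⟩ := (range_ι U).superset hx
    exact congrArg (fun k : X.restrict U ⟶ Z => k.hom.base y) (h U hU)
  · refine bandHom_ext_of_cover X (ι := {Q : 𝓑 // Q.1 ≤ W}) (fun Q => Q.1.1) (fun Q => Q.2)
      (fun x hx => ?_) fun Q => ?_
    · obtain ⟨Q, hQ, hxQ, hle⟩ := hB x W hx
      exact ⟨⟨⟨Q, hQ⟩, hle⟩, hxQ⟩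
    · rw [resHom_comp_pull, resHom_comp_pull]
      have hp : ∀ y ∈ Q.1.1, ∃ x ∈ (⊤ : Opens (X.restrict Q.1.1).carrier),
          (X.ι Q.1.1).hom.base x = y := fun y hy => by
        obtain ⟨t, rfl⟩ := (range_ι Q.1.1).superset hy
        exact ⟨t, trivial, rfl⟩
      have hi : (⊤ : Opens (X.restrict Q.1.1).carrier) ≤
          (Opens.map (X.ι Q.1.1).hom.base).obj Q.1.1 := fun y _ =>
        (range_ι Q.1.1).subset ⟨y, rfl⟩
      have e := push_comp_pull (X.ι Q.1.1).hom hi hp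
      rw [resHom_refl] at e
      have aux : ∀ (k : X ⟶ Z) (hk : Q.1.1 ≤ (Opens.map k.hom.base).obj O), pull k.hom hk =
          BandHom.comp (push (X.ι Q.1.1).hom hp)
            (pull (X.ι Q.1.1 ≫ k).hom (O := O) (W := ⊤) fun x hx => hk (hi hx)) := fun k hk => by
        refine (congrArg (fun m => BandHom.comp m (pull k.hom hk)) e).symm.trans ?_
        exact congrArg (BandHom.comp (push (X.ι Q.1.1).hom hp)) 
              (pull_comp (X.ι Q.1.1).hom k.hom hi hk)
      rw [aux, aux]
      congr 1
      exact pull_congr (congrArg Hom.hom (h _ Q.1.2)) _ _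

end GlueData

end Glue

end BandSpace

/-! ### The canonical affine presentation -/

section Canonical

variable (X : BandScheme.{u})

/-- The affine open subsets of a band scheme. -/
abbrev AffineOpens : Type u := {U : Opens X.obj.carrier // IsAffineOpen X U}

variable {X}

/-- An affine open subset of a band scheme, as a band scheme. -/
def AffineOpens.toScheme (U : AffineOpens X) : BandScheme.{u} :=
  ⟨X.obj.restrict U.1, IsAffine.isBandScheme U.2⟩

/-- The inclusion of an affine open subset. -/
def AffineOpens.ι (U : AffineOpens X) : U.toScheme ⟶ X := ObjectProperty.homMk (X.obj.ι U.1)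

theorem AffineOpens.isOpenImmersion_ι (U : AffineOpens X) : IsOpenImmersion U.ι :=
  inferInstanceAs (PresheafedSpace.IsOpenImmersion (X.obj.ι U.1).hom)

variable (X)

/-- The diagram of affine open subsets of a band scheme. -/
def affineDiagram : AffineOpens X ⥤ BandScheme.{u} where
  obj U := U.toScheme
  map {V U} a := ObjectProperty.homMk (X.obj.incl (show V.1 ≤ U.1 from a.le))
  map_id U := ObjectProperty.hom_ext _ (hom_cancel (X.obj.ι U.1)
    ((X.obj.incl_ι le_rfl).trans (Category.id_comp _).symm))
  map_comp {W V U} a b := ObjectProperty.hom_ext _ (hom_cancel (X.obj.ι U.1) (by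
    change X.obj.incl (a ≫ b).le ≫ _ = (X.obj.incl a.le ≫ X.obj.incl b.le) ≫ _
    rw [Category.assoc, incl_ι, incl_ι, incl_ι]))

/-- The cocone of inclusions of affine open subsets. -/
def affineCocone : Cocone (affineDiagram X) where
  pt := X
  ι :=
    { app := fun U => U.ι
      naturality := fun _ _ a => ObjectProperty.hom_ext _
        ((X.obj.incl_ι a.le).trans (Category.comp_id _).symm) }

/-- The morphisms of a cocone on the diagram of affine open subsets form a compatible family. -/
def affineGlueData (s : Cocone (affineDiagram X)) :
    GlueData {U : Opens X.obj.carrier | IsAffineOpen X U} s.pt.obj where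
  basis x O hx := by
    obtain ⟨U, hx, hle, hU⟩ := IsBandScheme.exists_affine X.property x O hx
    exact ⟨U, hU, hx, hle⟩
  hom U := (s.ι.app U).hom
  compat U V h := congrArg InducedCategory.Hom.hom (s.w (homOfLE h : (V : AffineOpens X) ⟶ U))

/-- Affine opens form a basis, so the legs of any cocone glue to a unique morphism out of `X`. This
presentation brings property 2 to bear on every band scheme in the uniqueness proof. -/
theorem isAffinePresentation_affineCocone :
    IsAffinePresentation (affineDiagram X) (affineCocone X) where
  affine U := U.2
  map_open a := X.obj.isOpenImmersion_incl a.le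
  isColimit := ⟨
    { desc := fun s => ObjectProperty.homMk (affineGlueData X s).desc
      fac := fun s U => ObjectProperty.hom_ext _ ((affineGlueData X s).ι_comp_desc U)
      uniq := fun s _ hm => ObjectProperty.hom_ext _
        (GlueData.hom_ext (affineGlueData X s).basis fun U hU =>
          (congrArg InducedCategory.Hom.hom (hm ⟨U, hU⟩)).trans
            ((affineGlueData X s).ι_comp_desc ⟨U, hU⟩).symm) }⟩
  ι_open U := U.isOpenImmersion_ι

end Canonical

end

end BandTheory

/-! ### Uniqueness of the null space functor. -/

namespace BandTheory

noncomputable section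

open BandSpace Limits

/-! ### Comparison of null space functors -/

theorem exists_spec_map_eq {B C : BandCat.{u}ᵒᵖ} (g : Spec.obj B ⟶ Spec.obj C) :
    ∃ f : B ⟶ C, Spec.map f = g := by
  obtain ⟨f, hf⟩ := exists_specPshMap_eq (B := C.unop) (C := B.unop) g.hom
  exact ⟨Quiver.Hom.op (V := BandCat.{u}) f, ObjectProperty.hom_ext _ (BandSpace.Hom.ext hf)⟩

theorem exists_iso_spec {X : BandScheme.{u}} (hX : IsAffine X.obj) :
    ∃ B : BandCat.{u}ᵒᵖ, Nonempty (X ≅ Spec.obj B) := by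
  obtain ⟨B, ⟨e⟩⟩ := hX
  exact ⟨op B, ⟨ObjectProperty.isoMk _ e⟩⟩

theorem isAffine_spec_obj (B : BandCat.{u}ᵒᵖ) : IsAffine (Spec.obj B).obj :=
  isAffine_spec B.unop

theorem AffineOpens.isAffine {X : BandScheme.{u}} (U : AffineOpens X) : IsAffine U.toScheme.obj :=
  U.2

section Comparison

variable {N N' : BandScheme.{u} ⥤ TopCat.{u}} (ε : Spec ⋙ N ≅ Spec ⋙ N')

/-- The extension of an isomorphism on spectra to affine band schemes. -/
def affineComparison (X : BandScheme.{u}) (hX : IsAffine X.obj) : N.obj X ≅ N'.obj X :=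
  N.mapIso (exists_iso_spec hX).choose_spec.some ≪≫ ε.app _ ≪≫
    N'.mapIso (exists_iso_spec hX).choose_spec.some.symm

/-- By fullness of `Spec`, `f` becomes the image of a band morphism under the chosen isomorphism of
`X` with a spectrum, and `ε` is natural in band morphisms. Taking `f` to be an isomorphism shows
that the choice does not matter. -/
theorem map_comp_app_eq {X : BandScheme.{u}} (hX : IsAffine X.obj) {B : BandCat.{u}ᵒᵖ}
    (f : X ⟶ Spec.obj B) :
    N.map f ≫ ε.hom.app B = (affineComparison ε X hX).hom ≫ N'.map f := by
  let e := (exists_iso_spec hX).choose_spec.some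
  obtain ⟨g, hg⟩ := exists_spec_map_eq (e.inv ≫ f)
  have hf : f = e.hom ≫ Spec.map g := by rw [hg, e.hom_inv_id_assoc]
  have hn : N.map (Spec.map g) ≫ ε.hom.app B = ε.hom.app _ ≫ N'.map (Spec.map g) :=
    ε.hom.naturality g
  rw [hf, N.map_comp, N'.map_comp, Category.assoc, hn]
  change N.map e.hom ≫ _ = (N.map e.hom ≫ ε.hom.app _ ≫ N'.map e.inv) ≫ _
  simp only [Category.assoc, ← N'.map_comp_assoc, e.inv_hom_id, N'.map_id, Category.id_comp]

theorem affineComparison_spec (B : BandCat.{u}ᵒᵖ) (h : IsAffine (Spec.obj B).obj) :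
    (affineComparison ε (Spec.obj B) h).hom = ε.hom.app B := by
  have := map_comp_app_eq ε h (𝟙 (Spec.obj B))
  rw [N.map_id, N'.map_id, Category.id_comp, Category.comp_id] at this
  exact this.symm

theorem affineComparison_naturality {X Y : BandScheme.{u}} (hX : IsAffine X.obj)
    (hY : IsAffine Y.obj) (f : X ⟶ Y) :
    N.map f ≫ (affineComparison ε Y hY).hom = (affineComparison ε X hX).hom ≫ N'.map f := by
  obtain ⟨B, ⟨e⟩⟩ := exists_iso_spec hY
  rw [← cancel_mono (N'.map e.hom), Category.assoc, Category.assoc, ← map_comp_app_eq,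
    ← N'.map_comp, ← map_comp_app_eq, N.map_comp, Category.assoc]

theorem eq_affineComparison (α : N ⟶ N') (h : Functor.whiskerLeft Spec α = ε.hom)
    {X : BandScheme.{u}} (hX : IsAffine X.obj) : α.app X = (affineComparison ε X hX).hom := by
  obtain ⟨B, ⟨e⟩⟩ := exists_iso_spec hX
  rw [← cancel_mono (N'.map e.hom), ← map_comp_app_eq, ← h, ← α.naturality]
  rfl

theorem affineComparison_comp {π : N ⟶ toTop} {π' : N' ⟶ toTop}
    (h : ε.hom ≫ Functor.whiskerLeft Spec π' = Functor.whiskerLeft Spec π)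
    {X : BandScheme.{u}} (hX : IsAffine X.obj) :
    (affineComparison ε X hX).hom ≫ π'.app X = π.app X := by
  obtain ⟨B, ⟨e⟩⟩ := exists_iso_spec hX
  have hB : ε.hom.app B ≫ π'.app (Spec.obj B) = π.app (Spec.obj B) := congrArg (fun t => t.app B) h
  rw [← cancel_mono (toTop.map e.hom), Category.assoc, ← π'.naturality, ← π.naturality, ← hB,
    ← Category.assoc, ← map_comp_app_eq, Category.assoc]

variable (X : BandScheme.{u}) (hN : IsColimit (N.mapCocone (affineCocone X)))
  (hN' : IsColimit (N'.mapCocone (affineCocone X)))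

/-- The comparison on the diagram of affine open subsets. -/
def diagramComparison : affineDiagram X ⋙ N ≅ affineDiagram X ⋙ N' :=
  NatIso.ofComponents (fun U => affineComparison ε U.toScheme U.isAffine)
    fun _ => affineComparison_naturality ε _ _ _

/-- The extension of an isomorphism on spectra to all band schemes. -/
def comparison : N.obj X ≅ N'.obj X :=
  hN.coconePointsIsoOfNatIso hN' (diagramComparison ε X)

theorem map_ι_comp_comparison (U : AffineOpens X) :
    N.map U.ι ≫ (comparison ε X hN hN').hom =
      (affineComparison ε U.toScheme U.isAffine).hom ≫ N'.map U.ι :=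
  IsColimit.comp_coconePointsIsoOfNatIso_hom hN hN' (diagramComparison ε X) U

end Comparison

theorem nullSpace_exists_map_eq {X : BandScheme.{u}} (U : AffineOpens X) (ξ : nullSpace.obj X)
    (h : nullSpacePi.app X ξ ∈ U.1) : ∃ ζ, nullSpace.map U.ι ζ = ξ := by
  have h1 : NullPoint.pt ξ ∈ Set.range (X.obj.ι U.1).hom.base := by
    rw [range_ι]
    exact h
  exact (NullPoint.range_map (X.obj.ι U.1)).superset h1

section Uniqueness

variable {N' : BandScheme.{u} ⥤ TopCat.{u}} (ε : Spec ⋙ nullSpace.{u} ≅ Spec ⋙ N')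
  (hN : ∀ X : BandScheme.{u}, IsColimit (nullSpace.mapCocone (affineCocone X)))
  (hN' : ∀ X : BandScheme.{u}, IsColimit (N'.mapCocone (affineCocone X)))

/-- A morphism from an affine band scheme to `X` need not factor through an affine open. Near each
point it does, and equality of continuous maps can be checked at points; on small affine opens it is
naturality of `affineComparison`. -/
theorem map_comp_comparison {T X : BandScheme.{u}} (hT : IsAffine T.obj) (g : T ⟶ X) :
    nullSpace.map g ≫ (comparison ε X (hN X) (hN' X)).hom =
      (affineComparison ε T hT).hom ≫ N'.map g := by
  refine TopCat.hom_ext (ContinuousMap.ext fun ξ => ?_)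
  obtain ⟨U, hxU, -, hU⟩ := IsBandScheme.exists_affine X.property
    (g.hom.hom.base (nullSpacePi.app T ξ)) ⊤ trivial
  obtain ⟨W, hxW, hWU, hW⟩ := IsBandScheme.exists_affine T.property (nullSpacePi.app T ξ)
    ((Opens.map g.hom.hom.base).obj U) hxU
  let U' : AffineOpens X := ⟨U, hU⟩
  let W' : AffineOpens T := ⟨W, hW⟩
  obtain ⟨ζ, rfl⟩ := nullSpace_exists_map_eq W' ξ hxW
  have hr : Set.range ((T.obj.ι W ≫ g.hom).hom.base) ⊆ Set.range (X.obj.ι U).hom.base := by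
    rw [range_ι]
    rintro _ ⟨t, rfl⟩
    exact hWU ((range_ι W).subset ⟨t, rfl⟩)
  let k₀ : T.obj.restrict W ⟶ X.obj.restrict U := lift (X.obj.ι U) (T.obj.ι W ≫ g.hom) hr
  have hk₀ : k₀ ≫ X.obj.ι U = T.obj.ι W ≫ g.hom := lift_fac _ _ _
  let k : W'.toScheme ⟶ U'.toScheme := ObjectProperty.homMk k₀
  have hk : k ≫ U'.ι = W'.ι ≫ g := ObjectProperty.hom_ext _ hk₀
  have key : nullSpace.map W'.ι ≫ nullSpace.map g ≫ (comparison ε X (hN X) (hN' X)).hom =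
      nullSpace.map W'.ι ≫ (affineComparison ε T hT).hom ≫ N'.map g := by
    rw [← nullSpace.map_comp_assoc, ← hk, nullSpace.map_comp_assoc, map_ι_comp_comparison,
      ← Category.assoc, affineComparison_naturality ε W'.isAffine, Category.assoc, ← N'.map_comp, hk,
      N'.map_comp, ← Category.assoc, ← affineComparison_naturality ε W'.isAffine hT, Category.assoc]
  exact ConcreteCategory.congr_hom key ζ

/-- The comparison isomorphism with the null space functor. -/
def comparisonIso : nullSpace ≅ N' :=
  NatIso.ofComponents (fun X => comparison ε X (hN X) (hN' X)) fun {Y X} f =>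
    (hN Y).hom_ext fun V => by
      change nullSpace.map V.ι ≫ _ ≫ _ = nullSpace.map V.ι ≫ _ ≫ _
      rw [← nullSpace.map_comp_assoc, map_comp_comparison ε hN hN' V.isAffine, ← Category.assoc,
        map_ι_comp_comparison, N'.map_comp, Category.assoc]

theorem comparisonIso_comp {π' : N' ⟶ toTop}
    (h : ε.hom ≫ Functor.whiskerLeft Spec π' = Functor.whiskerLeft Spec nullSpacePi) :
    (comparisonIso ε hN hN').hom ≫ π' = nullSpacePi := by
  refine NatTrans.ext (funext fun X => (hN X).hom_ext fun (U : AffineOpens X) => ?_)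
  change nullSpace.map U.ι ≫ (comparison ε X (hN X) (hN' X)).hom ≫ π'.app X =
    nullSpace.map U.ι ≫ nullSpacePi.app X
  rw [← Category.assoc, map_ι_comp_comparison, Category.assoc, π'.naturality,
    nullSpacePi.naturality, ← Category.assoc, affineComparison_comp ε h U.isAffine]

theorem whiskerLeft_comparisonIso :
    Functor.whiskerLeft Spec (comparisonIso ε hN hN').hom = ε.hom := by
  refine NatTrans.ext (funext fun B => ?_)
  have h := map_comp_comparison ε hN hN' (isAffine_spec_obj B) (𝟙 (Spec.obj B))
  rw [nullSpace.map_id, N'.map_id, Category.id_comp, Category.comp_id,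
    affineComparison_spec ε B] at h
  exact h

include hN in
theorem hom_ext_of_whiskerLeft {α β : nullSpace.{u} ⟶ N'}
    (hα : Functor.whiskerLeft Spec α = ε.hom) (hβ : Functor.whiskerLeft Spec β = ε.hom) :
    α = β := by
  refine NatTrans.ext (funext fun X => (hN X).hom_ext fun (U : AffineOpens X) => ?_)
  change nullSpace.map U.ι ≫ α.app X = nullSpace.map U.ι ≫ β.app X
  rw [α.naturality, β.naturality, eq_affineComparison ε α hα U.isAffine, eq_affineComparison ε β hβ U.isAffine]

end Uniqueness

theorem existsUnique_nullSpace_iso {N' : BandScheme.{u} ⥤ TopCat.{u}} {π' : N' ⟶ toTop}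
    {η' : Null ≅ Spec ⋙ N'} (h : IsNullSpaceFunctor N' π' η') :
    ∃! α : nullSpace.{u} ≅ N', α.hom ≫ π' = nullSpacePi ∧
      nullSpaceEta ≪≫ Functor.isoWhiskerLeft Spec α = η' := by
  let ε : Spec ⋙ nullSpace ≅ Spec ⋙ N' := nullSpaceEta.symm ≪≫ η'
  -- Compatibility with `η` and `η'` means that `α` restricts to `ε` on spectra. This determines `α`
  -- on affine band schemes, and hence everywhere by the colimit property.
  have hε : ∀ α : nullSpace.{u} ≅ N', nullSpaceEta ≪≫ Functor.isoWhiskerLeft Spec α = η' ↔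
      Functor.whiskerLeft Spec α.hom = ε.hom := fun α =>
    ⟨fun h => (Iso.eq_inv_comp _).2 (congrArg Iso.hom h), fun h => Iso.ext ((Iso.eq_inv_comp _).1 h)⟩
  have hN (X : BandScheme.{u}) := (isNullSpaceFunctor_nullSpace.isColimit _ _
    (isAffinePresentation_affineCocone X)).some
  have hN' (X : BandScheme.{u}) := (h.isColimit _ _ (isAffinePresentation_affineCocone X)).some
  refine ⟨comparisonIso ε hN hN', ⟨comparisonIso_comp ε hN hN' ?_, (hε _).2
    (whiskerLeft_comparisonIso ε hN hN')⟩, fun α hα => Iso.ext ?_⟩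
  -- On spectra, compatibility with the projections holds because both are `piBar` up to `η` and
  -- `η'`.
  · change (nullSpaceEta.inv ≫ η'.hom) ≫ _ = _
    rw [Category.assoc, ← h.piBar_eq, piBar_eq_nullSpaceEta, Iso.inv_hom_id_assoc]
  · exact hom_ext_of_whiskerLeft ε hN ((hε α).1 hα.2) (whiskerLeft_comparisonIso ε hN hN')

end

end BandTheory

theorem mainTheorem9 :
    ∃ (N : BandTheory.BandScheme.{u} ⥤ TopCat.{u}) (π : N ⟶ BandTheory.toTop)
      (η : BandTheory.Null ≅ BandTheory.Spec ⋙ N),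
      BandTheory.IsNullSpaceFunctor N π η ∧
      ∀ (N' : BandTheory.BandScheme.{u} ⥤ TopCat.{u}) (π' : N' ⟶ BandTheory.toTop)
        (η' : BandTheory.Null ≅ BandTheory.Spec ⋙ N'),
        BandTheory.IsNullSpaceFunctor N' π' η' →
          ∃! α : N ≅ N',
            α.hom ≫ π' = π ∧ η ≪≫ Functor.isoWhiskerLeft BandTheory.Spec α = η' :=
  ⟨BandTheory.nullSpace, BandTheory.nullSpacePi, BandTheory.nullSpaceEta,
    BandTheory.isNullSpaceFunctor_nullSpace,
    fun _ _ _ h => BandTheory.existsUnique_nullSpace_iso h⟩
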